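/- **Proposition (facets of skyscrapers).** Let $\mathbb R^3_+=[0,\infty)^3$, $\Delta^2=S^2\cap\mathbb R^3_+$ and $\Delta^1=S^1\cap\mathbb R^2_+$. *The entropy.* For $\mathbf n\in\Delta^2$ let $L_{\mathbf n}=\{\mathbf x\in\mathbb R^3:(\mathbf x,\mathbf n)=0\}$, and let $\Sigma_{\mathbf n}$ be the family of all surfaces $Q\subset\mathbb R^3$ that are unions of closed unit plaquettes of the lattice $\mathbb Z^3$ and whose orthogonal projection onto $L_{\mathbf n}$ is a homeomorphism. Let $Q_{\mathbf n}$ be one of the surfaces in $\Sigma_{\mathbf n}$ with the smallest Hausdorff distance to $L_{\mathbf n}$, and let $\#(B_R,Q_{\mathbf n})$ be the number of surfaces in $\Sigma_{\mathbf n}$ that coincide with $Q_{\mathbf n}$ outside the ball $B_R$ of radius $R$ centered at the origin. The entropy of lozenge tilings is $$\eta(\mathbf n)=\lim_{R\to\infty}\frac{\ln \#(B_R,Q_{\mathbf n})}{\pi R^2},\qquad \mathbf n\in\Delta^2 .$$ For $\nu=(\nu_1,\nu_2)\in\Delta^1$ let $$h(\nu)=-\Bigl(\nu_1\ln\frac{\nu_1}{\nu_1+\nu_2}+\nu_2\ln\frac{\nu_2}{\nu_1+\nu_2}\Bigr)\qquad(0\ln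 0=0)$$ be the entropy density of lattice staircases with normal $\nu$. *The surface.* Let $K=\{\mathbf x\in\mathbb R^3:(\mathbf x,\mathbf n)\ge\eta(\mathbf n)\text{ for all }\mathbf n\in\Delta^2\}$, let $\lambda=|\mathbb R^3_+\setminus K|^{-1/3}$, where $|\cdot|$ is the volume, and let $\mathfrak S=\lambda\,\partial K=\partial(\lambda K)$. Thus $\mathfrak S$ is the surface given by the dual Wulff construction for $\eta$, normalized so as to enclose volume $1$ together with $\partial\mathbb R^3_+$. (This surface describes the limit shape of a large random plane partition; that background fact is not part of the claim.) Then the following holds. 1. For every $\mathbf n\in\Delta^2$ a minimizer $Q_{\mathbf n}$ exists, and the limit defining $\eta(\mathbf n)$ exists and is the same for all choices of $Q_{\mathbf n}$. 2. For every $\nu\in\Delta^1$ the one-sided derivative of $\eta$ at $\mathbf e_z=(0,0,1)$ in the tangential direction $\nu$ equals $h(\nu)$: with $\mathbf n_\theta=\cos\theta\,\mathbf e_z+\sin\theta\,(\nu_1,\nu_2,0)$, $$\lim_{\theta\to0+}\frac{\eta(\mathbf n_\theta)-\eta(\mathbf e_z)}{\theta}=h(\nu).$$ 3. The normalization is possible: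 $0<|\mathbb R^3_+\setminus K|<\infty$, so that $|\mathbb R^3_+\setminus\lambda K|=1$. 4. $\mathfrak S$ has three identical flat facets, one in each of the three quadrants $(\mathbb R^2_+)_i=\{\mathbf x\in\mathbb R^3_+:x_i=0\}$, $i=1,2,3$, that form $\partial\mathbb R^3_+$: each set $\mathfrak S\cap(\mathbb R^2_+)_i$ is the intersection of the convex body $\lambda K$ with a support plane and has nonempty interior relative to that plane, and, when $\{x_i=0\}$ is identified with $\mathbb R^2$ by omitting the $i$-th coordinate, the three sets are one and the same set $F\subset\mathbb R^2$. The boundary $\partial F$ in $\mathbb R^2$ is a scaled Vershik–Kerov curve: there is $c>0$ with $$\partial F=c\,\mathcal C_{VK},\qquad \mathcal C_{VK}=\Bigl\{(x,y)\in\mathbb R^2: e^{-\pi x/\sqrt6}+e^{-\pi y/\sqrt6}=1\Bigr\}.$$ -/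

import Mathlib

open Real Set Filter Topology MeasureTheory
open scoped Pointwise

noncomputable section

namespace SkyscraperFacets

/-- Euclidean space `ℝ³`. -/
abbrev E3 : Type := EuclideanSpace ℝ (Fin 3)

/-- The Euclidean plane `ℝ²`. -/
abbrev E2 : Type := EuclideanSpace ℝ (Fin 2)

/-- The closed positive octant `ℝ³₊`. -/
def octant : Set E3 := {x | ∀ j, 0 ≤ x j}

/-- The three quadrants `(ℝ²₊)ᵢ` which together form the boundary of the octant. -/
def quadrant (i : Fin 3) : Set E3 := {x | x i = 0 ∧ ∀ j, 0 ≤ x j}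

/-- The spherical triangle `Δ² = S² ∩ ℝ³₊`. -/
def sphTriangle : Set E3 := {n | ‖n‖ = 1 ∧ ∀ j, 0 ≤ n j}

/-- The quarter circle `Δ¹ = S¹ ∩ ℝ²₊`. -/
def quarterCircle : Set E2 := {v | ‖v‖ = 1 ∧ ∀ j, 0 ≤ v j}

/-! ### Stepped surfaces and the entropy of lozenge tilings -/

/-- The closed unit plaquette of the lattice `ℤ³` that is orthogonal to the `i`-th axis and whose
least vertex is `a`. -/
def plaquette (a : Fin 3 → ℤ) (i : Fin 3) : Set E3 :=
  {x | x i = a i ∧ ∀ j, j ≠ i → (a j : ℝ) ≤ x j ∧ x j ≤ a j + 1}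

/-- The plane `L_n` through the origin which is orthogonal to `n`. -/
def plane (n : E3) : Submodule ℝ E3 := (ℝ ∙ n)ᗮ

/-- The family `Σ_n` of all surfaces which are made from unit plaquettes and are mapped
homeomorphically onto `L_n` by the orthogonal projection. -/
def steppedSurfaces (n : E3) : Set (Set E3) :=
  {Q | (∃ P : Set ((Fin 3 → ℤ) × Fin 3), Q = ⋃ p ∈ P, plaquette p.1 p.2) ∧
    IsHomeomorph (fun q : Q => (plane n).orthogonalProjectionOnto (q : E3))}

/-- The surfaces in `Σ_n` which minimize the (Hausdorff) distance to the plane `L_n`. -/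
def flattestSurfaces (n : E3) : Set (Set E3) :=
  {Q | Q ∈ steppedSurfaces n ∧ ∀ Q' ∈ steppedSurfaces n,
    Metric.hausdorffEDist Q (plane n : Set E3) ≤ Metric.hausdorffEDist Q' (plane n : Set E3)}

/-- The number `#(B_R, Q₀)` of surfaces in `Σ_n` which coincide with `Q₀` outside the ball `B_R`
of radius `R` centered at the origin. -/
def surfaceCount (n : E3) (Q₀ : Set E3) (R : ℝ) : ℕ :=
  {Q | Q ∈ steppedSurfaces n ∧ Q \ Metric.ball 0 R = Q₀ \ Metric.ball 0 R}.ncard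

/-- The logarithm of `#(B_R, Q₀)` per unit area. -/
def entropyDensity (n : E3) (Q₀ : Set E3) (R : ℝ) : ℝ :=
  Real.log (surfaceCount n Q₀ R) / (π * R ^ 2)

/-- One of the flattest surfaces, `Q_n`. -/
def flattestSurface (n : E3) : Set E3 := Classical.epsilon fun Q => Q ∈ flattestSurfaces n

/-- The entropy function `η` of lozenge tilings,
`η(n) = lim_{R → ∞} ln #(B_R, Q_n) / (π R²)`. -/
def eta (n : E3) : ℝ := limUnder atTop fun R : ℝ => entropyDensity n (flattestSurface n) R

/-! ### The dual Wulff construction -/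

/-- The body `K_f^> = {x | ∀ n ∈ Δ², (x, n) ≥ f(n)}`. -/
def dualWulffBody (f : E3 → ℝ) : Set E3 := {x | ∀ n ∈ sphTriangle, f n ≤ inner ℝ x n}

/-- The dilatation factor for which the dilated surface encloses, together with the boundary of the
octant, a region of volume one. -/
def dualWulffScale (f : E3 → ℝ) : ℝ :=
  (volume (octant \ dualWulffBody f)).toReal ^ (-(1 / 3) : ℝ)

/-- The convex body above the surface `V_f`. -/
def normalizedBody (f : E3 → ℝ) : Set E3 := dualWulffScale f • dualWulffBody f

/-- The surface `V_f`: the dilatation of `G_f = ∂ K_f^>` that encloses volume one. -/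
def dualWulffSurface (f : E3 → ℝ) : Set E3 := dualWulffScale f • frontier (dualWulffBody f)

/-- `F` is a facet of the boundary of the convex body `B`: the intersection of `B` with a support
plane, having nonempty interior relative to that plane. -/
def IsFacet (B F : Set E3) : Prop :=
  ∃ (m : E3) (a : ℝ), m ≠ 0 ∧ (∀ x ∈ B, a ≤ inner ℝ m x) ∧ F = B ∩ {x | inner ℝ m x = a} ∧
    (interior ((↑) ⁻¹' F : Set {x : E3 | inner ℝ m x = a})).Nonempty

/-- The isometric embedding of `ℝ²` onto the coordinate plane `{x | x i = 0}` of `ℝ³`. -/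
def embed (i : Fin 3) (p : E2) : E3 :=
  WithLp.toLp 2 (Fin.insertNth (α := fun _ => ℝ) i 0 fun k => p k)

/-! ### Staircases and the Vershik–Kerov curve -/

/-- The entropy density `h` of lattice staircases with normal direction `v`. -/
def stairEntropy (v : E2) : ℝ :=
  -(v 0 * Real.log (v 0 / (v 0 + v 1)) + v 1 * Real.log (v 1 / (v 0 + v 1)))

/-- The Vershik–Kerov curve. -/
def vershikKerov : Set E2 :=
  {p | Real.exp (-(π / √6) * p 0) + Real.exp (-(π / √6) * p 1) = 1}

/-- The unit vector `n_θ = cos θ e_z + sin θ v` at angle `θ` from `e_z` in the tangential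
direction `v`. -/
def tilt (v : E2) (θ : ℝ) : E3 := !₂[Real.sin θ * v 0, Real.sin θ * v 1, Real.cos θ]

end SkyscraperFacets

end

open SkyscraperFacets

/-! A stepped surface is the boundary of a set of unit cubes that is downward closed and invariant
in the coordinate directions in which n vanishes (`surf_mem_steppedSurfaces`,
`exists_isDown_of_mem_steppedSurfaces`). Flattest surfaces stay at bounded distance from `plane n`.
If a coordinate of n is zero, the surface is determined by its part outside the ball, and η(n) = 0.
If all coordinates are positive, surfaces are graphs of antitone arrays ℤ² → ℤ over the first and
third coordinates, prescribed outside an ellipse.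

The limit. The logarithm of the number of arrays is superadditive over separated regions
(`ent_sum_le`). Since both slopes are nonzero, one flat boundary condition can be turned into
another across a strip of bounded width (`exists_box_comparison`). So all flat arrays have one
common rate β per unit area in large boxes. Filling the ellipse with boxes bounds its entropy below;
filling the complement of the ellipse in a large box bounds it above (`ent_latticeEllipse_le`). The
area of the ellipse contributes the factor n 1, so η(n) = n 1 * β.

The derivative. Each row of an array, with the third coordinate fixed, is a staircase. Forgetting
the constraints between rows gives η(n) ≤ `pairEntropy (n 0) (n 1)`, which is sin θ h(ν) for n =
n_θ. As n tends to e_z, the drop from one row to the next tends to infinity, so that staircases in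
long blocks of the rows become independent and the bound is sharp to first order.

The facets. For x with x i = 0, normals tending to the i-th axis turn the constraints of K into (p,
ν) ≥ h(ν), where p is the remaining pair of coordinates. By the Gibbs variational principle this
means exp(-p 0) + exp(-p 1) ≤ 1. Conversely the bound by `pairEntropy`, valid for all n and, by
symmetry, for all pairs of coordinates, shows that this condition on one pair already puts a point
of the octant into K. This determines the facets, and it makes the complement of K exponentially
thin along the axes, hence of finite volume. -/

namespace SkyscraperFacets

/-! ### Stepped surfaces as boundaries of downward closed sets of cubes -/

/-- A set of unit cubes, each given by its least vertex, which is downward closed and invariant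
in the directions in which `n` vanishes. -/
def IsDown (n : E3) (U : Set (Fin 3 → ℤ)) : Prop :=
  ∀ c c' : Fin 3 → ℤ, (∀ i, n i ≠ 0 → c' i ≤ c i) → c ∈ U → c' ∈ U

/-- The boundary of the union of a downward closed set of unit cubes. -/
def surf (U : Set (Fin 3 → ℤ)) : Set E3 :=
  {x | (fun i => ⌈x i⌉ - 1) ∈ U ∧ (fun i => ⌊x i⌋) ∉ U}

/-- The plaquettes which separate a cube in `U` from a cube outside of `U`. -/
def faces (U : Set (Fin 3 → ℤ)) : Set ((Fin 3 → ℤ) × Fin 3) :=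
  {p | p.1 - Pi.single p.2 1 ∈ U ∧ p.1 ∉ U}

lemma IsDown.isLowerSet {n : E3} {U : Set (Fin 3 → ℤ)} (h : IsDown n U) : IsLowerSet U :=
  fun c c' hc hcU => h c c' (fun i _ => hc i) hcU

/-- The integers ⌈t⌉ - 1 and ⌊t⌋ differ only if t is an integer, and then by one. So if changing the
coordinate i leaves `U`, then x i is an integer and x lies on the plaquette between the two cubes.
-/
lemma exists_face_of_update {U : Set (Fin 3 → ℤ)} {x : E3} {c : Fin 3 → ℤ} (i : Fin 3)
    (hc : c ∈ U) (hc' : Function.update c i ⌊x i⌋ ∉ U)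
    (hx : ∀ j, (c j : ℝ) ≤ x j ∧ x j ≤ c j + 1) (hi : c i = ⌈x i⌉ - 1) :
    ∃ p ∈ faces U, x ∈ plaquette p.1 p.2 := by
  have h1 : ⌊x i⌋ = c i + 1 := by
    by_contra hne
    have h2 : ⌊x i⌋ = c i := by
      have h3 : c i ≤ ⌊x i⌋ := Int.le_floor.2 (hx i).1
      have h4 : ⌊x i⌋ ≤ ⌈x i⌉ := Int.floor_le_ceil _
      omega
    rw [h2, Function.update_eq_self] at hc'
    exact hc' hc
  refine ⟨(Function.update c i ⌊x i⌋, i), ⟨?_, hc'⟩, ?_, ?_⟩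
  · convert hc using 1
    ext j
    rcases eq_or_ne j i with rfl | h
    · simp [h1]
    · simp [h]
  · simp only [Function.update_self]
    have h5 : x i ≤ ⌈x i⌉ := Int.le_ceil _
    have h6 : (⌊x i⌋ : ℝ) ≤ x i := Int.floor_le _
    have h7 : (⌈x i⌉ : ℝ) = ⌊x i⌋ := by exact_mod_cast (by omega : ⌈x i⌉ = ⌊x i⌋)
    linarith
  · intro j hj
    simpa [hj] using hx j

lemma ceil_sub_one_bounds (t : ℝ) : ((⌈t⌉ - 1 : ℤ) : ℝ) ≤ t ∧ t ≤ ((⌈t⌉ - 1 : ℤ) : ℝ) + 1 := by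
  push_cast
  constructor <;> linarith [Int.le_ceil t, Int.ceil_lt_add_one t]

lemma floor_bounds (t : ℝ) : (⌊t⌋ : ℝ) ≤ t ∧ t ≤ (⌊t⌋ : ℝ) + 1 :=
  ⟨Int.floor_le t, (Int.lt_floor_add_one t).le⟩

/-- Pass from the cube ⌈x⌉ - 1 to the cube ⌊x⌋ by changing one coordinate at a time. All cubes on
the way contain x, and the first change that leaves `U` crosses a face through x. -/
lemma surf_eq_iUnion {U : Set (Fin 3 → ℤ)} (hU : IsLowerSet U) :
    surf U = ⋃ p ∈ faces U, plaquette p.1 p.2 := by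
  apply Subset.antisymm
  · rintro x ⟨h1, h2⟩
    simp only [mem_iUnion, exists_prop]
    set c0 : Fin 3 → ℤ := fun i => ⌈x i⌉ - 1
    have key : ∀ s : Fin 3 → Bool, ∀ j, (((fun i => if s i then ⌊x i⌋ else ⌈x i⌉ - 1) j : ℤ) : ℝ) ≤ x j ∧
        x j ≤ ((fun i => if s i then ⌊x i⌋ else ⌈x i⌉ - 1) j : ℤ) + 1 := by
      intro s j
      by_cases h : s j
      · simpa [h] using floor_bounds (x j)
      · simpa only [h, Bool.false_eq_true, if_false] using ceil_sub_one_bounds (x j)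
    let c (s : Fin 3 → Bool) : Fin 3 → ℤ := fun i => if s i then ⌊x i⌋ else ⌈x i⌉ - 1
    have step : ∀ (s : Fin 3 → Bool) (i : Fin 3), s i = false → c s ∈ U →
        c (Function.update s i true) ∉ U → ∃ p ∈ faces U, x ∈ plaquette p.1 p.2 := by
      intro s i hs h3 h4
      refine exists_face_of_update i h3 ?_ (key s) (by simp [c, hs])
      convert h4 using 2
      ext j
      rcases eq_or_ne j i with rfl | h
      · simp [c]
      · simp [c, h]
    by_cases g1 : c (Function.update (fun _ => false) 0 true) ∈ U
    swap
    · exact step _ 0 rfl (by simpa [c] using h1) g1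
    by_cases g2 : c (Function.update (Function.update (fun _ => false) 0 true) 1 true) ∈ U
    swap
    · exact step _ 1 rfl g1 g2
    refine step _ 2 rfl g2 ?_
    convert h2 using 2
    ext j
    fin_cases j <;> simp [c, Function.update]
  · intro x hx
    simp only [mem_iUnion, exists_prop] at hx
    obtain ⟨⟨a, i⟩, ⟨h1, h2⟩, h3, h4⟩ := hx
    simp only at h1 h2 h3 h4
    constructor
    · refine hU (fun j => ?_) h1
      rcases eq_or_ne j i with rfl | h
      · simp [h3]
      · have : ⌈x j⌉ ≤ a j + 1 := Int.ceil_le.2 (by push_cast; exact (h4 j h).2)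
        simp [h]; omega
    · refine fun h => h2 (hU (fun j => ?_) h)
      rcases eq_or_ne j i with rfl | h
      · simp [h3]
      · exact Int.le_floor.2 (h4 j h).1

lemma coe_proj_plane {n : E3} (hn : ‖n‖ = 1) (x : E3) :
    (((plane n).orthogonalProjectionOnto x : plane n) : E3) = x - inner ℝ n x • n := by
  rw [Submodule.coe_orthogonalProjectionOnto_apply]
  unfold plane
  rw [Submodule.starProjection_orthogonal_val, Submodule.starProjection_unit_singleton ℝ hn]

/-- If x were smaller than y in every coordinate with n i ≠ 0, then ⌊x i⌋ ≤ ⌈y i⌉ - 1 for these i,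
and the cube above x would belong to `U` together with the one below y. -/
lemma not_lt_of_mem_surf {n : E3} {U : Set (Fin 3 → ℤ)} (hU : IsDown n U) {x y : E3}
    (hx : x ∈ surf U) (hy : y ∈ surf U) : ∃ i, n i ≠ 0 ∧ y i ≤ x i := by
  by_contra! h
  refine hx.2 (hU _ _ (fun i hi => ?_) hy.1)
  have h1 := h i hi
  have h2 : (⌊x i⌋ : ℝ) < ⌈y i⌉ := by linarith [Int.floor_le (x i), Int.le_ceil (y i)]
  have h3 : ⌊x i⌋ < ⌈y i⌉ := by exact_mod_cast h2
  omega

lemma abs_apply_le_norm (x : E3) (i : Fin 3) : |x i| ≤ ‖x‖ := by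
  simpa using PiLp.norm_apply_le x i

lemma exists_pos_le_apply (n : E3) (hn0 : ∀ j, 0 ≤ n j) :
    ∃ μ : ℝ, 0 < μ ∧ ∀ i, n i ≠ 0 → μ ≤ n i := by
  have h : ∀ i, ∃ μ : ℝ, 0 < μ ∧ (n i ≠ 0 → μ ≤ n i) := fun i => by
    by_cases h : n i = 0
    · exact ⟨1, one_pos, fun h' => absurd h h'⟩
    · exact ⟨n i, lt_of_le_of_ne (hn0 i) (Ne.symm h), fun _ => le_rfl⟩
  choose μ h1 h2 using h
  refine ⟨Finset.univ.inf' Finset.univ_nonempty μ, ?_, fun i hi => ?_⟩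
  · rw [Finset.lt_inf'_iff]
    exact fun i _ => h1 i
  · exact (Finset.inf'_le _ (Finset.mem_univ i)).trans (h2 i hi)

lemma isClosed_ceil_mem (U : Set (Fin 3 → ℤ)) (hU : IsLowerSet U) :
    IsClosed {x : E3 | (fun i => ⌈x i⌉ - 1) ∈ U} := by
  rw [← isOpen_compl_iff, isOpen_iff_mem_nhds]
  intro x hx
  have h1 : {y : E3 | ∀ i, ((⌈x i⌉ - 1 : ℤ) : ℝ) < y i} ∈ 𝓝 x := by
    refine IsOpen.mem_nhds ?_ (fun i => ?_)
    · simp only [ofPred_forall]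
      exact isOpen_iInter_of_finite fun i => isOpen_lt continuous_const (by fun_prop)
    · push_cast; linarith [Int.ceil_lt_add_one (x i)]
  filter_upwards [h1] with y hy hyU
  refine hx (hU (fun i => ?_) hyU)
  have := Int.lt_ceil.2 (hy i)
  show ⌈x i⌉ - 1 ≤ ⌈y i⌉ - 1
  omega

lemma isClosed_floor_notMem (U : Set (Fin 3 → ℤ)) (hU : IsLowerSet U) :
    IsClosed {x : E3 | (fun i => ⌊x i⌋) ∉ U} := by
  rw [← isOpen_compl_iff, isOpen_iff_mem_nhds]
  intro x hx
  have hx' : (fun i => ⌊x i⌋) ∈ U := by simpa using hx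
  have h1 : {y : E3 | ∀ i, y i < ((⌊x i⌋ + 1 : ℤ) : ℝ)} ∈ 𝓝 x := by
    refine IsOpen.mem_nhds ?_ (fun i => ?_)
    · simp only [ofPred_forall]
      exact isOpen_iInter_of_finite fun i => isOpen_lt (by fun_prop) continuous_const
    · push_cast; exact Int.lt_floor_add_one (x i)
  filter_upwards [h1] with y hy
  simp only [mem_compl_iff, mem_ofPred_eq, not_not]
  refine hU (fun i => ?_) hx'
  have := Int.floor_lt.2 (hy i)
  show ⌊y i⌋ ≤ ⌊x i⌋
  omega

/-- The line is connected and covered by the closed conditions ⌈·⌉ - 1 ∈ U and ⌊·⌋ ∉ U. The first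
holds far down, the second far up, so they hold together somewhere. -/
lemma exists_mem_surf_line {n : E3} (hn : n ∈ sphTriangle) {U : Set (Fin 3 → ℤ)}
    (hU : IsDown n U) (h1 : U.Nonempty) (h2 : U ≠ univ) (p : E3) : ∃ t : ℝ, p + t • n ∈ surf U := by
  obtain ⟨a, ha⟩ := h1
  obtain ⟨b, hb⟩ := (ne_univ_iff_exists_notMem U).1 h2
  have hcont : Continuous fun t : ℝ => p + t • n := by fun_prop
  have hA := (isClosed_ceil_mem U hU.isLowerSet).preimage hcont
  have hB := (isClosed_floor_notMem U hU.isLowerSet).preimage hcont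
  have hpc := isPreconnected_closed_iff.1 (isPreconnected_univ (α := ℝ)) _ _ hA hB
  obtain ⟨μ, hμ, hμn⟩ := exists_pos_le_apply n hn.2
  have hM : ∃ M : ℝ, 0 ≤ M ∧ ∀ i, |p i| + |(a i : ℝ)| + |(b i : ℝ)| + 1 ≤ M := by
    refine ⟨∑ i, (|p i| + |(a i : ℝ)| + |(b i : ℝ)| + 1), by positivity, fun i => ?_⟩
    exact Finset.single_le_sum (f := fun i => |p i| + |(a i : ℝ)| + |(b i : ℝ)| + 1)
      (fun i _ => by positivity) (Finset.mem_univ i)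
  obtain ⟨M, hM0, hM⟩ := hM
  -- Up to the parameter M / μ every coordinate with n i ≠ 0 moves by at least M, hence past both a
  -- and b. The other coordinates do not matter by `IsDown`.
  have hMn : ∀ i, n i ≠ 0 → M ≤ M / μ * n i := fun i hi => by
    rw [div_mul_eq_mul_div, le_div_iff₀ hμ]
    exact mul_le_mul_of_nonneg_left (hμn i hi) hM0
  suffices h : (univ ∩ ((fun t : ℝ => p + t • n) ⁻¹' {x : E3 | (fun i => ⌈x i⌉ - 1) ∈ U} ∩
      (fun t : ℝ => p + t • n) ⁻¹' {x : E3 | (fun i => ⌊x i⌋) ∉ U})).Nonempty by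
    obtain ⟨t, -, ht1, ht2⟩ := h
    exact ⟨t, ht1, ht2⟩
  refine hpc ?_ ?_ ?_
  · intro t _
    by_contra h
    simp only [mem_union, mem_preimage, mem_ofPred_eq, not_or, not_not] at h
    refine h.1 (hU.isLowerSet (fun i => ?_) h.2)
    have := Int.ceil_le_floor_add_one ((p + t • n) i)
    show ⌈(p + t • n) i⌉ - 1 ≤ ⌊(p + t • n) i⌋
    omega
  · refine ⟨-(M / μ), mem_univ _, hU a _ (fun i hi => ?_) ha⟩
    have h3 : (p + -(M / μ) • n) i ≤ a i := by
      have := hM i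
      have := hMn i hi
      have := le_abs_self (p i)
      have := neg_abs_le (a i : ℝ)
      have := abs_nonneg (b i : ℝ)
      simp only [PiLp.add_apply, PiLp.smul_apply, smul_eq_mul]
      linarith
    have := Int.ceil_le.2 h3
    show ⌈(p + -(M / μ) • n) i⌉ - 1 ≤ a i
    omega
  · refine ⟨M / μ, mem_univ _, fun h => hb (hU _ b (fun i hi => ?_) h)⟩
    refine Int.le_floor.2 ?_
    have := hM i
    have := hMn i hi
    have := neg_abs_le (p i)
    have := le_abs_self (b i : ℝ)
    have := abs_nonneg (a i : ℝ)
    simp only [PiLp.add_apply, PiLp.smul_apply, smul_eq_mul]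
    linarith

/-- The surface is a Lipschitz graph over the plane. Write x - y as its projection plus τ n with τ ≥
0; some coordinate with n i ≥ μ does not increase from y to x, so τ μ is at most the norm of the
projection. -/
lemma norm_sub_le_of_mem_surf {n : E3} (hn : n ∈ sphTriangle) {U : Set (Fin 3 → ℤ)}
    (hU : IsDown n U) {μ : ℝ} (hμ : 0 < μ) (hμn : ∀ i, n i ≠ 0 → μ ≤ n i) {x y : E3}
    (hx : x ∈ surf U) (hy : y ∈ surf U) :
    ‖x - y‖ ≤ (1 + 1 / μ) * ‖(plane n).orthogonalProjectionOnto x -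
      (plane n).orthogonalProjectionOnto y‖ := by
  wlog hle : inner ℝ n y ≤ inner ℝ n x generalizing x y
  · rw [norm_sub_rev, norm_sub_rev ((plane n).orthogonalProjectionOnto x)]
    exact this hy hx (le_of_not_ge hle)
  set π' := (plane n).orthogonalProjectionOnto x - (plane n).orthogonalProjectionOnto y with hπ
  set τ := inner ℝ n x - inner ℝ n y with hτ
  have h0 : 0 ≤ τ := by linarith
  have h1 : x - y = (π' : E3) + τ • n := by
    rw [hπ, Submodule.coe_sub, coe_proj_plane hn.1, coe_proj_plane hn.1, hτ, sub_smul]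
    abel
  obtain ⟨i, hi, hle'⟩ := not_lt_of_mem_surf hU hy hx
  have h2 : (x - y) i ≤ 0 := by simpa using hle'
  rw [h1] at h2
  simp only [PiLp.add_apply, PiLp.smul_apply, smul_eq_mul] at h2
  have h3 : τ * μ ≤ ‖π'‖ := by
    have h4 := (neg_le_abs ((π' : E3) i)).trans (abs_apply_le_norm (π' : E3) i)
    have h5 := mul_le_mul_of_nonneg_left (hμn i hi) h0
    rw [Submodule.norm_coe] at h4
    linarith
  have h6 : τ ≤ 1 / μ * ‖π'‖ := by
    rw [one_div, ← div_eq_inv_mul, le_div_iff₀ hμ]; exact h3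
  calc ‖x - y‖ ≤ ‖(π' : E3)‖ + ‖τ • n‖ := by rw [h1]; exact norm_add_le _ _
    _ = ‖π'‖ + τ := by rw [norm_smul, hn.1, Real.norm_of_nonneg h0, Submodule.norm_coe, mul_one]
    _ ≤ _ := by linarith

lemma surf_mem_steppedSurfaces {n : E3} (hn : n ∈ sphTriangle) {U : Set (Fin 3 → ℤ)}
    (hU : IsDown n U) (h1 : U.Nonempty) (h2 : U ≠ univ) : surf U ∈ steppedSurfaces n := by
  refine ⟨⟨faces U, surf_eq_iUnion hU.isLowerSet⟩, ?_⟩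
  rw [isHomeomorph_iff_isEmbedding_surjective]
  obtain ⟨μ, hμ, hμn⟩ := exists_pos_le_apply n hn.2
  constructor
  · have hanti : AntilipschitzWith (Real.toNNReal (1 + 1 / μ))
        (fun q : surf U => (plane n).orthogonalProjectionOnto (q : E3)) := by
      refine AntilipschitzWith.of_le_mul_dist fun x y => ?_
      rw [Real.coe_toNNReal _ (by positivity), Subtype.dist_eq, dist_eq_norm, dist_eq_norm]
      exact norm_sub_le_of_mem_surf hn hU hμ hμn x.2 y.2
    refine (hanti.isUniformEmbedding ?_).isEmbedding
    exact (plane n).orthogonalProjectionOnto.uniformContinuous.comp uniformContinuous_subtype_val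
  · intro p
    obtain ⟨t, ht⟩ := exists_mem_surf_line hn hU h1 h2 (p : E3)
    refine ⟨⟨_, ht⟩, Subtype.ext ?_⟩
    have h3 : inner ℝ n (p : E3) = 0 := by
      have : (p : E3) ∈ (ℝ ∙ n)ᗮ := p.2
      rw [Submodule.mem_orthogonal_singleton_iff_inner_right] at this
      exact this
    rw [coe_proj_plane hn.1, inner_add_right, h3, inner_smul_right, real_inner_self_eq_norm_sq,
      hn.1]
    simp

/-! ### Every stepped surface bounds a downward closed set of cubes -/

/-- The center of the unit cube with least vertex `c`. -/
noncomputable def cubeCenter (c : Fin 3 → ℤ) : E3 := WithLp.toLp 2 fun i => (c i : ℝ) + 1 / 2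

/-- The center of the plaquette orthogonal to the `i`-th axis with least vertex `a`. -/
noncomputable def faceCenter (a : Fin 3 → ℤ) (i : Fin 3) : E3 :=
  WithLp.toLp 2 fun j => if j = i then (a j : ℝ) else (a j : ℝ) + 1 / 2

/-- The open unit cube with least vertex `c`. -/
def openCube (c : Fin 3 → ℤ) : Set E3 := {z | ∀ i, z i ∈ Ioo (c i : ℝ) (c i + 1)}

lemma convex_openCube (c : Fin 3 → ℤ) : Convex ℝ (openCube c) :=
  fun _ hx _ hy _ _ ha hb hab i => (convex_Ioo (c i : ℝ) (c i + 1)) (hx i) (hy i) ha hb hab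

lemma cubeCenter_mem_openCube (c : Fin 3 → ℤ) : cubeCenter c ∈ openCube c := fun i => by
  simp only [cubeCenter, mem_Ioo]
  constructor <;> linarith

lemma int_eq_of_bounds {a b : ℤ} {t : ℝ} (h1 : (a : ℝ) < t) (h2 : t < a + 1) (h3 : (b : ℝ) ≤ t)
    (h4 : t ≤ b + 1) : b = a := by
  have h5 : (b : ℝ) < a + 1 := by linarith
  have h6 : (a : ℝ) < b + 1 := by linarith
  have h7 : b < a + 1 := by exact_mod_cast h5
  have h8 : a < b + 1 := by exact_mod_cast h6
  omega

lemma int_ne_of_bounds {a b : ℤ} {t : ℝ} (h1 : (a : ℝ) < t) (h2 : t < a + 1) : t ≠ b := by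
  rintro rfl
  have h3 : a < b := by exact_mod_cast h1
  have h4 : b < a + 1 := by exact_mod_cast h2
  omega

lemma notMem_plaquette_of_mem_openCube {c a : Fin 3 → ℤ} {i : Fin 3} {z : E3}
    (hz : z ∈ openCube c) : z ∉ plaquette a i :=
  fun h => int_ne_of_bounds (hz i).1 (hz i).2 h.1

lemma eq_of_mem_plaquette {a b : Fin 3 → ℤ} {i j : Fin 3} {z : E3} (hi : z i = a i)
    (hz : ∀ k, k ≠ i → z k ∈ Ioo (a k : ℝ) (a k + 1)) (h : z ∈ plaquette b j) :
    b = a ∧ j = i := by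
  have hj : j = i := by
    by_contra hne
    exact int_ne_of_bounds (hz j hne).1 (hz j hne).2 h.1
  subst hj
  refine ⟨funext fun k => ?_, rfl⟩
  rcases eq_or_ne k j with rfl | hk
  · have : (b k : ℝ) = a k := by rw [← h.1, hi]
    exact_mod_cast this
  · exact int_eq_of_bounds (hz k hk).1 (hz k hk).2 (h.2 k hk).1 (h.2 k hk).2

lemma faceCenter_apply_ne {a : Fin 3 → ℤ} {i k : Fin 3} (h : k ≠ i) :
    faceCenter a i k = a k + 1 / 2 := by simp [faceCenter, h]

lemma faceCenter_apply_self (a : Fin 3 → ℤ) (i : Fin 3) : faceCenter a i i = a i := by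
  simp [faceCenter]

lemma faceCenter_mem_Ioo (a : Fin 3 → ℤ) (i k : Fin 3) (h : k ≠ i) :
    faceCenter a i k ∈ Ioo (a k : ℝ) (a k + 1) := by
  rw [faceCenter_apply_ne h]
  constructor <;> linarith

lemma isDown_of_step {n : E3} {U : Set (Fin 3 → ℤ)}
    (h1 : ∀ (a : Fin 3 → ℤ) i, a ∈ U → a - Pi.single i 1 ∈ U)
    (h2 : ∀ (a : Fin 3 → ℤ) i, n i = 0 → a - Pi.single i 1 ∈ U → a ∈ U) : IsDown n U := by
  have h3 : ∀ i (k : ℕ) (a : Fin 3 → ℤ), a ∈ U → a - k • Pi.single i 1 ∈ U := by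
    intro i k
    induction k with
    | zero => intro a ha; simpa using ha
    | succ k ih =>
      intro a ha
      have := h1 _ i (ih a ha)
      rwa [sub_sub, ← succ_nsmul] at this
  have h4 : ∀ i, n i = 0 → ∀ (k : ℕ) (a : Fin 3 → ℤ), a ∈ U → a + k • Pi.single i 1 ∈ U := by
    intro i hi k
    induction k with
    | zero => intro a ha; simpa using ha
    | succ k ih =>
      intro a ha
      refine h2 _ i hi ?_
      rw [succ_nsmul, ← add_assoc, add_sub_cancel_right]
      exact ih a ha
  have h5 : ∀ i (v : ℤ) (c : Fin 3 → ℤ), (n i ≠ 0 → v ≤ c i) → c ∈ U →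
      Function.update c i v ∈ U := by
    intro i v c hv hc
    rcases le_or_gt v (c i) with h | h
    · convert h3 i (c i - v).toNat c hc using 1
      ext j
      rcases eq_or_ne j i with rfl | hj
      · simp [Int.toNat_of_nonneg (sub_nonneg.2 h)]
      · simp [hj]
    · have hi : n i = 0 := by by_contra h'; exact absurd (hv h') (not_le.2 h)
      convert h4 i hi (v - c i).toNat c hc using 1
      ext j
      rcases eq_or_ne j i with rfl | hj
      · simp [Int.toNat_of_nonneg (sub_nonneg.2 h.le)]
      · simp [hj]
  intro c c' hcc hc
  have h6 := h5 2 (c' 2) _ (by simpa using hcc 2)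
    (h5 1 (c' 1) _ (by simpa using hcc 1) (h5 0 (c' 0) c (hcc 0) hc))
  convert h6 using 1
  ext j
  fin_cases j <;> simp [Function.update]

lemma mem_segment_sub_single {x : E3} {i : Fin 3} {z : E3}
    (hz : z ∈ segment ℝ (x - EuclideanSpace.single i 1) x) :
    (∀ k, k ≠ i → z k = x k) ∧ x i - 1 ≤ z i ∧ z i ≤ x i := by
  obtain ⟨a, b, ha, hb, hab, rfl⟩ := hz
  refine ⟨fun k hk => ?_, ?_, ?_⟩
  · simp [hk]; rw [← add_mul, hab, one_mul]
  · have : a * x i + b * x i = x i := by rw [← add_mul, hab, one_mul]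
    simp; linarith
  · have : a * x i + b * x i = x i := by rw [← add_mul, hab, one_mul]
    simp; linarith

/-- `U` consists of the cubes whose center lies below Q. Neighboring cubes are on different sides of
Q exactly if the plaquette between them belongs to Q, so the plaquettes of Q are the faces of `U`.
-/
theorem exists_isDown_of_mem_steppedSurfaces {n : E3} (hn : n ∈ sphTriangle) {Q : Set E3}
    (hQ : Q ∈ steppedSurfaces n) :
    ∃ U, IsDown n U ∧ U.Nonempty ∧ U ≠ univ ∧ Q = surf U := by
  obtain ⟨⟨P, hP⟩, hhom⟩ := hQ
  have hnn : inner ℝ n n = (1 : ℝ) := by rw [real_inner_self_eq_norm_sq, hn.1]; norm_num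
  have hn1 : ∀ i, n i ≤ 1 := fun i =>
    ((le_abs_self _).trans (abs_apply_le_norm n i)).trans hn.1.le
  set e := hhom.homeomorph with he
  set g : E3 → E3 := fun x => (e.symm ((plane n).orthogonalProjectionOnto x) : E3) with hg
  -- The signed height of Q above x in direction n: it is continuous, vanishes exactly on Q and is
  -- positive below Q.
  set T : E3 → ℝ := fun x => inner ℝ n (g x) - inner ℝ n x with hTdef
  have hgc : Continuous g := continuous_subtype_val.comp
    (e.symm.continuous.comp (plane n).orthogonalProjectionOnto.continuous)
  have hTc : Continuous T := by fun_prop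
  have hproj : ∀ (x : E3) (t : ℝ), (plane n).orthogonalProjectionOnto (x + t • n) =
      (plane n).orthogonalProjectionOnto x := by
    intro x t
    apply Subtype.ext
    rw [coe_proj_plane hn.1, coe_proj_plane hn.1, inner_add_right, inner_smul_right, hnn, mul_one,
      add_smul]
    abel
  have hgT : ∀ x, x + T x • n = g x := by
    intro x
    have h1 : (plane n).orthogonalProjectionOnto (g x) = (plane n).orthogonalProjectionOnto x :=
      e.apply_symm_apply ((plane n).orthogonalProjectionOnto x)
    have h2 := congrArg (Subtype.val) h1
    rw [coe_proj_plane hn.1, coe_proj_plane hn.1] at h2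
    have h4 : T x • n = inner ℝ n (g x) • n - inner ℝ n x • n := sub_smul _ _ _
    rw [h4, ← add_sub_assoc, add_sub_right_comm, ← h2, sub_add_cancel]
  have hT : ∀ x t, x + t • n ∈ Q ↔ t = T x := by
    intro x t
    constructor
    · intro h
      have h1 : g x = x + t • n := by
        have h2 : e ⟨x + t • n, h⟩ = (plane n).orthogonalProjectionOnto x := hproj x t
        rw [hg]
        simp only
        rw [← h2, e.symm_apply_apply]
      rw [hTdef]
      simp only
      rw [h1, inner_add_right, inner_smul_right, hnn]
      ring
    · rintro rfl
      rw [hgT]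
      exact (e.symm _).2
  have hTs : ∀ x s, T (x + s • n) = T x - s := by
    intro x s
    refine ((hT _ _).1 ?_).symm
    rw [add_assoc, ← add_smul, add_sub_cancel, hT]
  have hT0 : ∀ x, x ∈ Q ↔ T x = 0 := fun x => by
    rw [eq_comm, ← hT x 0, zero_smul, add_zero]
  have hQmem : ∀ z, z ∈ Q ↔ ∃ p ∈ P, z ∈ plaquette p.1 p.2 := fun z => by simp [hP]
  have hsgn : ∀ x y, (∀ z ∈ segment ℝ x y, z ∉ Q) → 0 < T x → 0 < T y := by
    intro x y h hx
    by_contra hy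
    obtain ⟨z, hz, hz0⟩ := (convex_segment x y).isPreconnected.intermediate_value
      (right_mem_segment ℝ x y) (left_mem_segment ℝ x y) hTc.continuousOn ⟨not_lt.1 hy, hx.le⟩
    exact h z hz ((hT0 z).2 hz0)
  have hcube : ∀ c, ∀ x ∈ openCube c, ∀ y ∈ openCube c, 0 < T x → 0 < T y := by
    intro c x hx y hy
    refine hsgn x y fun z hz hzQ => ?_
    obtain ⟨p, -, hp⟩ := (hQmem z).1 hzQ
    exact notMem_plaquette_of_mem_openCube ((convex_openCube c).segment_subset hx hy hz) hp
  set U : Set (Fin 3 → ℤ) := {c | 0 < T (cubeCenter c)} with hU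
  have hcs : ∀ (a : Fin 3 → ℤ) i,
      cubeCenter (a - Pi.single i 1) = cubeCenter a - EuclideanSpace.single i 1 := by
    intro a i
    ext j
    rcases eq_or_ne j i with rfl | hj
    · simp [cubeCenter]; ring
    · simp [cubeCenter, hj]
  have hfP : ∀ a i, faceCenter a i ∈ Q ↔ (a, i) ∈ P := by
    intro a i
    rw [hQmem]
    constructor
    · rintro ⟨⟨b, j⟩, hp, hz⟩
      obtain ⟨rfl, rfl⟩ := eq_of_mem_plaquette (faceCenter_apply_self a i)
        (faceCenter_mem_Ioo a i) hz
      exact hp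
    · intro h
      exact ⟨_, h, faceCenter_apply_self a i, fun k hk =>
        ⟨(faceCenter_mem_Ioo a i k hk).1.le, (faceCenter_mem_Ioo a i k hk).2.le⟩⟩
  -- The segment between the two cube centers could meet Q only in the plaquette `(a, i)`. Without
  -- it, T keeps its sign.
  have hnot : ∀ a i, (a, i) ∉ P → (a - Pi.single i 1 ∈ U ↔ a ∈ U) := by
    intro a i hai
    have hseg : ∀ z ∈ segment ℝ (cubeCenter (a - Pi.single i 1)) (cubeCenter a), z ∉ Q := by
      intro z hz hzQ
      rw [hcs] at hz
      obtain ⟨h1, h2, h3⟩ := mem_segment_sub_single hz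
      obtain ⟨⟨b, j⟩, hp, hzp⟩ := (hQmem z).1 hzQ
      have h4 : ∀ k, k ≠ i → z k ∈ Ioo (a k : ℝ) (a k + 1) := fun k hk => by
        rw [h1 k hk]; exact cubeCenter_mem_openCube a k
      have hji : j = i := by
        by_contra hne
        exact int_ne_of_bounds (h4 j hne).1 (h4 j hne).2 hzp.1
      subst hji
      have h5 : z j = a j := by
        have h6 : z j = b j := hzp.1
        simp only [cubeCenter] at h2 h3
        have h7 : (b j : ℝ) < a j + 1 := by linarith
        have h8 : (a j : ℝ) < b j + 1 := by linarith
        have h9 : b j < a j + 1 := by exact_mod_cast h7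
        have h10 : a j < b j + 1 := by exact_mod_cast h8
        rw [h6, (by omega : b j = a j)]
      obtain ⟨rfl, -⟩ := eq_of_mem_plaquette h5 h4 hzp
      exact hai hp
    refine ⟨hsgn _ _ hseg, hsgn _ _ ?_⟩
    rwa [segment_symm]
  have hyes : ∀ a i, (a, i) ∈ P → n i ≠ 0 ∧ a - Pi.single i 1 ∈ U ∧ a ∉ U := by
    intro a i hai
    have hf0 : T (faceCenter a i) = 0 := (hT0 _).1 ((hfP a i).2 hai)
    have hni : n i ≠ 0 := by
      intro h0
      -- With n i = 0 the shifted point stays in the same plaquette, which puts two points of Q on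
      -- one normal line.
      have h1 : faceCenter a i + (1 / 4 : ℝ) • n ∈ Q := by
        refine (hQmem _).2 ⟨_, hai, ?_, fun k hk => ?_⟩
        · simp [faceCenter, h0]
        · have := hn1 k
          have := hn.2 k
          simp only [PiLp.add_apply, PiLp.smul_apply, smul_eq_mul, faceCenter_apply_ne hk]
          constructor <;> linarith
      have := (hT _ _).1 h1
      rw [hf0] at this
      norm_num at this
    have hpos : 0 < n i := lt_of_le_of_ne (hn.2 i) (Ne.symm hni)
    refine ⟨hni, ?_, fun haU => ?_⟩
    -- As 0 < n i and all coordinates of n lie in [0, 1], a shift of the face center by 1/4 against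
    -- or along n lands in the open cube on the respective side.
    · refine hcube _ (faceCenter a i + (-1 / 4 : ℝ) • n) (fun k => ?_) _
        (cubeCenter_mem_openCube _) ?_
      · have := hn1 k
        have := hn.2 k
        rcases eq_or_ne k i with rfl | hk
        · simp only [PiLp.add_apply, PiLp.smul_apply, smul_eq_mul, faceCenter_apply_self,
            Pi.sub_apply, Pi.single_eq_same]
          push_cast
          constructor <;> linarith
        · simp only [PiLp.add_apply, PiLp.smul_apply, smul_eq_mul, faceCenter_apply_ne hk,
            Pi.sub_apply, Pi.single_eq_of_ne hk]
          push_cast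
          constructor <;> linarith
      · rw [hTs, hf0]; norm_num
    · have h1 : 0 < T (faceCenter a i + (1 / 4 : ℝ) • n) := by
        refine hcube a _ (cubeCenter_mem_openCube a) _ (fun k => ?_) haU
        have := hn1 k
        have := hn.2 k
        rcases eq_or_ne k i with rfl | hk
        · simp only [PiLp.add_apply, PiLp.smul_apply, smul_eq_mul, faceCenter_apply_self]
          constructor <;> linarith
        · simp only [PiLp.add_apply, PiLp.smul_apply, smul_eq_mul, faceCenter_apply_ne hk]
          constructor <;> linarith
      rw [hTs, hf0] at h1
      norm_num at h1
  have hfaces : P = faces U := by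
    ext ⟨a, i⟩
    refine ⟨fun h => (hyes a i h).2, fun h => ?_⟩
    by_contra hP'
    exact h.2 ((hnot a i hP').1 h.1)
  have hdown : IsDown n U := by
    refine isDown_of_step (fun a i ha => ?_) (fun a i hi ha => ?_)
    · by_cases h : (a, i) ∈ P
      · exact (hyes a i h).2.1
      · exact (hnot a i h).2 ha
    · by_cases h : (a, i) ∈ P
      · exact absurd hi (hyes a i h).1
      · exact (hnot a i h).1 ha
  have hne : Q.Nonempty := ⟨_, (hT 0 _).2 rfl⟩
  obtain ⟨z, hz⟩ := hne
  obtain ⟨p, hp, -⟩ := (hQmem z).1 hz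
  refine ⟨U, hdown, ⟨_, (hyes p.1 p.2 hp).2.1⟩, fun h => (hyes p.1 p.2 hp).2.2 (h ▸ mem_univ _), ?_⟩
  rw [surf_eq_iUnion hdown.isLowerSet, ← hfaces, hP]

/-! ### Lattice points on stepped surfaces and flattest surfaces -/

/-- The point of `ℝ³` with integer coordinates `c`. -/
noncomputable def toE (c : Fin 3 → ℤ) : E3 := WithLp.toLp 2 fun i => (c i : ℝ)

/-- The inner product of `n` with an integer vector. -/
noncomputable def dot (n : E3) (c : Fin 3 → ℤ) : ℝ := ∑ i, n i * c i

/-- The set of cubes `U` deviates from the half space below `L_n` by at most `C`. -/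
def IsFlat (n : E3) (C : ℝ) (U : Set (Fin 3 → ℤ)) : Prop :=
  (∀ c ∈ U, dot n c ≤ C) ∧ ∀ c, c ∉ U → -C ≤ dot n c

lemma inner_eq_sum (n x : E3) : inner ℝ n x = ∑ i, n i * x i := by
  simp [PiLp.inner_apply, mul_comm]

lemma inner_toE (n : E3) (c : Fin 3 → ℤ) : inner ℝ n (toE c) = dot n c := by
  rw [inner_eq_sum]; rfl

lemma dot_add_const (n : E3) (c : Fin 3 → ℤ) (k : ℤ) :
    dot n (fun i => c i + k) = dot n c + k * ∑ i, n i := by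
  simp only [dot, Fin.sum_univ_three]; push_cast; ring

lemma toE_mem_surf {U : Set (Fin 3 → ℤ)} (c : Fin 3 → ℤ) :
    toE c ∈ surf U ↔ (fun i => c i - 1) ∈ U ∧ c ∉ U := by
  simp [surf, toE]

/-- By `toE_mem_surf`, c + k (1, 1, 1) is a lattice point of the surface. Such points are used to
compare different surfaces along a diagonal. -/
lemma exists_diagonal {U : Set (Fin 3 → ℤ)} (hU : IsLowerSet U) (h1 : U.Nonempty) (h2 : U ≠ univ)
    (c : Fin 3 → ℤ) : ∃ k : ℤ, (fun i => c i + (k - 1)) ∈ U ∧ (fun i => c i + k) ∉ U := by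
  obtain ⟨a, ha⟩ := h1
  obtain ⟨b, hb⟩ := (ne_univ_iff_exists_notMem U).1 h2
  obtain ⟨m, hm⟩ : ∃ m : ℤ, ∀ i, |a i - c i| + |b i - c i| ≤ m :=
    ⟨∑ i, (|a i - c i| + |b i - c i|), fun i => Finset.single_le_sum
      (f := fun i => |a i - c i| + |b i - c i|) (fun i _ => by positivity) (Finset.mem_univ i)⟩
  obtain ⟨k, hk, hmax⟩ := Int.exists_greatest_of_bdd (P := fun k => (fun i => c i + k) ∈ U)
    ⟨m, fun z hz => by
      by_contra! hlt
      refine hb (hU (fun i => ?_) hz)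
      have := hm i
      have := le_abs_self (b i - c i)
      have := abs_nonneg (a i - c i)
      show b i ≤ c i + z
      omega⟩
    ⟨-m, hU (fun i => by
      have := hm i
      have := neg_abs_le (a i - c i)
      have := abs_nonneg (b i - c i)
      show c i + -m ≤ a i
      omega) ha⟩
  refine ⟨k + 1, by simpa using hk, fun h => ?_⟩
  have := hmax _ h
  omega

lemma sum_apply_bounds {n : E3} (hn : n ∈ sphTriangle) :
    1 ≤ ∑ i, n i ∧ ∑ i, n i ≤ 3 := by
  have h1 : ∀ i, n i ≤ 1 := fun i =>
    ((le_abs_self _).trans (abs_apply_le_norm n i)).trans hn.1.le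
  have h2 : ∑ i, n i ^ 2 = 1 := by
    have := EuclideanSpace.norm_sq_eq n
    rw [hn.1] at this
    simpa using this.symm
  constructor
  · rw [← h2]
    exact Finset.sum_le_sum fun i _ => by nlinarith [h1 i, hn.2 i]
  · calc ∑ i, n i ≤ ∑ _i : Fin 3, (1 : ℝ) := Finset.sum_le_sum fun i _ => h1 i
      _ = 3 := by simp

/-- The cubes below the standard discrete plane with normal `n`. -/
def discretePlane (n : E3) : Set (Fin 3 → ℤ) := {c | dot n c < -((∑ i, n i) / 2)}

lemma isDown_discretePlane {n : E3} (hn : n ∈ sphTriangle) : IsDown n (discretePlane n) := by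
  intro c c' h hc
  refine lt_of_le_of_lt (b := dot n c) (Finset.sum_le_sum fun i _ => ?_) hc
  by_cases h0 : n i = 0
  · simp [h0]
  · exact mul_le_mul_of_nonneg_left (by exact_mod_cast h i h0) (hn.2 i)

lemma IsFlat.mem {n : E3} {C : ℝ} {U : Set (Fin 3 → ℤ)} (h : IsFlat n C U) {c : Fin 3 → ℤ}
    (hc : dot n c < -C) : c ∈ U := by
  by_contra h'
  exact absurd (h.2 c h') (not_le.2 hc)

lemma IsFlat.notMem {n : E3} {C : ℝ} {U : Set (Fin 3 → ℤ)} (h : IsFlat n C U) {c : Fin 3 → ℤ}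
    (hc : C < dot n c) : c ∉ U :=
  fun h' => absurd (h.1 c h') (not_le.2 hc)

lemma isFlat_discretePlane {n : E3} (hn : n ∈ sphTriangle) : IsFlat n 2 (discretePlane n) := by
  have := sum_apply_bounds hn
  constructor
  · intro c hc
    have : dot n c < -((∑ i, n i) / 2) := hc
    linarith
  · intro c hc
    have : ¬ dot n c < -((∑ i, n i) / 2) := hc
    linarith

lemma dot_const (n : E3) (k : ℤ) : dot n (fun _ => k) = k * ∑ i, n i := by
  simp only [dot, Fin.sum_univ_three]; ring

lemma norm_toE_const (k : ℤ) : |(k : ℝ)| ≤ ‖toE fun _ => k‖ := abs_apply_le_norm (toE fun _ => k) 0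

/-- A set of cubes which agrees with a flat one far away is neither empty nor everything. -/
lemma nonempty_ne_univ_of_agree {n : E3} (hn : n ∈ sphTriangle) {C R : ℝ}
    {U₀ U : Set (Fin 3 → ℤ)} (h₀ : IsFlat n C U₀)
    (h : ∀ c, R ≤ ‖toE c‖ → (c ∈ U ↔ c ∈ U₀)) : U.Nonempty ∧ U ≠ univ := by
  obtain ⟨k, hk⟩ := exists_nat_gt (max (max C R) 0)
  have hC : C < k := ((le_max_left _ _).trans (le_max_left _ _)).trans_lt hk
  have hR : R < k := ((le_max_right _ _).trans (le_max_left _ _)).trans_lt hk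
  have h0 : (0 : ℝ) < k := (le_max_right _ _).trans_lt hk
  have hs := (sum_apply_bounds hn).1
  constructor
  · refine ⟨fun _ => -(k : ℤ), (h _ ?_).2 (h₀.mem ?_)⟩
    · refine le_trans ?_ (norm_toE_const _)
      push_cast
      rw [abs_neg, abs_of_pos h0]
      exact hR.le
    · rw [dot_const]
      push_cast
      nlinarith
  · rw [ne_univ_iff_exists_notMem]
    refine ⟨fun _ => (k : ℤ), fun h' => h₀.notMem ?_ ((h _ ?_).1 h')⟩
    · rw [dot_const]
      push_cast
      nlinarith
    · refine le_trans ?_ (norm_toE_const _)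
      push_cast
      rw [abs_of_pos h0]
      exact hR.le

lemma IsFlat.nonempty_ne_univ {n : E3} (hn : n ∈ sphTriangle) {C : ℝ} {U : Set (Fin 3 → ℤ)}
    (h : IsFlat n C U) : U.Nonempty ∧ U ≠ univ :=
  nonempty_ne_univ_of_agree hn (R := 0) h fun _ _ => Iff.rfl

lemma floor_ceil_dot {n : E3} (hn : n ∈ sphTriangle) (x : E3) :
    dot n (fun i => ⌊x i⌋) ≤ inner ℝ n x ∧ inner ℝ n x ≤ dot n (fun i => ⌈x i⌉) := by
  rw [inner_eq_sum]
  exact ⟨Finset.sum_le_sum fun i _ => mul_le_mul_of_nonneg_left (Int.floor_le _) (hn.2 i),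
    Finset.sum_le_sum fun i _ => mul_le_mul_of_nonneg_left (Int.le_ceil _) (hn.2 i)⟩

lemma bounds_of_mem_surf_discretePlane {n : E3} {x : E3} (hx : x ∈ surf (discretePlane n)) :
    -((∑ i, n i) / 2) ≤ dot n (fun i => ⌊x i⌋) ∧ dot n (fun i => ⌈x i⌉) < (∑ i, n i) / 2 := by
  refine ⟨not_lt.1 hx.2, ?_⟩
  have h1 : dot n (fun i => ⌈x i⌉ + -1) < -((∑ i, n i) / 2) := hx.1
  rw [dot_add_const] at h1
  push_cast at h1
  linarith

lemma abs_inner_le_of_mem_surf_discretePlane {n : E3} (hn : n ∈ sphTriangle) {x : E3}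
    (hx : x ∈ surf (discretePlane n)) : |inner ℝ n x| ≤ (∑ i, n i) / 2 := by
  have h1 := floor_ceil_dot hn x
  have h2 := bounds_of_mem_surf_discretePlane hx
  rw [abs_le]
  constructor <;> linarith

/-- Let s = ∑ n i. For (n, x) ≥ 0 round x up to c, so that (n, x) ≤ (n, c) < s / 2. The surface of
`U` crosses the diagonal of c at a point where n takes the value (n, c) + k s: for k ≥ 0 this is at
least (n, x), and for k ≤ -1 it is below -s / 2. The case (n, x) ≤ 0 is symmetric, rounding down. -/
lemma exists_abs_inner_ge {n : E3} (hn : n ∈ sphTriangle) {U : Set (Fin 3 → ℤ)}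
    (hU : IsLowerSet U) (h1 : U.Nonempty) (h2 : U ≠ univ) {x : E3}
    (hx : x ∈ surf (discretePlane n)) : ∃ q ∈ surf U, |inner ℝ n x| ≤ |inner ℝ n q| := by
  have hs := sum_apply_bounds hn
  have h3 := floor_ceil_dot hn x
  have h4 := bounds_of_mem_surf_discretePlane hx
  have key : ∀ c : Fin 3 → ℤ, ∃ k : ℤ, ∃ q ∈ surf U, inner ℝ n q = dot n c + k * ∑ i, n i := by
    intro c
    obtain ⟨k, hk1, hk2⟩ := exists_diagonal hU h1 h2 c
    refine ⟨k, toE (fun i => c i + k), (toE_mem_surf _).2 ⟨?_, hk2⟩, ?_⟩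
    · convert hk1 using 2
      ring
    · rw [inner_toE, dot_add_const]
  rcases le_total 0 (inner ℝ n x) with h0 | h0
  · obtain ⟨k, q, hq, hqn⟩ := key fun i => ⌈x i⌉
    refine ⟨q, hq, ?_⟩
    rw [abs_of_nonneg h0, hqn]
    rcases le_or_gt 0 k with hk | hk
    · have : (0 : ℝ) ≤ k := by exact_mod_cast hk
      refine le_trans ?_ (le_abs_self _)
      nlinarith
    · have : (k : ℝ) ≤ -1 := by exact_mod_cast (by omega : k ≤ -1)
      refine le_trans ?_ (neg_le_abs _)
      nlinarith
  · obtain ⟨k, q, hq, hqn⟩ := key fun i => ⌊x i⌋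
    refine ⟨q, hq, ?_⟩
    rw [abs_of_nonpos h0, hqn]
    rcases le_or_gt k 0 with hk | hk
    · have : (k : ℝ) ≤ 0 := by exact_mod_cast hk
      refine le_trans ?_ (neg_le_abs _)
      nlinarith
    · have : (1 : ℝ) ≤ k := by exact_mod_cast (by omega : 1 ≤ k)
      refine le_trans ?_ (le_abs_self _)
      nlinarith

lemma mem_plane_iff {n p : E3} : p ∈ plane n ↔ inner ℝ n p = 0 := by
  unfold plane
  rw [Submodule.mem_orthogonal_singleton_iff_inner_right]

/-- Since |(n, q)| is the distance of q from the plane, this bound and the next one identify the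
Hausdorff distance of a stepped surface with the supremum of |(n, q)|. -/
lemma ofReal_abs_inner_le_hausdorffEDist {n : E3} (hn : ‖n‖ = 1) {Q : Set E3} {q : E3}
    (hq : q ∈ Q) :
    ENNReal.ofReal |inner ℝ n q| ≤ Metric.hausdorffEDist Q (plane n : Set E3) := by
  refine le_trans ?_ (Metric.infEDist_le_hausdorffEDist_of_mem hq)
  refine Metric.le_infEDist.2 fun p hp => ?_
  rw [edist_dist]
  refine ENNReal.ofReal_le_ofReal ?_
  have h1 : inner ℝ n q = inner ℝ n (q - p) := by
    rw [inner_sub_right, mem_plane_iff.1 hp, sub_zero]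
  rw [h1, dist_eq_norm]
  simpa [hn] using abs_real_inner_le_norm n (q - p)

lemma hausdorffEDist_surf_le {n : E3} (hn : n ∈ sphTriangle) {U : Set (Fin 3 → ℤ)}
    (hU : IsDown n U) (h1 : U.Nonempty) (h2 : U ≠ univ) {r : ENNReal}
    (hr : ∀ q ∈ surf U, ENNReal.ofReal |inner ℝ n q| ≤ r) :
    Metric.hausdorffEDist (surf U) (plane n : Set E3) ≤ r := by
  have hnn : inner ℝ n n = (1 : ℝ) := by rw [real_inner_self_eq_norm_sq, hn.1]; norm_num
  refine Metric.hausdorffEDist_le_of_mem_edist (fun q hq => ?_) (fun p hp => ?_)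
  · refine ⟨q - inner ℝ n q • n, ?_, ?_⟩
    · show _ ∈ plane n
      rw [mem_plane_iff, inner_sub_right, inner_smul_right, hnn]
      ring
    · refine le_trans (le_of_eq ?_) (hr q hq)
      rw [edist_dist, dist_eq_norm, sub_sub_cancel, norm_smul, hn.1, mul_one, Real.norm_eq_abs]
  · obtain ⟨t, ht⟩ := exists_mem_surf_line hn hU h1 h2 p
    refine ⟨_, ht, le_trans (le_of_eq ?_) (hr _ ht)⟩
    rw [inner_add_right, mem_plane_iff.1 hp, inner_smul_right, hnn, edist_dist, dist_eq_norm,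
      sub_add_cancel_left, norm_neg, norm_smul, hn.1, Real.norm_eq_abs]
    simp

lemma surf_discretePlane_mem_flattestSurfaces {n : E3} (hn : n ∈ sphTriangle) :
    surf (discretePlane n) ∈ flattestSurfaces n := by
  obtain ⟨h1, h2⟩ := (isFlat_discretePlane hn).nonempty_ne_univ hn
  refine ⟨surf_mem_steppedSurfaces hn (isDown_discretePlane hn) h1 h2, fun Q' hQ' => ?_⟩
  obtain ⟨U, hU, h3, h4, rfl⟩ := exists_isDown_of_mem_steppedSurfaces hn hQ'
  refine hausdorffEDist_surf_le hn (isDown_discretePlane hn) h1 h2 fun q hq => ?_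
  obtain ⟨q', hq', hle⟩ := exists_abs_inner_ge hn hU.isLowerSet h3 h4 hq
  exact (ENNReal.ofReal_le_ofReal hle).trans (ofReal_abs_inner_le_hausdorffEDist hn.1 hq')

theorem exists_isFlat_of_mem_flattestSurfaces {n : E3} (hn : n ∈ sphTriangle) {Q : Set E3}
    (hQ : Q ∈ flattestSurfaces n) : ∃ U, IsDown n U ∧ IsFlat n 2 U ∧ Q = surf U := by
  obtain ⟨hQ1, hQ2⟩ := hQ
  obtain ⟨U, hU, h1, h2, rfl⟩ := exists_isDown_of_mem_steppedSurfaces hn hQ1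
  refine ⟨U, hU, ?_, rfl⟩
  have hs := sum_apply_bounds hn
  obtain ⟨h3, h4⟩ := (isFlat_discretePlane hn).nonempty_ne_univ hn
  have hle : ∀ q ∈ surf U, |inner ℝ n q| ≤ (∑ i, n i) / 2 := by
    intro q hq
    have h5 := (ofReal_abs_inner_le_hausdorffEDist hn.1 hq).trans
      ((hQ2 _ (surf_discretePlane_mem_flattestSurfaces hn).1).trans
        (hausdorffEDist_surf_le hn (isDown_discretePlane hn) h3 h4
          (r := ENNReal.ofReal ((∑ i, n i) / 2)) fun q hq =>
            ENNReal.ofReal_le_ofReal (abs_inner_le_of_mem_surf_discretePlane hn hq)))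
    exact (ENNReal.ofReal_le_ofReal_iff (by linarith)).1 h5
  -- The sign of the number of diagonal steps from c to the surface tells whether c belongs to `U`,
  -- and each step changes the inner product with n by ∑ n i.
  have key : ∀ c : Fin 3 → ℤ, ∃ k : ℤ, (c ∈ U ↔ 1 ≤ k) ∧
      |dot n c + k * ∑ i, n i| ≤ (∑ i, n i) / 2 := by
    intro c
    obtain ⟨k, hk1, hk2⟩ := exists_diagonal hU.isLowerSet h1 h2 c
    refine ⟨k, ⟨fun h => ?_, fun h => ?_⟩, ?_⟩
    · by_contra! hk
      exact hk2 (hU.isLowerSet (fun i => by show c i + k ≤ c i; omega) h)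
    · exact hU.isLowerSet (fun i => by show c i ≤ c i + (k - 1); omega) hk1
    · rw [← dot_add_const, ← inner_toE]
      refine hle _ ((toE_mem_surf _).2 ⟨?_, hk2⟩)
      convert hk1 using 2
      ring
  constructor
  · intro c hc
    obtain ⟨k, hk, hk'⟩ := key c
    have : (1 : ℝ) ≤ k := by exact_mod_cast hk.1 hc
    rw [abs_le] at hk'
    nlinarith
  · intro c hc
    obtain ⟨k, hk, hk'⟩ := key c
    have h6 : k ≤ 0 := by
      by_contra! h
      exact hc (hk.2 (by omega))
    have : (k : ℝ) ≤ 0 := by exact_mod_cast h6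
    rw [abs_le] at hk'
    nlinarith

/-! ### Counting surfaces by counting sets of cubes -/

/-- The downward closed sets of cubes which agree with `U₀` outside of the ball of radius `R`. -/
def cellSets (U₀ : Set (Fin 3 → ℤ)) (R : ℝ) : Set (Set (Fin 3 → ℤ)) :=
  {U | IsLowerSet U ∧ ∀ c, R ≤ ‖toE c‖ → (c ∈ U ↔ c ∈ U₀)}

lemma finite_norm_toE_lt (R : ℝ) : {c : Fin 3 → ℤ | ‖toE c‖ < R}.Finite := by
  refine (Set.finite_Icc (fun _ => -⌈R⌉ : Fin 3 → ℤ) (fun _ => ⌈R⌉)).subset fun c hc => ?_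
  have h : ∀ i, |(c i : ℝ)| ≤ ⌈R⌉ := fun i =>
    ((abs_apply_le_norm (toE c) i).trans (le_of_lt hc)).trans (Int.le_ceil R)
  have h' : ∀ i, |c i| ≤ ⌈R⌉ := fun i => by exact_mod_cast h i
  exact ⟨fun i => (abs_le.1 (h' i)).1, fun i => (abs_le.1 (h' i)).2⟩

lemma finite_cellSets (U₀ : Set (Fin 3 → ℤ)) (R : ℝ) : (cellSets U₀ R).Finite := by
  refine Set.Finite.of_finite_image (f := fun U => U ∩ {c | ‖toE c‖ < R})
    ((finite_norm_toE_lt R).finite_subsets.subset ?_) ?_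
  · rintro _ ⟨U, -, rfl⟩
    exact inter_subset_right
  · intro U hU V hV h
    ext c
    rcases lt_or_ge ‖toE c‖ R with hc | hc
    · have := Set.ext_iff.1 h c
      simpa [hc] using this
    · rw [hU.2 c hc, hV.2 c hc]

lemma norm_sq_toE (c : Fin 3 → ℤ) : ‖toE c‖ ^ 2 = ∑ i, (c i : ℝ) ^ 2 := by
  rw [EuclideanSpace.norm_sq_eq]
  simp [toE]

lemma norm_toE_le_add {c : Fin 3 → ℤ} {k : ℤ} (h : 0 ≤ k * ∑ i, c i) :
    ‖toE c‖ ≤ ‖toE fun i => c i + k‖ := by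
  refine le_of_sq_le_sq ?_ (norm_nonneg _)
  rw [norm_sq_toE, norm_sq_toE]
  have h' : (0 : ℝ) ≤ k * ∑ i, (c i : ℝ) := by exact_mod_cast h
  simp only [Fin.sum_univ_three] at h' ⊢
  push_cast
  nlinarith [sq_nonneg (k : ℝ)]

/-- Suppose c is in `U` but not in `V`. On its diagonal the surface of `U` is crossed above c and
that of `V` at or below c. Choose the crossing on the side where the norm does not decrease,
according to the sign of ∑ c i. It lies outside the ball, hence on both surfaces, which is
impossible. -/
lemma agree_of_surf_diff_eq_aux {U V : Set (Fin 3 → ℤ)} (hU : IsLowerSet U) (hV : IsLowerSet V)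
    (hU1 : U.Nonempty) (hU2 : U ≠ univ) (hV1 : V.Nonempty) (hV2 : V ≠ univ) {R : ℝ}
    (h : surf U \ Metric.ball 0 R = surf V \ Metric.ball 0 R) {c : Fin 3 → ℤ}
    (hc : R ≤ ‖toE c‖) (hcU : c ∈ U) : c ∈ V := by
  by_contra hcV
  rcases le_total 0 (∑ i, c i) with h0 | h0
  · obtain ⟨k, hk1, hk2⟩ := exists_diagonal hU hU1 hU2 c
    have hk : 0 ≤ k := by
      by_contra! hk
      exact hk2 (hU (fun i => by show c i + k ≤ c i; omega) hcU)
    have h3 : toE (fun i => c i + k) ∈ surf U \ Metric.ball 0 R := by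
      refine ⟨(toE_mem_surf _).2 ⟨by simpa [add_sub_assoc] using hk1, hk2⟩, ?_⟩
      rw [mem_ball_zero_iff, not_lt]
      exact hc.trans (norm_toE_le_add (mul_nonneg hk h0))
    rw [h] at h3
    have h4 := ((toE_mem_surf _).1 h3.1).1
    have hk' : k ≠ 0 := by
      rintro rfl
      exact hk2 (by simpa using hcU)
    exact hcV (hV (fun i => by show c i ≤ c i + k - 1; omega) h4)
  · obtain ⟨k, hk1, hk2⟩ := exists_diagonal hV hV1 hV2 c
    have hk : k ≤ 0 := by
      by_contra! hk
      exact hcV (hV (fun i => by show c i ≤ c i + (k - 1); omega) hk1)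
    have h3 : toE (fun i => c i + k) ∈ surf V \ Metric.ball 0 R := by
      refine ⟨(toE_mem_surf _).2 ⟨by simpa [add_sub_assoc] using hk1, hk2⟩, ?_⟩
      rw [mem_ball_zero_iff, not_lt]
      exact hc.trans (norm_toE_le_add (mul_nonneg_of_nonpos_of_nonpos hk h0))
    rw [← h] at h3
    exact ((toE_mem_surf _).1 h3.1).2 (hU (fun i => by show c i + k ≤ c i; omega) hcU)

lemma agree_of_surf_diff_eq {U V : Set (Fin 3 → ℤ)} (hU : IsLowerSet U) (hV : IsLowerSet V)
    (hU1 : U.Nonempty) (hU2 : U ≠ univ) (hV1 : V.Nonempty) (hV2 : V ≠ univ) {R : ℝ}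
    (h : surf U \ Metric.ball 0 R = surf V \ Metric.ball 0 R) {c : Fin 3 → ℤ}
    (hc : R ≤ ‖toE c‖) : c ∈ U ↔ c ∈ V :=
  ⟨agree_of_surf_diff_eq_aux hU hV hU1 hU2 hV1 hV2 h hc,
    agree_of_surf_diff_eq_aux hV hU hV1 hV2 hU1 hU2 h.symm hc⟩

lemma surf_injOn {U V : Set (Fin 3 → ℤ)} (hU : IsLowerSet U) (hV : IsLowerSet V)
    (hU1 : U.Nonempty) (hU2 : U ≠ univ) (hV1 : V.Nonempty) (hV2 : V ≠ univ)
    (h : surf U = surf V) : U = V := by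
  ext c
  exact agree_of_surf_diff_eq hU hV hU1 hU2 hV1 hV2 (R := 0) (by rw [h]) (norm_nonneg _)

lemma setOf_surfaces_subset {n : E3} (hn : n ∈ sphTriangle) {C : ℝ} {U₀ : Set (Fin 3 → ℤ)}
    (h₀ : IsDown n U₀) (h₁ : IsFlat n C U₀) (R : ℝ) :
    {Q | Q ∈ steppedSurfaces n ∧ Q \ Metric.ball 0 R = surf U₀ \ Metric.ball 0 R} ⊆
      surf '' (cellSets U₀ R) := by
  rintro Q ⟨hQ, hQR⟩
  obtain ⟨U, hU, h1, h2, rfl⟩ := exists_isDown_of_mem_steppedSurfaces hn hQ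
  obtain ⟨h3, h4⟩ := h₁.nonempty_ne_univ hn
  exact ⟨U, ⟨hU.isLowerSet, fun c hc =>
    agree_of_surf_diff_eq hU.isLowerSet h₀.isLowerSet h1 h2 h3 h4 hQR hc⟩, rfl⟩

lemma surfaceCount_le {n : E3} (hn : n ∈ sphTriangle) {C : ℝ} {U₀ : Set (Fin 3 → ℤ)}
    (h₀ : IsDown n U₀) (h₁ : IsFlat n C U₀) (R : ℝ) :
    surfaceCount n (surf U₀) R ≤ (cellSets U₀ R).ncard :=
  (ncard_le_ncard (setOf_surfaces_subset hn h₀ h₁ R) ((finite_cellSets U₀ R).image _)).trans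
    (ncard_image_le (finite_cellSets U₀ R))

lemma isDown_of_isLowerSet {n : E3} (hpos : ∀ i, 0 < n i) {U : Set (Fin 3 → ℤ)}
    (hU : IsLowerSet U) : IsDown n U :=
  fun _ _ h hc => hU (fun i => h i (hpos i).ne') hc

lemma norm_sub_toE_le {x : E3} {c : Fin 3 → ℤ} (h : ∀ i, |x i - c i| ≤ 1) : ‖x - toE c‖ ≤ 2 := by
  refine le_of_sq_le_sq ?_ (by norm_num)
  rw [EuclideanSpace.norm_sq_eq]
  calc ∑ i, ‖(x - toE c) i‖ ^ 2 ≤ ∑ _i : Fin 3, (1 : ℝ) := Finset.sum_le_sum fun i _ => by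
        have := h i
        simp only [toE, PiLp.sub_apply, Real.norm_eq_abs]
        nlinarith [abs_nonneg (x i - c i)]
    _ ≤ 2 ^ 2 := by norm_num

/-- Whether x is on the surface depends only on two cubes whose least vertices have distance at most
2 from x. So agreement of the cubes from radius R - 2 on gives agreement of the surfaces outside the
ball of radius R. -/
lemma le_surfaceCount {n : E3} (hn : n ∈ sphTriangle) (hpos : ∀ i, 0 < n i) {C : ℝ}
    {U₀ : Set (Fin 3 → ℤ)} (h₀ : IsLowerSet U₀) (h₁ : IsFlat n C U₀) (R : ℝ) :
    (cellSets U₀ (R - 2)).ncard ≤ surfaceCount n (surf U₀) R := by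
  refine ncard_le_ncard_of_injOn surf ?_ ?_ (((finite_cellSets U₀ R).image _).subset
    (setOf_surfaces_subset hn (isDown_of_isLowerSet hpos h₀) h₁ R))
  · rintro U ⟨hU, hUc⟩
    obtain ⟨h1, h2⟩ := nonempty_ne_univ_of_agree hn h₁ hUc
    refine ⟨surf_mem_steppedSurfaces hn (isDown_of_isLowerSet hpos hU) h1 h2, ?_⟩
    ext x
    simp only [Set.mem_sdiff, mem_ball_zero_iff, not_lt]
    refine and_congr_left fun hx => ?_
    have h3 : ∀ c : Fin 3 → ℤ, (∀ i, |x i - c i| ≤ 1) → (c ∈ U ↔ c ∈ U₀) := by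
      intro c hc
      refine hUc c ?_
      have h4 := norm_sub_toE_le hc
      have h5 := norm_sub_norm_le x (toE c)
      linarith
    refine and_congr (h3 _ fun i => ?_) (not_congr (h3 _ fun i => ?_))
    · have := ceil_sub_one_bounds (x i)
      rw [abs_le]
      constructor <;> linarith
    · have := floor_bounds (x i)
      rw [abs_le]
      constructor <;> linarith
  · rintro U ⟨hU, hUc⟩ V ⟨hV, hVc⟩ h
    obtain ⟨h1, h2⟩ := nonempty_ne_univ_of_agree hn h₁ hUc
    obtain ⟨h3, h4⟩ := nonempty_ne_univ_of_agree hn h₁ hVc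
    exact surf_injOn hU hV h1 h2 h3 h4 h

/-- Admissible sets of cubes are invariant in the direction i, so each cube can be moved in this
direction out of the ball, where everything is prescribed. -/
lemma surfaceCount_eq_one {n : E3} (hn : n ∈ sphTriangle) {i : Fin 3} (hi : n i = 0) {C : ℝ}
    {U₀ : Set (Fin 3 → ℤ)} (h₀ : IsDown n U₀) (h₁ : IsFlat n C U₀) (R : ℝ) :
    surfaceCount n (surf U₀) R = 1 := by
  obtain ⟨h3, h4⟩ := h₁.nonempty_ne_univ hn
  rw [surfaceCount, ncard_eq_one]
  refine ⟨surf U₀, Subset.antisymm ?_ ?_⟩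
  · rintro Q ⟨hQ, hQR⟩
    obtain ⟨U, hU, h1, h2, rfl⟩ := exists_isDown_of_mem_steppedSurfaces hn hQ
    have hfar : ∀ c : Fin 3 → ℤ, R ≤ ‖toE (Function.update c i ⌈R⌉)‖ := fun c => by
      refine (Int.le_ceil R).trans (le_trans ?_ (abs_apply_le_norm _ i))
      simp [toE, le_abs_self]
    have hinv : ∀ {V : Set (Fin 3 → ℤ)}, IsDown n V → ∀ c, c ∈ V ↔ Function.update c i ⌈R⌉ ∈ V := by
      intro V hV c
      constructor <;> refine hV _ _ fun j hj => ?_ <;>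
      · have : j ≠ i := by rintro rfl; exact hj hi
        simp [this]
    rw [mem_singleton_iff]
    congr 1
    ext c
    rw [hinv hU, hinv h₀]
    exact agree_of_surf_diff_eq hU.isLowerSet h₀.isLowerSet h1 h2 h3 h4 hQR (hfar c)
  · rintro _ rfl
    exact ⟨surf_mem_steppedSurfaces hn h₀ h3 h4, rfl⟩

/-! ### Antitone integer arrays -/

/-- The antitone integer arrays which agree with `G₀` outside of `A`. -/
def arrSet (G₀ : ℤ × ℤ → ℤ) (A : Set (ℤ × ℤ)) : Set (ℤ × ℤ → ℤ) :=
  {G | Antitone G ∧ ∀ v, v ∉ A → G v = G₀ v}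

/-- The logarithm of the number of antitone arrays which agree with `G₀` outside of `A`. -/
noncomputable def ent (G₀ : ℤ × ℤ → ℤ) (A : Set (ℤ × ℤ)) : ℝ := Real.log (arrSet G₀ A).ncard

/-- The array deviates from the linear function with slopes `-α`, `-γ` by at most `C`. -/
def FlatArr (α γ C : ℝ) (G : ℤ × ℤ → ℤ) : Prop := ∀ v, |(G v : ℝ) + (α * v.1 + γ * v.2)| ≤ C

/-- No point of `A` is equal or adjacent to a point of `B`. -/
def Sep (A B : Set (ℤ × ℤ)) : Prop :=
  ∀ a ∈ A, ∀ b ∈ B, 1 < |a.1 - b.1| ∨ 1 < |a.2 - b.2|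

lemma antitone_of_step {G : ℤ × ℤ → ℤ} (h1 : ∀ x z, G (x + 1, z) ≤ G (x, z))
    (h2 : ∀ x z, G (x, z + 1) ≤ G (x, z)) : Antitone G := by
  rintro ⟨x, z⟩ ⟨x', z'⟩ ⟨hx, hz⟩
  have h3 : Antitone fun x => G (x, z') := antitone_int_of_succ_le fun x => h1 x z'
  have h4 : Antitone fun z => G (x, z) := antitone_int_of_succ_le fun z => h2 x z
  exact (h3 hx).trans (h4 hz)

lemma exists_shift_notMem {A : Set (ℤ × ℤ)} (hA : A.Finite) (v : ℤ × ℤ) (s : ℤ) (hs : s ≠ 0) :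
    ∃ k : ℕ, (v.1 + s * k, v.2 + s * k) ∉ A := by
  by_contra! h
  refine Set.infinite_of_injective_forall_mem (f := fun k : ℕ => (v.1 + s * k, v.2 + s * k))
    (fun a b hab => ?_) h hA
  simpa [hs] using hab

/-- The diagonal through a point of A leaves A in both directions, and monotonicity squeezes the
value there between two values of `G₀`. -/
lemma finite_arrSet (G₀ : ℤ × ℤ → ℤ) {A : Set (ℤ × ℤ)} (hA : A.Finite) : (arrSet G₀ A).Finite := by
  choose lo hlo using fun v => exists_shift_notMem hA v 1 (by norm_num)
  choose hi hhi using fun v => exists_shift_notMem hA v (-1) (by norm_num)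
  have : Finite A := hA
  have : Fintype A := Fintype.ofFinite A
  refine Set.Finite.of_finite_image (f := fun G => fun a : A => G a.1)
    ((Set.finite_Icc (fun a : A => G₀ (a.1.1 + 1 * lo a.1, a.1.2 + 1 * lo a.1))
      (fun a : A => G₀ (a.1.1 + -1 * hi a.1, a.1.2 + -1 * hi a.1))).subset ?_) ?_
  · rintro _ ⟨G, ⟨hG1, hG2⟩, rfl⟩
    constructor
    · intro a
      simp only
      rw [← hG2 _ (hlo a.1)]
      exact hG1 ⟨by simp, by simp⟩
    · intro a
      simp only
      rw [← hG2 _ (hhi a.1)]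
      exact hG1 ⟨by simp, by simp⟩
  · intro G hG G' hG' h
    ext v
    by_cases hv : v ∈ A
    · exact congrFun h ⟨v, hv⟩
    · rw [hG.2 v hv, hG'.2 v hv]

lemma self_mem_arrSet {G₀ : ℤ × ℤ → ℤ} (h : Antitone G₀) (A : Set (ℤ × ℤ)) : G₀ ∈ arrSet G₀ A :=
  ⟨h, fun _ _ => rfl⟩

lemma ncard_arrSet_pos {G₀ : ℤ × ℤ → ℤ} (h : Antitone G₀) {A : Set (ℤ × ℤ)} (hA : A.Finite) :
    0 < (arrSet G₀ A).ncard :=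
  (ncard_pos (finite_arrSet G₀ hA)).2 ⟨_, self_mem_arrSet h A⟩

lemma ent_nonneg (G₀ : ℤ × ℤ → ℤ) (A : Set (ℤ × ℤ)) : 0 ≤ ent G₀ A := Real.log_natCast_nonneg _

lemma log_natCast_le {a b : ℕ} (h : a ≤ b) : Real.log a ≤ Real.log b := by
  rcases Nat.eq_zero_or_pos a with rfl | ha
  · simpa using Real.log_natCast_nonneg b
  · exact Real.log_le_log (by exact_mod_cast ha) (by exact_mod_cast h)

lemma ent_le_of_injOn {G₀ G₁ : ℤ × ℤ → ℤ} {A B : Set (ℤ × ℤ)} (hB : B.Finite)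
    (f : (ℤ × ℤ → ℤ) → (ℤ × ℤ → ℤ)) (hf : ∀ G ∈ arrSet G₀ A, f G ∈ arrSet G₁ B)
    (hinj : InjOn f (arrSet G₀ A)) : ent G₀ A ≤ ent G₁ B :=
  log_natCast_le (ncard_le_ncard_of_injOn f hf hinj (finite_arrSet G₁ hB))

lemma ent_mono {G₀ : ℤ × ℤ → ℤ} {A B : Set (ℤ × ℤ)} (hB : B.Finite) (h : A ⊆ B) :
    ent G₀ A ≤ ent G₀ B :=
  ent_le_of_injOn hB id (fun _ hG => ⟨hG.1, fun v hv => hG.2 v fun h' => hv (h h')⟩)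
    (injOn_id _)

-- Since A and B are separated, of two neighboring sites with one in A the other is not in B, so
-- there both carry values of the single antitone array g.
open Classical in
lemma antitone_piecewise {G₀ g h : ℤ × ℤ → ℤ} {A B : Set (ℤ × ℤ)} (hs : Sep A B)
    (hg : g ∈ arrSet G₀ A) (hh : h ∈ arrSet G₀ B) :
    Antitone fun v => if v ∈ A then g v else h v := by
  have key : ∀ v v' : ℤ × ℤ, v ≤ v' → |v.1 - v'.1| ≤ 1 → |v.2 - v'.2| ≤ 1 →
      (if v' ∈ A then g v' else h v') ≤ if v ∈ A then g v else h v := by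
    intro v v' hle h1 h2
    have h1' : |v'.1 - v.1| ≤ 1 := by rwa [abs_sub_comm]
    have h2' : |v'.2 - v.2| ≤ 1 := by rwa [abs_sub_comm]
    by_cases hv : v ∈ A <;> by_cases hv' : v' ∈ A
    · simpa [hv, hv'] using hg.1 hle
    · have h3 : v' ∉ B := fun hB => by rcases hs v hv v' hB with h | h <;> omega
      simp only [hv, hv', if_true, if_false]
      rw [hh.2 v' h3, ← hg.2 v' hv']
      exact hg.1 hle
    · have h3 : v ∉ B := fun hB => by rcases hs v' hv' v hB with h | h <;> omega
      simp only [hv, hv', if_true, if_false]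
      rw [hh.2 v h3, ← hg.2 v hv]
      exact hg.1 hle
    · simpa [hv, hv'] using hh.1 hle
  exact antitone_of_step (fun x z => key _ _ ⟨by simp, le_rfl⟩ (by simp) (by simp))
    fun x z => key _ _ ⟨le_rfl, by simp⟩ (by simp) (by simp)

open Classical in
lemma ent_add_le_union {G₀ : ℤ × ℤ → ℤ} (h₀ : Antitone G₀) {A B : Set (ℤ × ℤ)} (hA : A.Finite)
    (hB : B.Finite) (hs : Sep A B) : ent G₀ A + ent G₀ B ≤ ent G₀ (A ∪ B) := by
  unfold ent
  have hA' := ncard_arrSet_pos h₀ hA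
  have hB' := ncard_arrSet_pos h₀ hB
  rw [← Real.log_mul (by positivity) (by positivity), ← Nat.cast_mul, ← ncard_prod]
  refine log_natCast_le (ncard_le_ncard_of_injOn
    (fun q : (ℤ × ℤ → ℤ) × (ℤ × ℤ → ℤ) => fun v => if v ∈ A then q.1 v else q.2 v) ?_ ?_
    (finite_arrSet G₀ (hA.union hB)))
  · rintro ⟨g, h⟩ ⟨hg, hh⟩
    refine ⟨antitone_piecewise hs hg hh, fun v hv => ?_⟩
    rw [mem_union, not_or] at hv
    simp only [hv.1, if_false]
    exact hh.2 v hv.2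
  · rintro ⟨g, h⟩ ⟨hg, hh⟩ ⟨g', h'⟩ ⟨hg', hh'⟩ heq
    simp only at hg hh hg' hh' heq
    have h1 : ∀ v, (if v ∈ A then g v else h v) = if v ∈ A then g' v else h' v := congrFun heq
    rw [Prod.mk.injEq]
    constructor
    · ext v
      by_cases hv : v ∈ A
      · simpa [hv] using h1 v
      · rw [hg.2 v hv, hg'.2 v hv]
    · ext v
      by_cases hv : v ∈ A
      · have h3 : v ∉ B := fun hB => by rcases hs v hv v hB with h | h <;> simp at h
        rw [hh.2 v h3, hh'.2 v h3]
      · simpa [hv] using h1 v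

lemma ent_sum_le {ι : Type*} {G₀ : ℤ × ℤ → ℤ} (h₀ : Antitone G₀) (I : Finset ι)
    (A : ι → Set (ℤ × ℤ)) (hA : ∀ i, (A i).Finite) (hs : Pairwise fun i j => Sep (A i) (A j))
    {B : Set (ℤ × ℤ)} (hB : B.Finite) (hsB : ∀ i ∈ I, Sep (A i) B) :
    ent G₀ B + ∑ i ∈ I, ent G₀ (A i) ≤ ent G₀ (B ∪ ⋃ i ∈ I, A i) := by
  classical
  induction I using Finset.induction_on with
  | empty => simp
  | insert i I hi ih =>
    rw [Finset.sum_insert hi, Finset.set_biUnion_insert, union_left_comm]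
    have h1 := ih fun j hj => hsB j (Finset.mem_insert_of_mem hj)
    have hfin : (B ∪ ⋃ i ∈ I, A i).Finite :=
      hB.union (Set.Finite.biUnion I.finite_toSet fun i _ => hA i)
    have h2 := ent_add_le_union h₀ (hA i) hfin (fun a ha b hb => by
      rcases hb with hb | hb
      · exact hsB i (Finset.mem_insert_self i I) a ha b hb
      · simp only [mem_iUnion] at hb
        obtain ⟨j, hj, hb⟩ := hb
        exact hs (fun hij : i = j => hi (by rw [hij]; exact hj)) a ha b hb)
    linarith

lemma ent_translate {G : ℤ × ℤ → ℤ} (u : ℤ × ℤ) (k : ℤ) {A : Set (ℤ × ℤ)} (hA : A.Finite) :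
    ent G A ≤ ent (fun v => G (v - u) + k) {v | v - u ∈ A} := by
  refine ent_le_of_injOn (hA.preimage (sub_left_injective.injOn))
    (fun g v => g (v - u) + k) (fun g hg => ⟨fun v v' hv => ?_, fun v hv => ?_⟩) ?_
  · have := hg.1 (sub_le_sub_right hv u)
    simpa using this
  · simp only
    rw [hg.2 _ hv]
  · intro g _ g' _ h
    ext v
    have := congrFun h (v + u)
    simpa using this

/-- A square of side `r` with least point `u`. -/
def box (u : ℤ × ℤ) (r : ℤ) : Set (ℤ × ℤ) :=
  {v | u.1 ≤ v.1 ∧ v.1 < u.1 + r ∧ u.2 ≤ v.2 ∧ v.2 < u.2 + r}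

lemma finite_box (u : ℤ × ℤ) (r : ℤ) : (box u r).Finite :=
  ((Set.finite_Icc u.1 (u.1 + r)).prod (Set.finite_Icc u.2 (u.2 + r))).subset
    fun _ hv => ⟨⟨hv.1, hv.2.1.le⟩, ⟨hv.2.2.1, hv.2.2.2.le⟩⟩

lemma box_translate (u : ℤ × ℤ) (r : ℤ) : {v | v - u ∈ box 0 r} = box u r := by
  ext v
  simp only [box, mem_ofPred_eq, Prod.fst_sub, Prod.snd_sub, Prod.fst_zero, Prod.snd_zero]
  constructor <;> intro h <;> omega

lemma box_translate' (u : ℤ × ℤ) (r : ℤ) : {v | v - -u ∈ box u r} = box 0 r := by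
  ext v
  simp only [box, mem_ofPred_eq, Prod.fst_sub, Prod.snd_sub, Prod.fst_neg, Prod.snd_neg,
    Prod.fst_zero, Prod.snd_zero]
  constructor <;> intro h <;> omega

/-- Two flat arrays can be interpolated across a strip. -/
lemma exists_interpolation {α γ C ε : ℝ} (hε : 0 ≤ ε) (hα : ε ≤ α) (hγ : ε ≤ γ)
    {G₀ G₁ : ℤ × ℤ → ℤ}
    (h₀ : Antitone G₀) (h₁ : Antitone G₁) (hf₀ : FlatArr α γ C G₀) (hf₁ : FlatArr α γ C G₁)
    (ψ : ℤ × ℤ → ℤ) (hψ1 : ∀ x z, |ψ (x + 1, z) - ψ (x, z)| ≤ 1)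
    (hψ2 : ∀ x z, |ψ (x, z + 1) - ψ (x, z)| ≤ 1) :
    ∃ V : ℤ × ℤ → ℤ, Antitone V ∧ (∀ v, ψ v ≤ 0 → V v = G₀ v) ∧
      ∀ v, 2 * C ≤ ε * ψ v → V v = G₁ v := by
  -- Two barriers: with growing ψ, e sinks from above `G₀` to below `G₁`, while f rises from below
  -- `G₀` to above `G₁`. They are antitone because both slopes are at least ε and ψ changes by at
  -- most one per step.
  set e : ℤ × ℤ → ℤ := fun v => ⌊-(α * v.1 + γ * v.2) + C - ε * ψ v⌋ with he
  set f : ℤ × ℤ → ℤ := fun v => ⌊-(α * v.1 + γ * v.2) - C + ε * ψ v⌋ with hf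
  have hψ1' : ∀ x z, |(ψ (x + 1, z) : ℝ) - ψ (x, z)| ≤ 1 := fun x z => by exact_mod_cast hψ1 x z
  have hψ2' : ∀ x z, |(ψ (x, z + 1) : ℝ) - ψ (x, z)| ≤ 1 := fun x z => by exact_mod_cast hψ2 x z
  have hea : Antitone e := by
    refine antitone_of_step (fun x z => Int.floor_le_floor ?_) fun x z => Int.floor_le_floor ?_
    · have := abs_le.1 (hψ1' x z)
      push_cast
      nlinarith
    · have := abs_le.1 (hψ2' x z)
      push_cast
      nlinarith
  have hfa : Antitone f := by
    refine antitone_of_step (fun x z => Int.floor_le_floor ?_) fun x z => Int.floor_le_floor ?_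
    · have := abs_le.1 (hψ1' x z)
      push_cast
      nlinarith
    · have := abs_le.1 (hψ2' x z)
      push_cast
      nlinarith
  -- Minima and maxima preserve antitonicity. The expression reduces to `G₀` where f ≤ G₀ ≤ e and to
  -- `G₁` where e ≤ G₁ ≤ f.
  refine ⟨fun v => min (max (min (G₀ v) (e v)) (G₁ v)) (max (G₀ v) (f v)),
    ((h₀.min hea).max h₁).min (h₀.max hfa), fun v hv => ?_, fun v hv => ?_⟩
  · have hv' : (ψ v : ℝ) ≤ 0 := by exact_mod_cast hv
    have h1 := abs_le.1 (hf₀ v)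
    have h2 : G₀ v ≤ e v := Int.le_floor.2 (by nlinarith)
    have h3 : f v ≤ G₀ v := by
      have h4 : (f v : ℝ) ≤ G₀ v := (Int.floor_le _).trans (by nlinarith)
      exact_mod_cast h4
    simp only [min_eq_left h2, max_eq_left h3]
    exact min_eq_right (le_max_left _ _)
  · have h1 := abs_le.1 (hf₁ v)
    have h2 : G₁ v ≤ f v := Int.le_floor.2 (by linarith)
    have h3 : e v ≤ G₁ v := by
      have h4 : (e v : ℝ) ≤ G₁ v := (Int.floor_le _).trans (by linarith)
      exact_mod_cast h4
    simp only [max_eq_right ((min_le_right (G₀ v) _).trans h3)]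
    exact min_eq_left (h2.trans (le_max_right _ _))

open Classical in
lemma ent_box_le_of_eqOn {G₁ V : ℤ × ℤ → ℤ} (hV : Antitone V) {u : ℤ × ℤ} {r : ℤ}
    (h : ∀ v ∈ box (u.1 - 1, u.2 - 1) (r + 2), V v = G₁ v) :
    ent G₁ (box u r) ≤ ent V (box u r) := by
  refine ent_le_of_injOn (finite_box u r) (fun g v => if v ∈ box u r then g v else V v) ?_ ?_
  · intro g hg
    refine ⟨?_, fun v hv => by simp [hv]⟩
    have key : ∀ v v' : ℤ × ℤ, v ≤ v' → |v.1 - v'.1| ≤ 1 → |v.2 - v'.2| ≤ 1 →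
        (if v' ∈ box u r then g v' else V v') ≤ if v ∈ box u r then g v else V v := by
      intro v v' hle h1 h2
      by_cases hv : v ∈ box u r <;> by_cases hv' : v' ∈ box u r
      · simpa [hv, hv'] using hg.1 hle
      · have h3 : V v' = g v' := by
          rw [hg.2 v' hv', h]
          simp only [box, mem_ofPred_eq] at hv ⊢
          rw [abs_le] at h1 h2
          omega
        simp only [hv, hv', if_true, if_false]
        rw [h3]
        exact hg.1 hle
      · have h3 : V v = g v := by
          rw [hg.2 v hv, h]
          simp only [box, mem_ofPred_eq] at hv' ⊢
          rw [abs_le] at h1 h2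
          omega
        simp only [hv, hv', if_true, if_false]
        rw [h3]
        exact hg.1 hle
      · simpa [hv, hv'] using hV hle
    exact antitone_of_step (fun x z => key _ _ ⟨by simp, le_rfl⟩ (by simp) (by simp))
      fun x z => key _ _ ⟨le_rfl, by simp⟩ (by simp) (by simp)
  · intro g hg g' hg' heq
    ext v
    by_cases hv : v ∈ box u r
    · simpa [hv] using congrFun heq v
    · rw [hg.2 v hv, hg'.2 v hv]

/-- An interpolating array equals `G₁` near the small box and `G₀` outside the large one. Every
modification of `G₁` in the small box can be carried out on it. -/
theorem exists_box_comparison {α γ : ℝ} (hα : 0 < α) (hγ : 0 < γ) (C : ℝ) :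
    ∃ w : ℤ, 0 ≤ w ∧ ∀ G₀ G₁ : ℤ × ℤ → ℤ, Antitone G₀ → Antitone G₁ → FlatArr α γ C G₀ →
      FlatArr α γ C G₁ → ∀ (u : ℤ × ℤ) (r : ℤ),
        ent G₁ (box u r) ≤ ent G₀ (box (u.1 - w, u.2 - w) (r + 2 * w)) := by
  set ε := min α γ with hε
  have hε0 : 0 < ε := lt_min hα hγ
  obtain ⟨w₀, hw₀⟩ := exists_nat_ge (2 * C / ε)
  rw [div_le_iff₀ hε0] at hw₀
  refine ⟨w₀ + 1, by positivity, fun G₀ G₁ h₀ h₁ hf₀ hf₁ u r => ?_⟩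
  -- Here ψ measures the distance from the box in the maximum norm, shifted so that it is still
  -- nonpositive on the surrounding collar of width one.
  obtain ⟨V, hV, hV1, hV2⟩ := exists_interpolation hε0.le (min_le_left _ _) (min_le_right _ _)
    h₁ h₀ hf₁ hf₀ (fun v => max (max (u.1 - 1 - v.1) (v.1 - (u.1 + r)))
      (max (u.2 - 1 - v.2) (v.2 - (u.2 + r)))) (fun x z => by simp only [abs_le]; omega)
    (fun x z => by simp only [abs_le]; omega)
  refine (ent_box_le_of_eqOn hV fun v hv => hV1 v ?_).trans ?_
  · simp only [box, mem_ofPred_eq] at hv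
    omega
  · refine ent_le_of_injOn (finite_box _ _) id (fun g hg => ⟨hg.1, fun v hv => ?_⟩) (injOn_id _)
    have h1 : (w₀ : ℤ) ≤ max (max (u.1 - 1 - v.1) (v.1 - (u.1 + r)))
        (max (u.2 - 1 - v.2) (v.2 - (u.2 + r))) := by
      simp only [box, mem_ofPred_eq] at hv
      omega
    have h2 : (w₀ : ℝ) ≤ (max (max (u.1 - 1 - v.1) (v.1 - (u.1 + r)))
        (max (u.2 - 1 - v.2) (v.2 - (u.2 + r))) : ℤ) := by exact_mod_cast h1
    rw [id, hg.2 v, hV2 v (by nlinarith)]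
    intro hv'
    apply hv
    simp only [box, mem_ofPred_eq] at hv' ⊢
    omega

/-! ### Staircases in a rectangle -/

/-- The staircases in a rectangle with `m` columns of height `h`. -/
def stairs (m h : ℕ) : Set (ℕ → ℕ) := {f | Antitone f ∧ f 0 ≤ h ∧ ∀ i, m ≤ i → f i = 0}

/-- Prepend a column to a staircase. -/
def prependColumn (a : ℕ) (f : ℕ → ℕ) : ℕ → ℕ
  | 0 => a
  | i + 1 => f i

lemma stairs_zero_left (h : ℕ) : stairs 0 h = {fun _ => 0} := by
  ext f
  constructor
  · rintro ⟨-, -, h3⟩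
    exact funext fun i => h3 i (Nat.zero_le i)
  · rintro rfl
    exact ⟨antitone_const, Nat.zero_le _, fun _ _ => rfl⟩

lemma stairs_zero_right (m : ℕ) : stairs m 0 = {fun _ => 0} := by
  ext f
  constructor
  · rintro ⟨h1, h2, -⟩
    exact funext fun i => Nat.le_zero.1 ((h1 (Nat.zero_le i)).trans h2)
  · rintro rfl
    exact ⟨antitone_const, Nat.zero_le _, fun _ _ => rfl⟩

/-- Pascal's rule: the first column has either height at most h or full height h + 1. -/
lemma stairs_succ_succ (m h : ℕ) :
    stairs (m + 1) (h + 1) = stairs (m + 1) h ∪ prependColumn (h + 1) '' stairs m (h + 1) := by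
  ext f
  constructor
  · rintro ⟨h1, h2, h3⟩
    rcases Nat.lt_or_ge (f 0) (h + 1) with hlt | hge
    · exact Or.inl ⟨h1, by omega, h3⟩
    · refine Or.inr ⟨fun i => f (i + 1), ⟨fun a b hab => h1 (by omega),
        (h1 (Nat.zero_le _)).trans h2, fun i hi => h3 _ (by omega)⟩, ?_⟩
      ext i
      cases i with
      | zero => simp only [prependColumn]; omega
      | succ i => rfl
  · rintro (⟨h1, h2, h3⟩ | ⟨g, ⟨h1, h2, h3⟩, rfl⟩)
    · exact ⟨h1, by omega, h3⟩
    · refine ⟨antitone_nat_of_succ_le fun i => ?_, le_rfl, fun i hi => ?_⟩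
      · cases i with
        | zero => exact h2
        | succ i => exact h1 (Nat.le_succ i)
      · cases i with
        | zero => omega
        | succ i => exact h3 i (by omega)

lemma finite_ncard_stairs (m h : ℕ) :
    (stairs m h).Finite ∧ (stairs m h).ncard = (m + h).choose m := by
  induction m generalizing h with
  | zero => simp [stairs_zero_left]
  | succ m ihm =>
    induction h with
    | zero => simp [stairs_zero_right]
    | succ h ihh =>
      have hinj : Function.Injective (prependColumn (h + 1)) := fun f g hfg =>
        funext fun i => congrFun hfg (i + 1)
      have hdisj : Disjoint (stairs (m + 1) h) (prependColumn (h + 1) '' stairs m (h + 1)) := by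
        rw [Set.disjoint_left]
        rintro _ ⟨-, h2, -⟩ ⟨g, -, rfl⟩
        simp [prependColumn] at h2
      have hfin := (ihm (h + 1)).1.image (prependColumn (h + 1))
      rw [stairs_succ_succ]
      refine ⟨ihh.1.union hfin, ?_⟩
      rw [ncard_union_eq hdisj ihh.1 hfin, ncard_image_of_injective _ hinj, ihh.2, (ihm (h + 1)).2,
        show m + 1 + (h + 1) = (m + (h + 1)) + 1 by ring, Nat.choose_succ_succ',
        show m + 1 + h = m + (h + 1) by ring, add_comm]

instance (m h : ℕ) : Finite (stairs m h) := (finite_ncard_stairs m h).1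

lemma card_stairs (m h : ℕ) : Nat.card (stairs m h) = (m + h).choose m := by
  rw [Nat.card_coe_set_eq, (finite_ncard_stairs m h).2]

/-- The entropy per column of staircases with slope `α`. -/
noncomputable def stairRate (α : ℝ) : ℝ := (1 + α) * Real.log (1 + α) - α * Real.log α

/-- A single term of the binomial expansion of (p + q) ^ (m + h) = 1 is at most 1; the weights p = 1
/ (1 + α), q = α / (1 + α) are optimal for slope α. -/
lemma log_choose_le {α : ℝ} (hα : 0 < α) (m h : ℕ) :
    Real.log ((m + h).choose m) ≤ m * Real.log (1 + α) + h * (Real.log (1 + α) - Real.log α) := by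
  set p : ℝ := 1 / (1 + α) with hp
  set q : ℝ := α / (1 + α) with hq
  have h1 : 0 < 1 + α := by linarith
  have hp0 : 0 < p := by positivity
  have hq0 : 0 < q := by positivity
  have hpq : p + q = 1 := by rw [hp, hq]; field_simp
  have h2 : p ^ m * q ^ h * ((m + h).choose m) ≤ 1 := by
    have h3 := add_pow p q (m + h)
    rw [hpq, one_pow] at h3
    rw [h3]
    have h4 := Finset.single_le_sum (f := fun k => p ^ k * q ^ (m + h - k) * ((m + h).choose k : ℝ))
      (s := Finset.range (m + h + 1)) (fun k _ => by positivity)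
      (Finset.mem_range.2 (by omega : m < m + h + 1))
    simpa using h4
  have hc : (0 : ℝ) < (m + h).choose m := by exact_mod_cast Nat.choose_pos (by omega)
  have h5 := Real.log_le_log (by positivity) h2
  rw [Real.log_one, Real.log_mul (by positivity) hc.ne', Real.log_mul (by positivity) (by positivity),
    Real.log_pow, Real.log_pow, hp, hq, Real.log_div one_ne_zero h1.ne', Real.log_one,
    Real.log_div hα.ne' h1.ne'] at h5
  linarith

/-! ### Boxes with planar boundary conditions -/

/-- The reference array with slopes `-α`, `-γ`. -/
noncomputable def refArr (α γ : ℝ) : ℤ × ℤ → ℤ := fun v => ⌊-(α * v.1 + γ * v.2)⌋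

lemma antitone_refArr {α γ : ℝ} (hα : 0 ≤ α) (hγ : 0 ≤ γ) : Antitone (refArr α γ) :=
  antitone_of_step (fun x z => Int.floor_le_floor (by push_cast; linarith))
    fun x z => Int.floor_le_floor (by push_cast; linarith)

lemma flatArr_refArr (α γ : ℝ) : FlatArr α γ 1 (refArr α γ) := fun v => by
  have h1 := Int.floor_le (-(α * v.1 + γ * v.2))
  have h2 := Int.lt_floor_add_one (-(α * v.1 + γ * v.2))
  rw [abs_le, refArr]
  constructor <;> linarith

lemma FlatArr.mono {α γ C C' : ℝ} {G : ℤ × ℤ → ℤ} (h : FlatArr α γ C G) (hC : C ≤ C') :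
    FlatArr α γ C' G := fun v => (h v).trans hC

/-- The entropy of the reference array in a box of side `r`. -/
noncomputable def boxEnt (α γ : ℝ) (r : ℤ) : ℝ := ent (refArr α γ) (box 0 r)

/-- Each of the L rows is a staircase of length L whose height is at most the drop of the boundary
values. Counting the rows as if they were independent bounds the number of arrays from above. -/
lemma boxEnt_le {α γ : ℝ} (hα : 0 < α) (hγ : 0 ≤ γ) (L : ℕ) :
    boxEnt α γ L ≤ L * (L * stairRate α + (α + 3) * (Real.log (1 + α) - Real.log α)) := by
  set h : ℕ := ⌈α * (L + 1) + 1⌉₊ with hh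
  set G₀ := refArr α γ with hG₀
  have hanti : Antitone G₀ := antitone_refArr hα.le hγ
  have hdrop : ∀ z : ℤ, G₀ (-1, z) - G₀ (L, z) ≤ h := by
    intro z
    have h1 : (G₀ (-1, z) : ℝ) - G₀ (L, z) ≤ α * (L + 1) + 1 := by
      have h2 := Int.floor_le (-(α * ((-1 : ℤ) : ℝ) + γ * (z : ℝ)))
      have h3 := Int.lt_floor_add_one (-(α * ((L : ℤ) : ℝ) + γ * (z : ℝ)))
      simp only [hG₀, refArr]
      push_cast at h2 h3 ⊢
      linarith
    have h4 : ((G₀ (-1, z) - G₀ (L, z) : ℤ) : ℝ) ≤ ((h : ℤ) : ℝ) := by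
      push_cast
      exact h1.trans (Nat.le_ceil _)
    exact_mod_cast h4
  have hbd : ∀ G ∈ arrSet G₀ (box 0 L), ∀ i : ℕ, i < L → ∀ z : ℤ,
      G₀ (L, z) ≤ G (i, z) ∧ G (i, z) ≤ G₀ (-1, z) := by
    intro G hG i hi z
    rw [← hG.2 (L, z) (by simp [box]), ← hG.2 (-1, z) (by simp [box])]
    exact ⟨hG.1 ⟨by simpa using hi.le, le_rfl⟩, hG.1 ⟨by simp, le_rfl⟩⟩
  let F : arrSet G₀ (box 0 L) → Fin L → stairs L h := fun G z =>
    ⟨fun i => if i < L then (G.1 (i, z) - G₀ (L, z)).toNat else 0, by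
      refine ⟨fun a b hab => ?_, ?_, fun i hi => by simp [not_lt.2 hi]⟩
      · by_cases hb : b < L
        · have ha : a < L := by omega
          have : G.1 (b, z) ≤ G.1 (a, z) := G.2.1 ⟨by simpa using hab, le_rfl⟩
          simp only [ha, hb, if_true]
          omega
        · simp [hb]
      · by_cases h0 : 0 < L
        · have h1 := (hbd G.1 G.2 0 h0 z).2
          have h2 := hdrop z
          simp only [h0, if_true]
          omega
        · simp [h0]⟩
  have hF : Function.Injective F := by
    intro G G' hGG
    apply Subtype.ext
    ext ⟨x, z⟩
    by_cases hv : (x, z) ∈ box 0 L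
    · have hv' := hv
      simp only [box, mem_ofPred_eq, Prod.fst_zero, Prod.snd_zero, zero_add] at hv'
      obtain ⟨i, rfl⟩ := Int.eq_ofNat_of_zero_le hv'.1
      obtain ⟨j, rfl⟩ := Int.eq_ofNat_of_zero_le hv'.2.2.1
      have hi : i < L := by omega
      have hj : j < L := by omega
      have h1 := congrFun (congrArg Subtype.val (congrFun hGG ⟨j, hj⟩)) i
      simp only [F, hi, if_true] at h1
      have h2 := (hbd G.1 G.2 i hi j).1
      have h3 := (hbd G'.1 G'.2 i hi j).1
      omega
    · rw [G.2.2 _ hv, G'.2.2 _ hv]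
  have hcard := Nat.card_le_card_of_injective F hF
  rw [Nat.card_coe_set_eq, Nat.card_fun, card_stairs, Nat.card_fin] at hcard
  have h1 := log_natCast_le hcard
  push_cast at h1
  rw [Real.log_pow] at h1
  refine h1.trans (mul_le_mul_of_nonneg_left ?_ (Nat.cast_nonneg L))
  refine (log_choose_le hα L h).trans ?_
  have h2 : (h : ℝ) ≤ α * (L + 1) + 2 := by
    have := Nat.ceil_lt_add_one (a := α * (L + 1) + 1) (by positivity)
    linarith
  have h3 : 0 ≤ Real.log (1 + α) - Real.log α :=
    sub_nonneg.2 (Real.log_le_log hα (by linarith))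
  unfold stairRate
  nlinarith

/-- The reference array for the lower bound, constant in `x` on blocks of length `l`. -/
noncomputable def blockArr (α γ : ℝ) (l : ℕ) : ℤ × ℤ → ℤ :=
  fun v => ⌊-(α * l * ((v.1 / l : ℤ) + 1)) - γ * v.2⌋

/-- The reference array drops by at least a from each block to the next and from each row to the
next. This leaves room for an arbitrary staircase of height at most a on every block of every row.
-/
lemma blockArr_step_add_le {α γ : ℝ} {l a : ℕ} (ha : (a : ℝ) ≤ α * l) (haγ : (a : ℝ) ≤ γ)
    (x z : ℤ) : blockArr α γ l (x, z + 1) + a ≤ blockArr α γ l (x, z) ∧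
      ∀ y, x / l + 1 = y / l → blockArr α γ l (y, z) + a ≤ blockArr α γ l (x, z) := by
  constructor
  · refine Int.le_floor.2 ?_
    have h1 := Int.floor_le (-(α * l * (((x, z + 1).1 / l : ℤ) + 1)) - γ * ((x, z + 1).2 : ℤ))
    rw [blockArr]
    push_cast at h1 ⊢
    linarith
  · intro y hy
    refine Int.le_floor.2 ?_
    have h1 := Int.floor_le (-(α * l * (((y, z).1 / l : ℤ) + 1)) - γ * ((y, z).2 : ℤ))
    rw [blockArr]
    simp only [← hy] at h1 ⊢
    push_cast at h1 ⊢
    linarith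

lemma add_one_ediv_cases (x : ℤ) {l : ℕ} (hl : 0 < l) :
    ((x + 1) / l = x / l ∧ (x + 1) % l = x % l + 1) ∨ x / l + 1 = (x + 1) / l := by
  have hl' : (0 : ℤ) < l := by exact_mod_cast hl
  have h1 := Int.emod_add_mul_ediv x l
  have h2 := Int.emod_nonneg x hl'.ne'
  have h3 := Int.emod_lt_of_pos x hl'
  rcases lt_or_ge (x % l + 1) l with h | h
  · left
    have h4 : x + 1 = (x % l + 1) + l * (x / l) := by linarith
    have h5 : (x + 1) / l = x / l := by
      rw [h4, Int.add_mul_ediv_left _ _ hl'.ne', Int.ediv_eq_zero_of_lt (by omega) h, zero_add]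
    refine ⟨h5, ?_⟩
    have h6 := Int.emod_add_mul_ediv (x + 1) l
    rw [h5] at h6
    linarith
  · right
    have h4 : x + 1 = l * (x / l + 1) := by
      have : x % l + 1 = l := by omega
      linarith
    exact (Int.ediv_eq_of_eq_mul_right hl'.ne' h4).symm

lemma antitone_blockArr_add {α γ : ℝ} {l a : ℕ} (hl : 0 < l) (ha : (a : ℝ) ≤ α * l)
    (haγ : (a : ℝ) ≤ γ) (ψ : ℤ → ℤ → ℕ → ℕ) (hψ : ∀ j z, ψ j z ∈ stairs l a) :
    Antitone fun v : ℤ × ℤ => blockArr α γ l v + ψ (v.1 / l) v.2 (v.1 % l).toNat := by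
  have hle : ∀ j z i, ψ j z i ≤ a := fun j z i => ((hψ j z).1 (Nat.zero_le i)).trans (hψ j z).2.1
  refine antitone_of_step (fun x z => ?_) (fun x z => ?_)
  · rcases add_one_ediv_cases x hl with ⟨h1, h2⟩ | h
    · have h3 := Int.emod_nonneg x (by exact_mod_cast hl.ne' : (l : ℤ) ≠ 0)
      have h4 : ψ (x / l) z (x % l + 1).toNat ≤ ψ (x / l) z (x % l).toNat :=
        (hψ _ _).1 (by omega)
      simp only [blockArr, h1, h2]
      omega
    · have h1 := (blockArr_step_add_le ha haγ x z).2 (x + 1) h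
      have h2 := hle ((x + 1) / l) z ((x + 1) % l).toNat
      simp only
      omega
  · have h1 := (blockArr_step_add_le ha haγ x z).1
    have h2 := hle (x / l) (z + 1) (x % l).toNat
    simp only
    omega

lemma antitone_blockArr {α γ : ℝ} {l a : ℕ} (hl : 0 < l) (ha : (a : ℝ) ≤ α * l)
    (haγ : (a : ℝ) ≤ γ) : Antitone (blockArr α γ l) := by
  have := antitone_blockArr_add hl ha haγ (fun _ _ _ => 0)
    fun _ _ => ⟨antitone_const, Nat.zero_le _, fun _ _ => rfl⟩
  simpa using this

lemma flatArr_blockArr {α γ : ℝ} (hα : 0 < α) {l : ℕ} (hl : 0 < l) :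
    FlatArr α γ (α * l + 1) (blockArr α γ l) := by
  intro v
  have hl' : (0 : ℤ) < l := by exact_mod_cast hl
  have h1 := Int.floor_le (-(α * l * ((v.1 / l : ℤ) + 1)) - γ * v.2)
  have h2 := Int.lt_floor_add_one (-(α * l * ((v.1 / l : ℤ) + 1)) - γ * v.2)
  have h3 : (((v.1 % l : ℤ) : ℝ)) + l * ((v.1 / l : ℤ) : ℝ) = v.1 := by
    exact_mod_cast Int.emod_add_mul_ediv v.1 l
  have h4 : (0 : ℝ) ≤ ((v.1 % l : ℤ) : ℝ) := by exact_mod_cast Int.emod_nonneg v.1 hl'.ne'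
  have h5 : ((v.1 % l : ℤ) : ℝ) ≤ l := by exact_mod_cast (Int.emod_lt_of_pos v.1 hl').le
  have h6 : α * v.1 = α * ((v.1 % l : ℤ) : ℝ) + α * l * ((v.1 / l : ℤ) : ℝ) := by
    rw [← h3]; ring
  have h7 : 0 ≤ α * ((v.1 % l : ℤ) : ℝ) := by positivity
  have h8 := mul_le_mul_of_nonneg_left h5 hα.le
  rw [abs_le, blockArr]
  constructor <;> linarith

lemma le_ent_blockArr {α γ : ℝ} {l a : ℕ} (hl : 0 < l) (ha : (a : ℝ) ≤ α * l)
    (haγ : (a : ℝ) ≤ γ) (k : ℕ) :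
    k * (k * l) * Real.log ((l + a).choose l) ≤ ent (blockArr α γ l) (box 0 (k * l : ℕ)) := by
  have hl' : (0 : ℤ) < l := by exact_mod_cast hl
  let ψ : (Fin k × Fin (k * l) → stairs l a) → ℤ → ℤ → ℕ → ℕ := fun φ j z =>
    if h : (0 ≤ j ∧ j.toNat < k) ∧ 0 ≤ z ∧ z.toNat < k * l then
      (φ (⟨j.toNat, h.1.2⟩, ⟨z.toNat, h.2.2⟩)).1 else fun _ => 0
  have hψ : ∀ φ j z, ψ φ j z ∈ stairs l a := by
    intro φ j z
    simp only [ψ]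
    split_ifs with h
    · exact Subtype.coe_prop _
    · exact ⟨antitone_const, Nat.zero_le _, fun _ _ => rfl⟩
  -- The square consists of k blocks in each of k l rows; the staircases on them are chosen
  -- independently.
  let F : (Fin k × Fin (k * l) → stairs l a) → arrSet (blockArr α γ l) (box 0 (k * l : ℕ)) :=
    fun φ => ⟨fun v => blockArr α γ l v + ψ φ (v.1 / l) v.2 (v.1 % l).toNat,
      antitone_blockArr_add hl ha haγ (ψ φ) (hψ φ), fun v hv => by
        have h0 : ¬ ((0 ≤ v.1 / l ∧ (v.1 / l).toNat < k) ∧ 0 ≤ v.2 ∧ v.2.toNat < k * l) := by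
          rintro ⟨⟨h1, h2⟩, h3, h4⟩
          apply hv
          have h5 : 0 ≤ v.1 := (Int.ediv_nonneg_iff_of_pos hl').1 h1
          have h6 : v.1 < k * l := (Int.ediv_lt_iff_lt_mul hl').1 (by omega)
          simp only [box, mem_ofPred_eq, Prod.fst_zero, Prod.snd_zero, zero_add]
          push_cast
          have h7 : v.2 < ((k * l : ℕ) : ℤ) := by omega
          push_cast at h7
          exact ⟨h5, h6, h3, h7⟩
        simp only [ψ, dif_neg h0]
        simp⟩
  have hF : Function.Injective F := by
    intro φ φ' hφ
    ext ⟨j, z⟩ i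
    rcases lt_or_ge i l with hi | hi
    · have h1 := congrFun (congrArg Subtype.val hφ) ((j : ℤ) * l + i, (z : ℤ))
      have h2 : ((j : ℤ) * l + i) / l = j := by
        rw [add_comm, Int.add_mul_ediv_right _ _ hl'.ne', Int.ediv_eq_zero_of_lt (by omega)
          (by exact_mod_cast hi), zero_add]
      have h3 : ((j : ℤ) * l + i) % l = i := by
        rw [add_comm, Int.add_mul_emod_self_right, Int.emod_eq_of_lt (by omega)
          (by exact_mod_cast hi)]
      have h4 : ((0 : ℤ) ≤ (j : ℤ) ∧ ((j : ℤ)).toNat < k) ∧ (0 : ℤ) ≤ (z : ℤ) ∧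
          ((z : ℤ)).toNat < k * l := by
        refine ⟨⟨by omega, by simp⟩, by omega, by simp⟩
      simp only [F, ψ, h2, h3, dif_pos h4] at h1
      simpa using h1
    · rw [(φ (j, z)).2.2.2 i hi, (φ' (j, z)).2.2.2 i hi]
  have : Finite (arrSet (blockArr α γ l) (box 0 (k * l : ℕ))) :=
    finite_arrSet _ (finite_box _ _)
  have hcard := Nat.card_le_card_of_injective F hF
  rw [Nat.card_coe_set_eq, Nat.card_fun, card_stairs, Nat.card_prod, Nat.card_fin,
    Nat.card_fin] at hcard
  have h1 := log_natCast_le hcard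
  push_cast at h1
  rw [Real.log_pow] at h1
  push_cast at h1
  exact h1

/-! ### The entropy per unit area of arrays with planar boundary conditions -/

/-- The boxes of side `p - 2`, two units apart, which are arranged in a grid of mesh `p`. -/
def gridBox (p : ℤ) (v : ℤ × ℤ) : Set (ℤ × ℤ) := box (p * v.1 + 1, p * v.2 + 1) (p - 2)

lemma sep_gridBox {p : ℤ} (hp : 2 ≤ p) : Pairwise fun v v' => Sep (gridBox p v) (gridBox p v') := by
  have key : ∀ s t a b : ℤ, s < t → p * s + 1 ≤ a → a < p * s + 1 + (p - 2) →
      p * t + 1 ≤ b → b < p * t + 1 + (p - 2) → 1 < b - a := by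
    intro s t a b hst h1 h2 h3 h4
    have : p * s + p ≤ p * t := by nlinarith
    omega
  intro v v' hne a ha b hb
  obtain ⟨h1, h2, h3, h4⟩ := ha
  obtain ⟨h5, h6, h7, h8⟩ := hb
  simp only at h1 h2 h3 h4 h5 h6 h7 h8
  simp only [lt_abs]
  rcases lt_trichotomy v.1 v'.1 with h | h | h
  · have := key _ _ _ _ h h1 h2 h5 h6
    omega
  · rcases lt_trichotomy v.2 v'.2 with h' | h' | h'
    · have := key _ _ _ _ h' h3 h4 h7 h8
      omega
    · exact absurd (Prod.ext h h') hne
    · have := key _ _ _ _ h' h7 h8 h3 h4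
      omega
  · have := key _ _ _ _ h h5 h6 h1 h2
    omega

/-- The mesh r + 2 w + 2 is made up of a box of side r, collars of width w for the change of
boundary values, and a gap that separates neighboring boxes. -/
lemma ent_add_card_mul_le {α γ C : ℝ} {w r : ℤ} (hw : 0 ≤ w) (hr : 0 ≤ r)
    (hcmp : ∀ G₀ : ℤ × ℤ → ℤ, Antitone G₀ → FlatArr α γ C G₀ → ∀ u : ℤ × ℤ,
      boxEnt α γ r ≤ ent G₀ (box u (r + 2 * w)))
    {G₀ : ℤ × ℤ → ℤ} (h₀ : Antitone G₀) (hf₀ : FlatArr α γ C G₀) (I : Finset (ℤ × ℤ))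
    {B : Set (ℤ × ℤ)} (hB : B.Finite) (hsB : ∀ v ∈ I, Sep (gridBox (r + 2 * w + 2) v) B) :
    ent G₀ B + I.card * boxEnt α γ r ≤ ent G₀ (B ∪ ⋃ v ∈ I, gridBox (r + 2 * w + 2) v) := by
  refine le_trans ?_ (ent_sum_le h₀ I _ (fun v => finite_box _ _)
    (sep_gridBox (p := r + 2 * w + 2) (by omega)) hB hsB)
  rw [← nsmul_eq_mul]
  refine add_le_add le_rfl (Finset.card_nsmul_le_sum _ _ _ fun v _ => ?_)
  have := hcmp G₀ h₀ hf₀ ((r + 2 * w + 2) * v.1 + 1, (r + 2 * w + 2) * v.2 + 1)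
  show boxEnt α γ r ≤ ent G₀ (box _ (r + 2 * w + 2 - 2))
  rwa [show r + 2 * w + 2 - 2 = r + 2 * w by ring]

lemma exists_boxEnt_comparison {α γ : ℝ} (hα : 0 < α) (hγ : 0 < γ) {C : ℝ} (hC : 2 ≤ C) :
    ∃ w : ℤ, 0 ≤ w ∧ (∀ r, ∀ G₀ : ℤ × ℤ → ℤ, Antitone G₀ → FlatArr α γ C G₀ → ∀ u : ℤ × ℤ,
      boxEnt α γ r ≤ ent G₀ (box u (r + 2 * w))) ∧
      ∀ r, ∀ G₀ : ℤ × ℤ → ℤ, Antitone G₀ → FlatArr α γ C G₀ → ∀ u : ℤ × ℤ,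
      ent G₀ (box u r) ≤ boxEnt α γ (r + 2 * w) := by
  obtain ⟨w, hw, hcmp⟩ := exists_box_comparison hα hγ C
  -- A translate of `refArr`, corrected by an integer. The two roundings together cost at most 2,
  -- whence the hypothesis 2 ≤ C.
  set T : ℤ × ℤ → ℤ × ℤ → ℤ := fun u v =>
    refArr α γ (v - u) + -⌊α * u.1 + γ * u.2⌋ with hT
  have hTa : ∀ u, Antitone (T u) := fun u v v' hv => by
    have := antitone_refArr hα.le hγ.le (sub_le_sub_right hv u)
    simpa [hT] using this
  have hTf : ∀ u, FlatArr α γ C (T u) := by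
    intro u v
    have h1 := abs_le.1 (flatArr_refArr α γ (v - u))
    have h2 := Int.floor_le (α * u.1 + γ * u.2)
    have h3 := Int.lt_floor_add_one (α * u.1 + γ * u.2)
    simp only [hT, Prod.fst_sub, Prod.snd_sub] at h1 ⊢
    push_cast at h1 ⊢
    rw [abs_le]
    constructor <;> nlinarith
  refine ⟨w, hw, fun r G₀ h₀ hf₀ u => ?_, fun r G₀ h₀ hf₀ u => ?_⟩
  · have h1 := ent_translate (G := refArr α γ) (u.1 + w, u.2 + w)
      (-⌊α * ((u.1 + w : ℤ) : ℝ) + γ * ((u.2 + w : ℤ) : ℝ)⌋) (finite_box 0 r)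
    rw [box_translate] at h1
    have h2 := hcmp G₀ (T (u.1 + w, u.2 + w)) h₀ (hTa _) hf₀ (hTf _) (u.1 + w, u.2 + w) r
    simp only [add_sub_cancel_right] at h2
    exact h1.trans h2
  · have h2 := hcmp (T (u.1 - w, u.2 - w)) G₀ (hTa _) h₀ (hTf _) hf₀ u r
    have h1 := ent_translate (G := T (u.1 - w, u.2 - w)) (-(u.1 - w, u.2 - w))
      (⌊α * ((u.1 - w : ℤ) : ℝ) + γ * ((u.2 - w : ℤ) : ℝ)⌋)
      (finite_box (u.1 - w, u.2 - w) (r + 2 * w))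
    rw [box_translate'] at h1
    refine (h2.trans h1).trans (le_of_eq ?_)
    unfold boxEnt
    congr 1
    ext v
    simp only [hT, sub_neg_eq_add, add_sub_cancel_right]
    ring

lemma boxEnt_nonneg (α γ : ℝ) (r : ℤ) : 0 ≤ boxEnt α γ r := ent_nonneg _ _

/-- A quadratic inequality with linear errors, valid for all natural numbers, holds between the
leading coefficients. -/
lemma le_of_forall_nat_quadratic {a b c d : ℝ}
    (h : ∀ k : ℕ, a * (k : ℝ) ^ 2 ≤ b * (k : ℝ) ^ 2 + c * k + d) : a ≤ b := by
  by_contra! hlt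
  obtain ⟨k, hk⟩ := exists_nat_gt (max 1 ((|c| + |d|) / (a - b)))
  have h1 : (1 : ℝ) < k := (le_max_left _ _).trans_lt hk
  have h2 : (|c| + |d|) / (a - b) < k := (le_max_right _ _).trans_lt hk
  rw [div_lt_iff₀ (by linarith)] at h2
  have h3 := h k
  have h4 : c * k ≤ |c| * k := mul_le_mul_of_nonneg_right (le_abs_self c) (by linarith)
  have h5 : d ≤ |d| * k := (le_abs_self d).trans (le_mul_of_one_le_right (abs_nonneg d) h1.le)
  nlinarith

lemma card_mul_boxEnt_le {α γ C : ℝ} (hα : 0 ≤ α) (hγ : 0 ≤ γ) (hC : 1 ≤ C) {w r : ℤ}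
    (hw : 0 ≤ w) (hr : 0 ≤ r)
    (hcmp : ∀ G₀ : ℤ × ℤ → ℤ, Antitone G₀ → FlatArr α γ C G₀ → ∀ u : ℤ × ℤ,
      boxEnt α γ r ≤ ent G₀ (box u (r + 2 * w))) (k : ℕ) :
    (k : ℝ) ^ 2 * boxEnt α γ r ≤ boxEnt α γ (k * (r + 2 * w + 2)) := by
  set p := r + 2 * w + 2 with hp
  have h := ent_add_card_mul_le hw hr hcmp (antitone_refArr hα hγ)
    ((flatArr_refArr α γ).mono hC) (Finset.Ico (0 : ℤ) k ×ˢ Finset.Ico (0 : ℤ) k)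
    (B := ∅) finite_empty (fun v _ a _ b hb => absurd hb (notMem_empty b))
  rw [Finset.card_product, Int.card_Ico, sub_zero, Int.toNat_natCast, empty_union] at h
  have h1 := ent_nonneg (refArr α γ) ∅
  refine le_trans ?_ (ent_mono (A := ⋃ v ∈ Finset.Ico (0 : ℤ) k ×ˢ Finset.Ico (0 : ℤ) k,
    gridBox p v) (finite_box 0 (k * p)) ?_)
  · refine le_trans (le_of_eq ?_) (le_trans (le_add_of_nonneg_left h1) h)
    push_cast
    ring
  · intro a ha
    simp only [mem_iUnion, Finset.mem_product, Finset.mem_Ico, exists_prop] at ha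
    obtain ⟨v, ⟨⟨h2, h3⟩, h4, h5⟩, h6, h7, h8, h9⟩ := ha
    simp only at h6 h7 h8 h9
    have h10 : 0 ≤ p * v.1 := mul_nonneg (by omega) h2
    have h11 : 0 ≤ p * v.2 := mul_nonneg (by omega) h4
    have h12 : p * v.1 + p ≤ k * p := by nlinarith
    have h13 : p * v.2 + p ≤ k * p := by nlinarith
    simp only [box, mem_ofPred_eq, Prod.fst_zero, Prod.snd_zero]
    omega

/-- β is the supremum of `boxEnt` per area of a grid cell of side r + 2 w + 2. Its upper bound comes
from counting rows in k ^ 2 copies of a box, its lower bound from the block array on squares of side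
k l. In both cases the boundary terms are of lower order in k. -/
theorem exists_entropy_rate {α γ : ℝ} (hα : 0 < α) (hγ : 0 < γ) {C : ℝ} (hC : 2 ≤ C) :
    ∃ (w : ℤ) (β : ℝ), 0 ≤ w ∧ 0 ≤ β ∧
      (∀ r, ∀ G₀ : ℤ × ℤ → ℤ, Antitone G₀ → FlatArr α γ C G₀ → ∀ u : ℤ × ℤ,
        boxEnt α γ r ≤ ent G₀ (box u (r + 2 * w))) ∧
      (∀ r, 0 ≤ r → ∀ G₀ : ℤ × ℤ → ℤ, Antitone G₀ → FlatArr α γ C G₀ → ∀ u : ℤ × ℤ,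
        ent G₀ (box u r) ≤ β * (r + 4 * w + 2) ^ 2) ∧
      (∀ δ > 0, ∃ r : ℤ, 0 ≤ r ∧ (β - δ) * (r + 2 * w + 2) ^ 2 ≤ boxEnt α γ r ∧
        boxEnt α γ r ≤ β * (r + 2 * w + 2) ^ 2) ∧
      β ≤ stairRate α ∧
      ∀ l : ℕ, 0 < l → α * l ≤ γ → α * l + 1 ≤ C →
        Real.log ((l + ⌊α * l⌋₊).choose l) / l ≤ β := by
  obtain ⟨w, hw, hcmp1, hcmp2⟩ := exists_boxEnt_comparison hα hγ hC
  have hpos : ∀ r : ℤ, 0 ≤ r → (0 : ℝ) < r + 2 * w + 2 := fun r hr => by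
    have : (0 : ℝ) ≤ r := by exact_mod_cast hr
    have : (0 : ℝ) ≤ w := by exact_mod_cast hw
    linarith
  have hup : ∀ r : ℤ, 0 ≤ r → boxEnt α γ r ≤ stairRate α * (r + 2 * w + 2) ^ 2 := by
    intro r hr
    refine le_of_forall_nat_quadratic
      (c := (r + 2 * w + 2) * ((α + 3) * (Real.log (1 + α) - Real.log α))) (d := 0) fun k => ?_
    have h1 := card_mul_boxEnt_le hα.le hγ.le (by linarith) hw hr (hcmp1 r) k
    have h2 := boxEnt_le hα hγ.le (k * (r + 2 * w + 2)).toNat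
    have h3 : (((k * (r + 2 * w + 2)).toNat : ℕ) : ℤ) = k * (r + 2 * w + 2) :=
      Int.toNat_of_nonneg (mul_nonneg (by omega) (by omega))
    have h4 : (((k * (r + 2 * w + 2)).toNat : ℕ) : ℝ) = k * (r + 2 * w + 2) := by
      exact_mod_cast h3
    rw [h3, h4] at h2
    linarith
  set S : Set ℝ := {b | ∃ r : ℤ, 0 ≤ r ∧ b = boxEnt α γ r / (r + 2 * w + 2) ^ 2} with hS
  have hSb : ∀ b ∈ S, b ≤ stairRate α := by
    rintro _ ⟨r, hr, rfl⟩
    rw [div_le_iff₀ (pow_pos (hpos r hr) 2)]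
    exact hup r hr
  have hSbdd : BddAbove S := ⟨_, hSb⟩
  have hSne : S.Nonempty := ⟨_, 0, le_rfl, rfl⟩
  have hle : ∀ r : ℤ, 0 ≤ r → boxEnt α γ r ≤ sSup S * (r + 2 * w + 2) ^ 2 := by
    intro r hr
    rw [← div_le_iff₀ (pow_pos (hpos r hr) 2)]
    exact le_csSup hSbdd ⟨r, hr, rfl⟩
  have hle2 : ∀ r, 0 ≤ r → ∀ G₀ : ℤ × ℤ → ℤ, Antitone G₀ → FlatArr α γ C G₀ → ∀ u : ℤ × ℤ,
      ent G₀ (box u r) ≤ sSup S * (r + 4 * w + 2) ^ 2 := by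
    intro r hr G₀ h₀ hf₀ u
    refine (hcmp2 r G₀ h₀ hf₀ u).trans ((hle (r + 2 * w) (by omega)).trans (le_of_eq ?_))
    push_cast
    ring
  refine ⟨w, sSup S, hw, ?_, hcmp1, hle2, ?_, csSup_le hSne hSb, ?_⟩
  · refine le_trans ?_ (le_csSup hSbdd ⟨0, le_rfl, rfl⟩)
    exact div_nonneg (boxEnt_nonneg _ _ _) (sq_nonneg _)
  · intro δ hδ
    obtain ⟨_, ⟨r, hr, rfl⟩, hlt⟩ := exists_lt_of_lt_csSup hSne (sub_lt_self (sSup S) hδ)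
    rw [lt_div_iff₀ (pow_pos (hpos r hr) 2)] at hlt
    exact ⟨r, hr, hlt.le, hle r hr⟩
  · intro l hl hlγ hlC
    have hl' : (0 : ℝ) < l := by exact_mod_cast hl
    have ha : ((⌊α * l⌋₊ : ℕ) : ℝ) ≤ α * l := Nat.floor_le (by positivity)
    rw [div_le_iff₀ hl']
    have h1 : l * Real.log ((l + ⌊α * l⌋₊).choose l) ≤ sSup S * l ^ 2 := by
      refine le_of_forall_nat_quadratic (c := sSup S * (2 * l * (4 * w + 2)))
        (d := sSup S * (4 * w + 2) ^ 2) fun k => ?_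
      have h2 := le_ent_blockArr hl ha (ha.trans hlγ) k
      have h3 := hle2 (k * l : ℕ) (by positivity) _ (antitone_blockArr hl ha (ha.trans hlγ))
        ((flatArr_blockArr hα hl).mono hlC) 0
      push_cast at h2 h3
      linarith
    nlinarith

/-! ### Lattice points in the projection of a disc -/

/-- The point of the plane `α x + y + γ z = 0` above `(s, t)`. -/
noncomputable def planePt (α γ s t : ℝ) : E3 := !₂[s, -(α * s + γ * t), t]

lemma norm_sq_planePt (α γ s t : ℝ) :
    ‖planePt α γ s t‖ ^ 2 = s ^ 2 + (α * s + γ * t) ^ 2 + t ^ 2 := by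
  rw [EuclideanSpace.norm_sq_eq, Fin.sum_univ_three]
  simp only [planePt, Real.norm_eq_abs, sq_abs]
  simp
  ring

lemma planePt_add (α γ s t s' t' : ℝ) :
    planePt α γ (s + s') (t + t') = planePt α γ s t + planePt α γ s' t' := by
  ext i
  fin_cases i <;> simp [planePt]
  ring

lemma planePt_smul (α γ c s t : ℝ) : planePt α γ (c * s) (c * t) = c • planePt α γ s t := by
  ext i
  fin_cases i <;> simp [planePt]
  ring

lemma abs_fst_le_norm_planePt (α γ s t : ℝ) : |s| ≤ ‖planePt α γ s t‖ :=
  abs_apply_le_norm (planePt α γ s t) 0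

lemma abs_snd_le_norm_planePt (α γ s t : ℝ) : |t| ≤ ‖planePt α γ s t‖ :=
  abs_apply_le_norm (planePt α γ s t) 2

lemma norm_planePt_le {α γ s t M : ℝ} (hα : 0 ≤ α) (hγ : 0 ≤ γ) (hs : |s| ≤ M) (ht : |t| ≤ M) :
    ‖planePt α γ s t‖ ≤ (2 + α + γ) * M := by
  have hM : 0 ≤ M := (abs_nonneg s).trans hs
  refine le_of_sq_le_sq ?_ (by positivity)
  rw [norm_sq_planePt]
  have h1 : |α * s + γ * t| ≤ (α + γ) * M := by
    refine (abs_add_le _ _).trans ?_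
    rw [abs_mul, abs_mul, abs_of_nonneg hα, abs_of_nonneg hγ]
    nlinarith
  have h2 : s ^ 2 ≤ M ^ 2 := sq_le_sq' (by linarith [(abs_le.1 hs).1]) (abs_le.1 hs).2
  have h3 : t ^ 2 ≤ M ^ 2 := sq_le_sq' (by linarith [(abs_le.1 ht).1]) (abs_le.1 ht).2
  have h4 : (α * s + γ * t) ^ 2 ≤ ((α + γ) * M) ^ 2 :=
    sq_le_sq' (by linarith [(abs_le.1 h1).1]) (abs_le.1 h1).2
  have h5 : 0 ≤ (α + γ) * M ^ 2 := by positivity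
  nlinarith

/-- The set of lattice points below the disc of radius `ρ` in the plane `α x + y + γ z = 0`. -/
def latticeEllipse (α γ ρ : ℝ) : Set (ℤ × ℤ) := {v | ‖planePt α γ v.1 v.2‖ < ρ}

lemma latticeEllipse_subset_box {α γ ρ : ℝ} {N : ℤ} (hN : ρ ≤ N) :
    latticeEllipse α γ ρ ⊆ box (-N, -N) (2 * N) := by
  intro v hv
  have h1 : |(v.1 : ℝ)| < N := ((abs_fst_le_norm_planePt α γ v.1 v.2).trans_lt hv).trans_le hN
  have h2 : |(v.2 : ℝ)| < N := ((abs_snd_le_norm_planePt α γ v.1 v.2).trans_lt hv).trans_le hN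
  have h3 : |v.1| < N := by exact_mod_cast h1
  have h4 : |v.2| < N := by exact_mod_cast h2
  rw [abs_lt] at h3 h4
  simp only [box, mem_ofPred_eq]
  omega

lemma finite_latticeEllipse (α γ ρ : ℝ) : (latticeEllipse α γ ρ).Finite :=
  (finite_box _ _).subset (latticeEllipse_subset_box (Int.le_ceil ρ))

lemma volume_unit_disc : volume {v : Fin 2 → ℝ | v 0 ^ 2 + v 1 ^ 2 < 1} = ENNReal.ofReal π := by
  have h1 := (EuclideanSpace.volume_preserving_symm_measurableEquiv_toLp (Fin 2)).measure_preimage_equiv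
    {v : Fin 2 → ℝ | v 0 ^ 2 + v 1 ^ 2 < 1}
  rw [← h1]
  have h2 : (⇑(MeasurableEquiv.toLp 2 (Fin 2 → ℝ)).symm ⁻¹' {v : Fin 2 → ℝ | v 0 ^ 2 + v 1 ^ 2 < 1})
      = Metric.ball (0 : EuclideanSpace ℝ (Fin 2)) 1 := by
    ext x
    rw [mem_ball_zero_iff, ← sq_lt_one_iff₀ (norm_nonneg x), EuclideanSpace.norm_sq_eq]
    simp
  rw [h2, EuclideanSpace.volume_ball_fin_two]
  simp [ENNReal.ofReal]

/-- The unit disc in the plane `α x + y + γ z = 0`, projected to `ℝ²`. -/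
def ellipse (α γ : ℝ) : Set (Fin 2 → ℝ) := {v | ‖planePt α γ (v 0) (v 1)‖ < 1}

lemma volume_ellipse (α γ : ℝ) :
    volume.real (ellipse α γ) = π / √(1 + α ^ 2 + γ ^ 2) := by
  set A := √(1 + α ^ 2) with hA
  set D := √(1 + α ^ 2 + γ ^ 2) with hD
  have hA0 : 0 < A := Real.sqrt_pos.2 (by positivity)
  have hD0 : 0 < D := Real.sqrt_pos.2 (by positivity)
  have hA2 : A ^ 2 = 1 + α ^ 2 := Real.sq_sqrt (by positivity)
  have hD2 : D ^ 2 = 1 + α ^ 2 + γ ^ 2 := Real.sq_sqrt (by positivity)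
  -- The Cholesky factor of the quadratic form (1 + α²) s² + 2 α γ s t + (1 + γ²) t²; it maps the
  -- ellipse to the unit disc.
  set M : Matrix (Fin 2) (Fin 2) ℝ := !![A, α * γ / A; 0, D / A] with hM
  have hdet : LinearMap.det (Matrix.toLin' M) = D := by
    rw [LinearMap.det_toLin', hM, Matrix.det_fin_two_of]
    field_simp
    ring
  have hpre : ellipse α γ = (Matrix.toLin' M) ⁻¹' {v : Fin 2 → ℝ | v 0 ^ 2 + v 1 ^ 2 < 1} := by
    ext v
    simp only [ellipse, mem_ofPred_eq, mem_preimage]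
    rw [← sq_lt_one_iff₀ (norm_nonneg _), norm_sq_planePt]
    have h1 : Matrix.toLin' M v 0 = A * v 0 + α * γ / A * v 1 := by
      simp [hM, Matrix.toLin'_apply, Matrix.mulVec, dotProduct]
    have h2 : Matrix.toLin' M v 1 = D / A * v 1 := by
      simp [hM, Matrix.toLin'_apply, Matrix.mulVec, dotProduct]
    rw [h1, h2]
    have h3 : (A * v 0 + α * γ / A * v 1) ^ 2 + (D / A * v 1) ^ 2 =
        A ^ 2 * v 0 ^ 2 + 2 * (α * γ) * v 0 * v 1 + ((α * γ) ^ 2 + D ^ 2) / A ^ 2 * v 1 ^ 2 := by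
      field_simp
      ring
    have h4 : ((α * γ) ^ 2 + D ^ 2) / A ^ 2 = 1 + γ ^ 2 := by
      rw [div_eq_iff (by positivity), hD2, hA2]
      ring
    rw [h3, h4, hA2]
    ring_nf
  rw [measureReal_def, hpre, Measure.addHaar_preimage_linearMap _ (by rw [hdet]; exact hD0.ne'), hdet,
    volume_unit_disc, ← ENNReal.ofReal_mul (abs_nonneg _), ENNReal.toReal_ofReal (by positivity),
    abs_of_pos (by positivity)]
  field_simp

lemma ellipse_bounded (α γ : ℝ) : Bornology.IsBounded (ellipse α γ) := by
  refine (Metric.isBounded_closedBall (x := (0 : Fin 2 → ℝ)) (r := 1)).subset fun v hv => ?_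
  rw [mem_closedBall_zero_iff, pi_norm_le_iff_of_nonneg zero_le_one]
  intro i
  fin_cases i
  · exact (abs_fst_le_norm_planePt α γ (v 0) (v 1)).trans (le_of_lt hv)
  · exact (abs_snd_le_norm_planePt α γ (v 0) (v 1)).trans (le_of_lt hv)

lemma convex_ellipse (α γ : ℝ) : Convex ℝ (ellipse α γ) := by
  intro v hv v' hv' a b ha hb hab
  have h1 : planePt α γ ((a • v + b • v') 0) ((a • v + b • v') 1) =
      a • planePt α γ (v 0) (v 1) + b • planePt α γ (v' 0) (v' 1) := by
    simp only [Pi.add_apply, Pi.smul_apply, smul_eq_mul]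
    rw [planePt_add, planePt_smul, planePt_smul]
  have h2 := convex_ball (0 : E3) 1 (mem_ball_zero_iff.2 hv) (mem_ball_zero_iff.2 hv') ha hb hab
  rw [← h1] at h2
  exact mem_ball_zero_iff.1 h2

lemma isOpen_ellipse (α γ : ℝ) : IsOpen (ellipse α γ) := by
  have h : Continuous fun v : Fin 2 → ℝ => planePt α γ (v 0) (v 1) := by
    unfold planePt
    refine (PiLp.continuous_toLp 2 _).comp (continuous_pi fun i => ?_)
    fin_cases i <;> simp <;> fun_prop
  exact isOpen_lt h.norm continuous_const

theorem tendsto_ncard_latticeEllipse (α γ : ℝ) :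
    Tendsto (fun ρ : ℝ => ((latticeEllipse α γ ρ).ncard : ℝ) / ρ ^ 2) atTop
      (𝓝 (π / √(1 + α ^ 2 + γ ^ 2))) := by
  have h := tendsto_card_div_pow_atTop_volume' (ellipse α γ) (ellipse_bounded α γ)
    (isOpen_ellipse α γ).measurableSet ((convex_ellipse α γ).addHaar_frontier volume)
    (fun x y hx hxy => by
      rintro _ ⟨v, hv, rfl⟩
      have hy : 0 < y := hx.trans_le hxy
      refine ⟨(x / y) • v, ?_, ?_⟩
      · simp only [ellipse, mem_ofPred_eq, Pi.smul_apply, smul_eq_mul] at hv ⊢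
        rw [planePt_smul, norm_smul, Real.norm_of_nonneg (by positivity)]
        have : x / y ≤ 1 := (div_le_one hy).2 hxy
        have := norm_nonneg (planePt α γ (v 0) (v 1))
        nlinarith
      · simp only [smul_smul]
        rw [mul_div_cancel₀ _ hy.ne'])
  rw [volume_ellipse, Fintype.card_fin] at h
  refine h.congr' ?_
  filter_upwards [eventually_gt_atTop 0] with ρ hρ
  have hset : (ellipse α γ ∩ ρ⁻¹ • (Submodule.span ℤ (Set.range (Pi.basisFun ℝ (Fin 2))) :
      Set (Fin 2 → ℝ))) = (fun v : ℤ × ℤ => ρ⁻¹ • (![(v.1 : ℝ), (v.2 : ℝ)] : Fin 2 → ℝ)) ''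
        latticeEllipse α γ ρ := by
    have hmem : ∀ v : ℤ × ℤ, v ∈ latticeEllipse α γ ρ ↔
        ρ⁻¹ • (![(v.1 : ℝ), (v.2 : ℝ)] : Fin 2 → ℝ) ∈ ellipse α γ := by
      intro v
      simp only [latticeEllipse, ellipse, mem_ofPred_eq, Pi.smul_apply, smul_eq_mul,
        Matrix.cons_val_zero, Matrix.cons_val_one]
      rw [planePt_smul, norm_smul, Real.norm_of_nonneg (by positivity), inv_mul_lt_iff₀ hρ, mul_one]
    ext x
    constructor
    · rintro ⟨hx, y, hy, rfl⟩
      have hy' : ∀ i, ∃ m : ℤ, (m : ℝ) = y i := by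
        have := (Pi.basisFun ℝ (Fin 2)).mem_span_iff_repr_mem ℤ y |>.1 hy
        simpa using this
      obtain ⟨m0, h0⟩ := hy' 0
      obtain ⟨m1, h1⟩ := hy' 1
      have hym : y = ![(m0 : ℝ), (m1 : ℝ)] := by
        ext i
        fin_cases i
        · exact h0.symm
        · exact h1.symm
      refine ⟨(m0, m1), (hmem _).2 ?_, by rw [hym]⟩
      rw [← hym]
      exact hx
    · rintro ⟨v, hv, rfl⟩
      refine ⟨(hmem v).1 hv, smul_mem_smul_set ?_⟩
      refine (Pi.basisFun ℝ (Fin 2)).mem_span_iff_repr_mem ℤ _ |>.2 fun i => ?_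
      fin_cases i
      · exact ⟨v.1, by simp⟩
      · exact ⟨v.2, by simp⟩
  have hinj : Function.Injective
      (fun v : ℤ × ℤ => ρ⁻¹ • (![(v.1 : ℝ), (v.2 : ℝ)] : Fin 2 → ℝ)) := by
    intro v v' h
    have h0 := congrFun h 0
    have h1 := congrFun h 1
    simp only [Pi.smul_apply, smul_eq_mul, Matrix.cons_val_zero, Matrix.cons_val_one,
      mul_right_inj' (inv_ne_zero hρ.ne'), Int.cast_inj] at h0 h1
    exact Prod.ext h0 h1
  rw [hset, Nat.card_coe_set_eq, ncard_image_of_injective _ hinj]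

/-! ### From sets of cubes to arrays -/

/-- The set of cubes below the graph of an array; the columns point in the second direction. -/
def below (G : ℤ × ℤ → ℤ) : Set (Fin 3 → ℤ) := {c | c 1 < G (c 0, c 2)}

lemma below_injective : Function.Injective below := by
  intro G G' h
  ext ⟨x, z⟩
  have h1 := Set.ext_iff.1 h ![x, G (x, z), z]
  have h2 := Set.ext_iff.1 h ![x, G' (x, z), z]
  simp only [below, mem_ofPred_eq, Matrix.cons_val] at h1 h2
  omega

lemma isLowerSet_below {G : ℤ × ℤ → ℤ} (h : Antitone G) : IsLowerSet (below G) :=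
  fun _ _ hcc hc => (hcc 1).trans_lt (lt_of_lt_of_le hc (h ⟨hcc 0, hcc 2⟩))

lemma eq_vec3 (c : Fin 3 → ℤ) : ![c 0, c 1, c 2] = c := by
  ext i; fin_cases i <;> rfl

lemma exists_eq_below {U : Set (Fin 3 → ℤ)} (hU : IsLowerSet U)
    (h1 : ∀ x z, ∃ y, ![x, y, z] ∈ U) (h2 : ∀ x z, ∃ y, ![x, y, z] ∉ U) :
    ∃ G, Antitone G ∧ U = below G := by
  have hle : ∀ {x y z x' y' z' : ℤ}, x' ≤ x → y' ≤ y → z' ≤ z →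
      (![x', y', z'] : Fin 3 → ℤ) ≤ ![x, y, z] := by
    intro x y z x' y' z' hx hy hz i
    fin_cases i
    exacts [hx, hy, hz]
  have key : ∀ x z, ∃ m : ℤ, ∀ y, ![x, y, z] ∈ U ↔ y < m := by
    intro x z
    obtain ⟨b, hb⟩ := h2 x z
    obtain ⟨m, hm, hmax⟩ := Int.exists_greatest_of_bdd (P := fun y => ![x, y, z] ∈ U)
      ⟨b, fun y hy => by
        by_contra! hlt
        exact hb (hU (hle le_rfl hlt.le le_rfl) hy)⟩ (h1 x z)
    refine ⟨m + 1, fun y => ⟨fun hy => ?_, fun hy => hU (hle le_rfl (by omega) le_rfl) hm⟩⟩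
    have := hmax y hy
    omega
  choose G hG using key
  refine ⟨fun v => G v.1 v.2, fun v v' hv => ?_, ?_⟩
  · by_contra! hlt
    have h3 := hU (hle hv.1 le_rfl hv.2) ((hG v'.1 v'.2 (G v.1 v.2)).2 hlt)
    exact lt_irrefl _ ((hG v.1 v.2 _).1 h3)
  · ext c
    rw [← eq_vec3 c, hG]
    rfl

lemma dot_eq {n : E3} (h1 : n 1 ≠ 0) (c : Fin 3 → ℤ) :
    dot n c = n 1 * (c 1 + (n 0 / n 1 * c 0 + n 2 / n 1 * c 2)) := by
  rw [dot, Fin.sum_univ_three]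
  field_simp
  ring

lemma exists_eq_below_of_agree {n : E3} (hpos : ∀ i, 0 < n i) {C R : ℝ}
    {U₀ U : Set (Fin 3 → ℤ)} (h₀ : IsFlat n C U₀) (hU : IsLowerSet U)
    (h : ∀ c, R ≤ ‖toE c‖ → (c ∈ U ↔ c ∈ U₀)) : ∃ G, Antitone G ∧ U = below G := by
  have hfar : ∀ x y z : ℤ, R ≤ |(y : ℝ)| → R ≤ ‖toE ![x, y, z]‖ := fun x y z hy =>
    hy.trans (abs_apply_le_norm (toE ![x, y, z]) 1)
  have h1 := hpos 1
  refine exists_eq_below hU (fun x z => ?_) fun x z => ?_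
  · obtain ⟨k, hk⟩ := exists_nat_gt (max R ((C + n 0 * x + n 2 * z) / n 1))
    have hR := (le_max_left _ _).trans_lt hk
    have hC := (le_max_right _ _).trans_lt hk
    rw [div_lt_iff₀ h1] at hC
    refine ⟨-k, (h _ (hfar _ _ _ ?_)).2 (h₀.mem ?_)⟩
    · push_cast
      rw [abs_neg, Nat.abs_cast]
      exact hR.le
    · rw [dot, Fin.sum_univ_three]
      simp only [Matrix.cons_val]
      push_cast
      linarith
  · obtain ⟨k, hk⟩ := exists_nat_gt (max R ((C - n 0 * x - n 2 * z) / n 1))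
    have hR := (le_max_left _ _).trans_lt hk
    have hC := (le_max_right _ _).trans_lt hk
    rw [div_lt_iff₀ h1] at hC
    refine ⟨k, fun hmem => h₀.notMem ?_ ((h _ (hfar _ _ _ ?_)).1 hmem)⟩
    · rw [dot, Fin.sum_univ_three]
      simp only [Matrix.cons_val]
      push_cast
      linarith
    · push_cast
      rw [Nat.abs_cast]
      exact hR.le

lemma flatArr_of_isFlat {n : E3} (hpos : ∀ i, 0 < n i) {C : ℝ} {G : ℤ × ℤ → ℤ}
    (h : IsFlat n C (below G)) : FlatArr (n 0 / n 1) (n 2 / n 1) (C / n 1 + 1) G := by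
  intro v
  have h1 := hpos 1
  have h2 := h.1 ![v.1, G v - 1, v.2] (by simp [below])
  have h3 := h.2 ![v.1, G v, v.2] (by simp [below])
  rw [dot_eq h1.ne'] at h2 h3
  simp only [Matrix.cons_val] at h2 h3
  push_cast at h2
  rw [← le_div_iff₀' h1] at h2
  have h4 : -(C / n 1) ≤ G v + (n 0 / n 1 * v.1 + n 2 / n 1 * v.2) := by
    rw [← neg_div, div_le_iff₀' h1]
    exact h3
  rw [abs_le]
  constructor <;> linarith

lemma norm_toE_sub_planePt (α γ : ℝ) (c : Fin 3 → ℤ) :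
    ‖toE c - planePt α γ (c 0) (c 2)‖ = |(c 1 : ℝ) + (α * c 0 + γ * c 2)| := by
  have h : toE c - planePt α γ (c 0) (c 2) =
      EuclideanSpace.single 1 ((c 1 : ℝ) + (α * c 0 + γ * c 2)) := by
    ext i
    fin_cases i <;> simp [toE, planePt]
    ring
  rw [h, PiLp.norm_single, Real.norm_eq_abs]

/-- Over v outside the ellipse, the two cubes on either side of the height `G₀ v` are at distance at
least R from the origin, so they force `G v = G₀ v`. -/
lemma log_ncard_cellSets_le {n : E3} (hpos : ∀ i, 0 < n i) {C C' R : ℝ} {G₀ : ℤ × ℤ → ℤ}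
    {α γ : ℝ} (hflat : IsFlat n C (below G₀)) (hG : FlatArr α γ C' G₀) :
    Real.log (cellSets (below G₀) R).ncard ≤ ent G₀ (latticeEllipse α γ (R + C' + 1)) := by
  have hfin := finite_arrSet G₀ (finite_latticeEllipse α γ (R + C' + 1))
  refine log_natCast_le ((ncard_le_ncard ?_ (hfin.image below)).trans (ncard_image_le hfin))
  rintro U ⟨hU, hUc⟩
  obtain ⟨G, hGa, rfl⟩ := exists_eq_below_of_agree hpos hflat hU hUc
  refine ⟨G, ⟨hGa, fun v hv => ?_⟩, rfl⟩
  have h1 := abs_le.1 (hG v)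
  have hfar : ∀ y : ℤ, |(y : ℝ) + (α * v.1 + γ * v.2)| ≤ C' + 1 → R ≤ ‖toE ![v.1, y, v.2]‖ := by
    intro y hy
    have h2 := norm_toE_sub_planePt α γ ![v.1, y, v.2]
    simp only [Matrix.cons_val] at h2
    have h3 := norm_sub_norm_le (planePt α γ v.1 v.2) (toE ![v.1, y, v.2])
    rw [norm_sub_rev, h2] at h3
    have h4 : R + C' + 1 ≤ ‖planePt α γ v.1 v.2‖ := not_lt.1 hv
    linarith
  have h2 := hUc ![v.1, G₀ v, v.2] (hfar _ (by rw [abs_le]; constructor <;> linarith))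
  have h3 := hUc ![v.1, G₀ v - 1, v.2]
    (hfar _ (by push_cast; rw [abs_le]; constructor <;> linarith))
  simp only [below, mem_ofPred_eq, Matrix.cons_val, Prod.mk.eta] at h2 h3
  omega

lemma notMem_gridBox_of_dvd {p : ℤ} (hp : 2 ≤ p) (a z : ℤ) (v : ℤ × ℤ) :
    (p * a, z) ∉ gridBox p v := by
  rintro ⟨h1, h2, -, -⟩
  simp only at h1 h2
  rcases lt_or_ge v.1 a with h | h
  · have : p * v.1 + p ≤ p * a := by nlinarith
    omega
  · have : p * a ≤ p * v.1 := by nlinarith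
    omega

lemma abs_sub_le_of_mem_gridBox {p : ℤ} {v a : ℤ × ℤ} (ha : a ∈ gridBox p v) :
    |(a.1 : ℝ) - (p * v.1 : ℤ)| ≤ p ∧ |(a.2 : ℝ) - (p * v.2 : ℤ)| ≤ p := by
  obtain ⟨h1, h2, h3, h4⟩ := ha
  simp only at h1 h2 h3 h4
  constructor
  · have : |a.1 - p * v.1| ≤ p := by rw [abs_le]; omega
    exact_mod_cast this
  · have : |a.2 - p * v.2| ≤ p := by rw [abs_le]; omega
    exact_mod_cast this

lemma norm_planePt_le_add {α γ M s t s' t' : ℝ} (hα : 0 ≤ α) (hγ : 0 ≤ γ) (hs : |s - s'| ≤ M)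
    (ht : |t - t'| ≤ M) : ‖planePt α γ s t‖ ≤ ‖planePt α γ s' t'‖ + (2 + α + γ) * M := by
  have h := planePt_add α γ s' t' (s - s') (t - t')
  rw [add_sub_cancel, add_sub_cancel] at h
  rw [h]
  exact (norm_add_le _ _).trans (add_le_add le_rfl (norm_planePt_le hα hγ hs ht))

/-- The lines on which the first coordinate is a multiple of p avoid all grid boxes, so there a
modified array equals `G₀`. By monotonicity its values in the boxes stay near the plane, and only
cubes inside the ball are affected. -/
lemma ent_iUnion_gridBox_le {α γ C' R : ℝ} (hα : 0 ≤ α) (hγ : 0 ≤ γ) {p : ℤ} (hp : 2 ≤ p)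
    {G₀ : ℤ × ℤ → ℤ} (hG : FlatArr α γ C' G₀) (I : Finset (ℤ × ℤ))
    (hI : ∀ v ∈ I, ‖planePt α γ (p * v.1 : ℤ) (p * v.2 : ℤ)‖ <
      R - ((2 + 3 * α + γ) * p + 2 * C' + 1)) :
    ent G₀ (⋃ v ∈ I, gridBox p v) ≤ Real.log (cellSets (below G₀) R).ncard := by
  refine log_natCast_le (ncard_le_ncard_of_injOn below (fun G hGm => ?_) below_injective.injOn
    (finite_cellSets _ _))
  obtain ⟨hGa, hGe⟩ := hGm
  refine ⟨isLowerSet_below hGa, fun c hc => ?_⟩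
  by_cases hcI : (c 0, c 2) ∈ ⋃ v ∈ I, gridBox p v
  swap
  · simp only [below, mem_ofPred_eq]
    rw [hGe _ hcI]
  simp only [mem_iUnion, exists_prop] at hcI
  obtain ⟨v, hvI, hcv⟩ := hcI
  have hnot : ∀ a, (p * a, c 2) ∉ ⋃ v ∈ I, gridBox p v := by
    intro a h
    simp only [mem_iUnion, exists_prop] at h
    obtain ⟨v', -, h'⟩ := h
    exact notMem_gridBox_of_dvd hp a (c 2) v' h'
  obtain ⟨h1, h2⟩ := abs_sub_le_of_mem_gridBox hcv
  have h3 : G (c 0, c 2) ≤ G₀ (p * v.1, c 2) := by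
    rw [← hGe _ (hnot v.1)]
    refine hGa ⟨?_, le_rfl⟩
    have := hcv.1
    simp only at this ⊢
    omega
  have h4 : G₀ (p * (v.1 + 1), c 2) ≤ G (c 0, c 2) := by
    rw [← hGe _ (hnot (v.1 + 1))]
    refine hGa ⟨?_, le_rfl⟩
    have := hcv.2.1
    simp only at this ⊢
    have : p * (v.1 + 1) = p * v.1 + p := by ring
    omega
  have h3' : (G (c 0, c 2) : ℝ) ≤ G₀ (p * v.1, c 2) := by exact_mod_cast h3
  have h4' : (G₀ (p * (v.1 + 1), c 2) : ℝ) ≤ G (c 0, c 2) := by exact_mod_cast h4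
  have f1 := abs_le.1 (hG (p * v.1, c 2))
  have f2 := abs_le.1 (hG (p * (v.1 + 1), c 2))
  have f3 := abs_le.1 (hG (c 0, c 2))
  simp only at h1 h2 f1 f2 f3
  have hpr : (0 : ℝ) ≤ p := by exact_mod_cast (by omega : 0 ≤ p)
  push_cast at h1 h2 f1 f2
  have g1 := mul_le_mul_of_nonneg_left (abs_le.1 h1).1 hα
  have g2 := mul_le_mul_of_nonneg_left (abs_le.1 h1).2 hα
  have hαp : 0 ≤ α * p := mul_nonneg hα hpr
  have hfarc : 2 * α * p + 2 * C' + 1 ≤ |(c 1 : ℝ) + (α * c 0 + γ * c 2)| := by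
    by_contra! hlt
    have h5 := norm_toE_sub_planePt α γ c
    have h6 := norm_sub_norm_le (toE c) (planePt α γ (c 0) (c 2))
    have h7 := norm_planePt_le_add (s := c 0) (t := c 2) (s' := (p * v.1 : ℤ))
      (t' := (p * v.2 : ℤ)) (M := p) hα hγ (by push_cast; exact h1) (by push_cast; exact h2)
    have h8 := hI v hvI
    rw [h5] at h6
    nlinarith
  simp only [below, mem_ofPred_eq]
  rcases le_abs.1 hfarc with h | h
  · have e1 : (G (c 0, c 2) : ℝ) ≤ c 1 := by nlinarith
    have e2 : (G₀ (c 0, c 2) : ℝ) ≤ c 1 := by nlinarith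
    have e1' : G (c 0, c 2) ≤ c 1 := by exact_mod_cast e1
    have e2' : G₀ (c 0, c 2) ≤ c 1 := by exact_mod_cast e2
    omega
  · have e1 : (c 1 : ℝ) < G (c 0, c 2) := by nlinarith
    have e2 : (c 1 : ℝ) < G₀ (c 0, c 2) := by nlinarith
    have e1' : c 1 < G (c 0, c 2) := by exact_mod_cast e1
    have e2' : c 1 < G₀ (c 0, c 2) := by exact_mod_cast e2
    omega

/-! ### The entropy limit -/

lemma tendsto_rescale {N : ℝ → ℝ} {a : ℝ} (hN : Tendsto (fun ρ => N ρ / ρ ^ 2) atTop (𝓝 a))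
    {p : ℝ} (hp : 0 < p) (K : ℝ) :
    Tendsto (fun R => p ^ 2 * N ((R + K) / p) / R ^ 2) atTop (𝓝 a) := by
  have h1 : Tendsto (fun R : ℝ => (R + K) / p) atTop atTop :=
    (tendsto_atTop_add_const_right _ K tendsto_id).atTop_div_const hp
  have h2 : Tendsto (fun R : ℝ => (1 + K / R) ^ 2) atTop (𝓝 ((1 + 0) ^ 2)) :=
    ((tendsto_const_nhds).add (tendsto_const_nhds.div_atTop tendsto_id)).pow 2
  have h3 := (hN.comp h1).mul h2
  rw [add_zero, one_pow, mul_one] at h3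
  refine h3.congr' ?_
  filter_upwards [eventually_gt_atTop 0, eventually_gt_atTop (-K)] with R hR hR'
  have : R + K ≠ 0 := by linarith
  simp only [Function.comp]
  field_simp

lemma tendsto_of_entropy_bounds {F N : ℝ → ℝ} {a β : ℝ}
    (hN : Tendsto (fun ρ => N ρ / ρ ^ 2) atTop (𝓝 a))
    (h : ∀ δ > 0, ∃ p K D : ℝ, 0 < p ∧ ∀ᶠ R in atTop,
      (β - δ) * (p ^ 2 * N ((R - K) / p)) ≤ F R ∧
        F R ≤ D * (R + D) + 4 * δ * (R + D) ^ 2 + β * (p ^ 2 * N ((R + K) / p))) :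
    Tendsto (fun R => F R / R ^ 2) atTop (𝓝 (β * a)) := by
  refine tendsto_order.2 ⟨fun b hb => ?_, fun b hb => ?_⟩
  · have hδ : 0 < (β * a - b) / (2 * (|a| + 1)) := div_pos (by linarith) (by positivity)
    obtain ⟨p, K, D, hp, hev⟩ := h _ hδ
    set δ := (β * a - b) / (2 * (|a| + 1)) with hδd
    have h1 := (tendsto_rescale hN hp (-K)).const_mul (β - δ)
    have h2 : b < (β - δ) * a := by
      have h3 : δ * (2 * (|a| + 1)) = β * a - b := div_mul_cancel₀ _ (by positivity)
      have h4 := le_abs_self a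
      have h5 := abs_nonneg a
      nlinarith
    filter_upwards [hev, h1.eventually (lt_mem_nhds h2), eventually_gt_atTop 0] with R hR hR' hR0
    refine hR'.trans_le ?_
    rw [← mul_div_assoc, ← sub_eq_add_neg]
    exact div_le_div_of_nonneg_right hR.1 (by positivity)
  · have hδ : 0 < (b - β * a) / 8 := by linarith
    obtain ⟨p, K, D, hp, hev⟩ := h _ hδ
    set δ := (b - β * a) / 8 with hδd
    have h0 : Tendsto (fun R : ℝ => 1 + D / R) atTop (𝓝 (1 + 0)) :=
      tendsto_const_nhds.add (tendsto_const_nhds.div_atTop tendsto_id)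
    have h1 : Tendsto (fun R : ℝ => D / R * (1 + D / R) + 4 * δ * (1 + D / R) ^ 2 +
        β * (p ^ 2 * N ((R + K) / p) / R ^ 2)) atTop (𝓝 (0 * (1 + 0) + 4 * δ * (1 + 0) ^ 2 + β * a)) :=
      (((tendsto_const_nhds.div_atTop tendsto_id).mul h0).add ((h0.pow 2).const_mul _)).add
        ((tendsto_rescale hN hp K).const_mul β)
    have h2 : 0 * (1 + 0) + 4 * δ * (1 + 0) ^ 2 + β * a < b := by
      rw [hδd]; linarith
    filter_upwards [hev, h1.eventually (gt_mem_nhds h2), eventually_gt_atTop 0] with R hR hR' hR0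
    refine lt_of_le_of_lt ?_ hR'
    rw [div_le_iff₀ (by positivity)]
    refine hR.2.trans (le_of_eq ?_)
    field_simp

/-- Projecting the plane along the second axis multiplies areas by n 1. -/
lemma slope_sum_sq {n : E3} (hn : n ∈ sphTriangle) (hpos : ∀ i, 0 < n i) :
    π / √(1 + (n 0 / n 1) ^ 2 + (n 2 / n 1) ^ 2) = π * n 1 := by
  have h1 := hpos 1
  have h2 := EuclideanSpace.norm_sq_eq n
  rw [hn.1, Fin.sum_univ_three] at h2
  simp only [Real.norm_eq_abs, sq_abs] at h2
  have h3 : 1 + (n 0 / n 1) ^ 2 + (n 2 / n 1) ^ 2 = (1 / n 1) ^ 2 := by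
    field_simp
    linarith
  rw [h3, Real.sqrt_sq (by positivity)]
  field_simp

-- Superadditivity yields an upper bound through the complement: the ellipse together with boxes
-- filling the rest of a large square has at most the entropy of the square, which is at most β
-- times its area up to lower order, while the boxes already use up nearly β times theirs.
open Classical in
lemma ent_latticeEllipse_le {α γ C' β δ : ℝ} (hα : 0 < α) (hγ : 0 < γ) {w r : ℤ}
    (hw : 0 ≤ w) (hr : 0 ≤ r)
    (hcmp : ∀ G₀ : ℤ × ℤ → ℤ, Antitone G₀ → FlatArr α γ C' G₀ → ∀ u : ℤ × ℤ,
      boxEnt α γ r ≤ ent G₀ (box u (r + 2 * w)))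
    {G₀ : ℤ × ℤ → ℤ} (h₀ : Antitone G₀) (hf₀ : FlatArr α γ C' G₀) (hβ : 0 ≤ β)
    (hup : ∀ L, 0 ≤ L → ∀ u : ℤ × ℤ, ent G₀ (box u L) ≤ β * (L + 4 * w + 2) ^ 2)
    (h1 : (β - δ) * (r + 2 * w + 2) ^ 2 ≤ boxEnt α γ r)
    (h2 : boxEnt α γ r ≤ β * (r + 2 * w + 2) ^ 2) {ρ : ℝ} (hρ : 0 ≤ ρ) (hδ : 0 < δ) :
    ent G₀ (latticeEllipse α γ ρ) ≤
      β * ((4 * w + 2) * (4 * (ρ + 2 * (r + 2 * w + 2)) + 4 * w + 2)) +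
      4 * δ * (ρ + 2 * (r + 2 * w + 2)) ^ 2 + β * ((r + 2 * w + 2) ^ 2 *
        (latticeEllipse α γ ((ρ + (2 + α + γ) * (r + 2 * w + 3)) / (r + 2 * w + 2))).ncard) := by
  set p : ℤ := r + 2 * w + 2 with hp
  have hp2 : 2 ≤ p := by omega
  have hpr : (p : ℝ) = r + 2 * w + 2 := by rw [hp]; push_cast; ring
  have hp0 : (0 : ℝ) < p := by exact_mod_cast (by omega : 0 < p)
  have hwr : (0 : ℝ) ≤ w := by exact_mod_cast hw
  set m : ℤ := ⌈ρ / p⌉ + 1 with hm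
  have hm1 : ρ ≤ ((p * m : ℤ) : ℝ) := by
    have h3 := Int.le_ceil (ρ / p)
    rw [div_le_iff₀ hp0] at h3
    rw [hm]
    push_cast
    nlinarith
  have hm2 : ((p * m : ℤ) : ℝ) ≤ ρ + 2 * p := by
    have h3 := (Int.ceil_lt_add_one (ρ / p)).le
    have h4 : (p : ℝ) * (ρ / p) = ρ := mul_div_cancel₀ _ hp0.ne'
    have h5 := mul_le_mul_of_nonneg_left h3 hp0.le
    rw [hm]
    push_cast
    nlinarith
  have hm0 : 0 ≤ m := by
    have : 0 ≤ ⌈ρ / p⌉ := Int.ceil_nonneg (by positivity)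
    omega
  set E' := latticeEllipse α γ ((ρ + (2 + α + γ) * (r + 2 * w + 3)) / (r + 2 * w + 2)) with hE'
  have hE'fin : E'.Finite := finite_latticeEllipse _ _ _
  -- The grid cells in the large square whose corner p v lies over no point of the disc of radius ρ
  -- + (2 + α + γ) (p + 1); these are separated from the ellipse.
  set J : Finset (ℤ × ℤ) := (Finset.Ico (-m) m ×ˢ Finset.Ico (-m) m).filter fun v => v ∉ E' with hJ
  have hJcard : (2 * m : ℝ) ^ 2 - E'.ncard ≤ J.card := by
    have h3 : Finset.Ico (-m) m ×ˢ Finset.Ico (-m) m ⊆ J ∪ hE'fin.toFinset := by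
      intro v hv
      by_cases h : v ∈ E'
      · exact Finset.mem_union_right _ (by simpa using h)
      · exact Finset.mem_union_left _ (Finset.mem_filter.2 ⟨hv, h⟩)
    have h4 := (Finset.card_le_card h3).trans (Finset.card_union_le _ _)
    rw [Finset.card_product, Int.card_Ico, ← ncard_eq_toFinset_card E' hE'fin] at h4
    have h5 : (((m - -m).toNat : ℕ) : ℝ) = 2 * m := by
      have : (((m - -m).toNat : ℕ) : ℤ) = 2 * m := by omega
      exact_mod_cast this
    have h6 : ((((m - -m).toNat * (m - -m).toNat : ℕ)) : ℝ) ≤ ((J.card + E'.ncard : ℕ) : ℝ) := by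
      exact_mod_cast h4
    push_cast at h6
    rw [h5] at h6
    linarith
  have hsep : ∀ v ∈ J, Sep (gridBox p v) (latticeEllipse α γ ρ) := by
    intro v hv a ha b hb
    by_contra! hcon
    have hvE : v ∉ E' := (Finset.mem_filter.1 hv).2
    apply hvE
    obtain ⟨h3, h4⟩ := abs_sub_le_of_mem_gridBox ha
    have h5 : |(a.1 : ℝ) - b.1| ≤ 1 := by exact_mod_cast hcon.1
    have h6 : |(a.2 : ℝ) - b.2| ≤ 1 := by exact_mod_cast hcon.2
    have h7 : |((p * v.1 : ℤ) : ℝ) - b.1| ≤ p + 1 := by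
      rw [abs_le] at *
      constructor <;> linarith
    have h8 : |((p * v.2 : ℤ) : ℝ) - b.2| ≤ p + 1 := by
      rw [abs_le] at *
      constructor <;> linarith
    have h9 := norm_planePt_le_add hα.le hγ.le h7 h8
    have h10 : ‖planePt α γ b.1 b.2‖ < ρ := hb
    push_cast at h9
    rw [planePt_smul, norm_smul, Real.norm_of_nonneg hp0.le] at h9
    show ‖planePt α γ v.1 v.2‖ < _
    rw [← hpr, lt_div_iff₀ hp0]
    have h11 : (r : ℝ) + 2 * w + 3 = p + 1 := by rw [hpr]; ring
    rw [h11]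
    linarith
  have hmain := ent_add_card_mul_le hw hr hcmp h₀ hf₀ J (finite_latticeEllipse α γ ρ) hsep
  have hsub : latticeEllipse α γ ρ ∪ ⋃ v ∈ J, gridBox p v ⊆ box (-(p * m), -(p * m)) (2 * (p * m)) := by
    refine union_subset (latticeEllipse_subset_box hm1) fun a ha => ?_
    simp only [mem_iUnion, exists_prop] at ha
    obtain ⟨v, hv, h3, h4, h5, h6⟩ := ha
    have hv' := (Finset.mem_filter.1 hv).1
    simp only [Finset.mem_product, Finset.mem_Ico] at hv' h3 h4 h5 h6
    have g1 : -(p * m) ≤ p * v.1 := by nlinarith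
    have g2 : p * v.1 + p ≤ p * m := by nlinarith
    have g3 : -(p * m) ≤ p * v.2 := by nlinarith
    have g4 : p * v.2 + p ≤ p * m := by nlinarith
    simp only [box, mem_ofPred_eq]
    omega
  have hbig := (hmain.trans (ent_mono (finite_box _ _) hsub)).trans
    (hup (2 * (p * m)) (by positivity) _)
  rw [← hpr] at h1 h2 ⊢
  push_cast at hbig hm1 hm2
  have hb0 := boxEnt_nonneg α γ r
  have k1 := mul_le_mul_of_nonneg_right hJcard hb0
  have k2 : (4 * (m : ℝ) ^ 2) * ((β - δ) * p ^ 2) ≤ 4 * (m : ℝ) ^ 2 * boxEnt α γ r :=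
    mul_le_mul_of_nonneg_left h1 (by positivity)
  have k3 : (E'.ncard : ℝ) * boxEnt α γ r ≤ E'.ncard * (β * p ^ 2) :=
    mul_le_mul_of_nonneg_left h2 (by positivity)
  have hpm0 : (0 : ℝ) ≤ p * m := by
    have : (0 : ℝ) ≤ m := by exact_mod_cast hm0
    positivity
  have k4 : δ * ((p : ℝ) * m) ^ 2 ≤ δ * (ρ + 2 * p) ^ 2 :=
    mul_le_mul_of_nonneg_left (pow_le_pow_left₀ hpm0 hm2 2) hδ.le
  have k5 : β * ((4 * w + 2) * (4 * (p * m) + 4 * w + 2)) ≤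
      β * ((4 * w + 2) * (4 * (ρ + 2 * p) + 4 * w + 2)) :=
    mul_le_mul_of_nonneg_left (mul_le_mul_of_nonneg_left (by linarith) (by positivity)) hβ
  linarith

theorem exists_entropy_limit {n : E3} (hn : n ∈ sphTriangle) (hpos : ∀ i, 0 < n i) (C : ℝ) :
    ∃ β : ℝ, (∀ U₀, IsLowerSet U₀ → IsFlat n C U₀ →
        Tendsto (fun R : ℝ => Real.log (cellSets U₀ R).ncard / (π * R ^ 2)) atTop
          (𝓝 (n 1 * β))) ∧
      β ≤ stairRate (n 0 / n 1) ∧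
      ∀ l : ℕ, 0 < l → n 0 / n 1 * l ≤ n 2 / n 1 → n 0 / n 1 * l ≤ C / n 1 →
        Real.log ((l + ⌊n 0 / n 1 * l⌋₊).choose l) / l ≤ β := by
  set α := n 0 / n 1 with hα
  set γ := n 2 / n 1 with hγ
  set C' := max 2 (C / n 1 + 1) with hC'
  have hα0 : 0 < α := div_pos (hpos 0) (hpos 1)
  have hγ0 : 0 < γ := div_pos (hpos 2) (hpos 1)
  have hC0 : 0 ≤ C' := le_trans (by norm_num) (le_max_left _ _)
  obtain ⟨w, β, hw, hβ, hcmp, hup, hδ, hle, hge⟩ := exists_entropy_rate hα0 hγ0 (le_max_left 2 (C / n 1 + 1))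
  refine ⟨β, fun U₀ hU₀ hflat => ?_, hle, fun l hl h1 h2 =>
    hge l hl h1 ((add_le_add_left h2 1).trans (le_max_right _ _))⟩
  obtain ⟨G₀, h₀, rfl⟩ := exists_eq_below_of_agree hpos hflat hU₀ (R := 0) fun _ _ => Iff.rfl
  have hf₀ : FlatArr α γ C' G₀ := (flatArr_of_isFlat hpos hflat).mono (le_max_right _ _)
  have hN := tendsto_ncard_latticeEllipse α γ
  rw [slope_sum_sq hn hpos] at hN
  suffices h : Tendsto (fun R : ℝ => Real.log (cellSets (below G₀) R).ncard / R ^ 2) atTop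
      (𝓝 (β * (π * n 1))) by
    have h' := h.div_const π
    have e1 : β * (π * n 1) / π = n 1 * β := by field_simp
    rw [e1] at h'
    refine h'.congr fun R => ?_
    rw [div_div, mul_comm]
  refine tendsto_of_entropy_bounds hN fun δ hδ0 => ?_
  obtain ⟨r, hr, hr1, hr2⟩ := hδ δ hδ0
  set p : ℤ := r + 2 * w + 2 with hp
  have hp2 : 2 ≤ p := by omega
  have hpr : (p : ℝ) = r + 2 * w + 2 := by rw [hp]; push_cast; ring
  have hp0 : (0 : ℝ) < p := by exact_mod_cast (by omega : 0 < p)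
  have hwr : (0 : ℝ) ≤ w := by exact_mod_cast hw
  -- Large enough for the loss of radius in the lower bound as well as for the gain in the upper
  -- bound.
  set K : ℝ := (2 + 3 * α + γ) * (p + 1) + 2 * C' + 1 with hK
  set D : ℝ := β * (4 * (4 * w + 2)) + (C' + 1 + 2 * p + w + 1) with hD
  refine ⟨p, K, D, hp0, ?_⟩
  filter_upwards [eventually_ge_atTop 0] with R hR
  constructor
  · have hfin := finite_latticeEllipse α γ ((R - K) / p)
    have h1 := ent_iUnion_gridBox_le (R := R) hα0.le hγ0.le hp2 hf₀ hfin.toFinset (fun v hv => by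
      rw [Set.Finite.mem_toFinset] at hv
      have hv' : ‖planePt α γ v.1 v.2‖ < (R - K) / p := hv
      push_cast
      rw [planePt_smul, norm_smul, Real.norm_of_nonneg hp0.le]
      rw [lt_div_iff₀ hp0] at hv'
      have : 0 < 2 + 3 * α + γ := by positivity
      rw [hK] at hv'
      nlinarith)
    have h2 := ent_add_card_mul_le hw hr (hcmp r) h₀ hf₀ hfin.toFinset (B := ∅) finite_empty
      (fun v _ a _ b hb => absurd hb (notMem_empty b))
    rw [empty_union, ← ncard_eq_toFinset_card _ hfin] at h2
    have h3 := ent_nonneg G₀ ∅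
    have h4 := mul_le_mul_of_nonneg_left hr1 (Nat.cast_nonneg (α := ℝ) (latticeEllipse α γ ((R - K) / p)).ncard)
    rw [← hpr] at h4
    linarith
  · have h1 := log_ncard_cellSets_le (R := R) hpos hflat hf₀
    have h2 := ent_latticeEllipse_le hα0 hγ0 hw hr (hcmp r) h₀ hf₀ hβ
      (fun L hL u => hup L hL G₀ h₀ hf₀ u) hr1 hr2 (ρ := R + C' + 1) (by linarith) hδ0
    rw [← hpr] at h2
    have h3 : ((latticeEllipse α γ ((R + C' + 1 + (2 + α + γ) * (r + 2 * w + 3)) / p)).ncard : ℝ) ≤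
        (latticeEllipse α γ ((R + K) / p)).ncard := by
      refine Nat.cast_le.2 (ncard_le_ncard
        (fun v (hv : ‖planePt α γ v.1 v.2‖ < _) =>
          show ‖planePt α γ v.1 v.2‖ < _ from hv.trans_le ?_)
        (finite_latticeEllipse _ _ _))
      refine div_le_div_of_nonneg_right ?_ hp0.le
      have : (r : ℝ) + 2 * w + 3 = p + 1 := by rw [hpr]; ring
      rw [this, hK]
      have : 0 ≤ α * (p + 1) := by positivity
      nlinarith
    have h4 : β * (p ^ 2 * ((latticeEllipse α γ ((R + C' + 1 + (2 + α + γ) * (r + 2 * w + 3)) / p)).ncard : ℝ)) ≤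
        β * (p ^ 2 * (latticeEllipse α γ ((R + K) / p)).ncard) :=
      mul_le_mul_of_nonneg_left (mul_le_mul_of_nonneg_left h3 (by positivity)) hβ
    have hB : 0 ≤ β * (4 * (4 * w + 2)) := by positivity
    have h5 : R + C' + 1 + 2 * p ≤ R + D := by rw [hD]; linarith
    have h6 : δ * (R + C' + 1 + 2 * p) ^ 2 ≤ δ * (R + D) ^ 2 :=
      mul_le_mul_of_nonneg_left (pow_le_pow_left₀ (by positivity) h5 2) hδ0.le
    have h7 : β * ((4 * w + 2) * (4 * (R + C' + 1 + 2 * p) + 4 * w + 2)) ≤ D * (R + D) := by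
      have e1 : β * ((4 * w + 2) * (4 * (R + C' + 1 + 2 * p) + 4 * w + 2)) ≤
          β * (4 * (4 * w + 2)) * (R + (C' + 1 + 2 * p + w + 1)) := by
        have e2 := mul_nonneg hβ (by positivity : (0 : ℝ) ≤ 4 * w + 2)
        linarith
      refine e1.trans (mul_le_mul ?_ ?_ (by positivity) (by positivity)) <;> rw [hD]
      · have : 0 ≤ C' + 1 + 2 * p + w + 1 := by positivity
        linarith
      · linarith
    linarith

/-! ### Asymptotics of binomial coefficients -/

lemma le_log_factorial (n : ℕ) : n * Real.log n - n ≤ Real.log (n.factorial) := by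
  rcases Nat.eq_zero_or_pos n with rfl | hn
  · simp
  · have h := Stirling.le_log_factorial_stirling hn.ne'
    have h1 : 0 ≤ Real.log n := Real.log_natCast_nonneg n
    have h2 : 0 ≤ Real.log (2 * π) := Real.log_nonneg (by nlinarith [Real.pi_gt_three])
    linarith

/-- The Stirling sequence decreases from e / √2, whose logarithm is at most 1. The term log (2 n) /
2 is estimated crudely by √(2 n), since any error o(n) is harmless. -/
lemma log_factorial_le {n : ℕ} (hn : 0 < n) :
    Real.log (n.factorial) ≤ n * Real.log n - n + √(2 * n) + 1 := by
  obtain ⟨m, rfl⟩ := Nat.exists_eq_succ_of_ne_zero hn.ne'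
  have h1 := Stirling.stirlingSeq'_antitone (Nat.zero_le m)
  simp only [Function.comp] at h1
  have h2 := Real.log_le_log (Stirling.stirlingSeq'_pos m) h1
  have hn' : (0 : ℝ) < (m.succ : ℕ) := by exact_mod_cast hn
  have h3 : Real.log (Stirling.stirlingSeq (Nat.succ 0)) ≤ 1 := by
    rw [show Nat.succ 0 = 1 from rfl, Stirling.stirlingSeq_one,
      Real.log_div (Real.exp_pos 1).ne' (by positivity), Real.log_exp]
    have : 0 ≤ Real.log √2 := Real.log_nonneg (Real.one_le_sqrt.2 (by norm_num))
    linarith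
  have h4 := Stirling.log_stirlingSeq_formula m.succ
  have h5 : Real.log (2 * (m.succ : ℕ)) ≤ 2 * √(2 * (m.succ : ℕ)) := by
    have h6 : Real.log √(2 * (m.succ : ℕ)) ≤ √(2 * (m.succ : ℕ)) - 1 :=
      Real.log_le_sub_one_of_pos (Real.sqrt_pos.2 (by positivity))
    rw [Real.log_sqrt (by positivity)] at h6
    linarith
  rw [Real.log_div hn'.ne' (Real.exp_pos 1).ne', Real.log_exp] at h4
  have h7 : Real.log (Stirling.stirlingSeq m.succ) ≤ 1 := h2.trans h3
  linarith

lemma log_choose_ge {l a : ℕ} (hl : 0 < l) (ha : 0 < a) :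
    l * stairRate (a / l) - (√(2 * l) + √(2 * a) + 2) ≤ Real.log ((l + a).choose l) := by
  have hl' : (0 : ℝ) < l := by exact_mod_cast hl
  have ha' : (0 : ℝ) < a := by exact_mod_cast ha
  have h1 : Real.log ((l + a).choose l) =
      Real.log ((l + a).factorial) - Real.log (l.factorial) - Real.log (a.factorial) := by
    have h2 : (l + a).choose l * l.factorial * a.factorial = (l + a).factorial := by
      rw [Nat.choose_symm_add, Nat.add_choose_mul_factorial_mul_factorial]
    rw [← h2]
    push_cast
    have h3 : ((l + a).choose l : ℝ) ≠ 0 := by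
      exact_mod_cast (Nat.choose_pos (by omega)).ne'
    have h4 : ((l.factorial : ℕ) : ℝ) ≠ 0 := by exact_mod_cast l.factorial_ne_zero
    have h5 : ((a.factorial : ℕ) : ℝ) ≠ 0 := by exact_mod_cast a.factorial_ne_zero
    rw [Real.log_mul (mul_ne_zero h3 h4) h5, Real.log_mul h3 h4]
    ring
  have h2 := le_log_factorial (l + a)
  have h3 := log_factorial_le hl
  have h4 := log_factorial_le ha
  have h5 : l * stairRate (a / l) = (l + a) * Real.log (l + a) - l * Real.log l -
      a * Real.log a := by
    have h6 : 1 + (a : ℝ) / l = (l + a) / l := by field_simp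
    rw [stairRate, h6, Real.log_div (by positivity) hl'.ne', Real.log_div ha'.ne' hl'.ne']
    field_simp
    ring
  push_cast at h2
  linarith

lemma continuousAt_stairRate {α : ℝ} (hα : 0 < α) : ContinuousAt stairRate α := by
  unfold stairRate
  have h1 : (1 : ℝ) + α ≠ 0 := by linarith
  exact ((continuousAt_const.add continuousAt_id).mul
    ((continuousAt_const.add continuousAt_id).log h1)).sub
    (continuousAt_id.mul (continuousAt_id.log hα.ne'))

lemma exists_log_choose_ge {α ε : ℝ} (hα : 0 < α) (hε : 0 < ε) :
    ∃ l : ℕ, 0 < l ∧ stairRate α - ε ≤ Real.log ((l + ⌊α * l⌋₊).choose l) / l := by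
  have h1 : Tendsto (fun l : ℕ => ((⌊α * l⌋₊ : ℕ) : ℝ) / l) atTop (𝓝 α) :=
    (tendsto_nat_floor_mul_div_atTop hα.le).comp tendsto_natCast_atTop_atTop
  have hs : Tendsto (fun l : ℕ => √(l : ℝ)) atTop atTop :=
    Real.tendsto_sqrt_atTop.comp tendsto_natCast_atTop_atTop
  have h2 : Tendsto (fun l : ℕ => stairRate ((⌊α * l⌋₊ : ℕ) / l) -
      ((√2 + √(2 * α)) / √(l : ℝ) + 2 / l)) atTop (𝓝 (stairRate α - (0 + 0))) :=
    ((continuousAt_stairRate hα).tendsto.comp h1).sub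
      ((tendsto_const_nhds.div_atTop hs).add
        (tendsto_const_nhds.div_atTop tendsto_natCast_atTop_atTop))
  have h3 : stairRate α - ε < stairRate α - (0 + 0) := by linarith
  have h4 : ∀ᶠ l : ℕ in atTop, 1 ≤ α * l :=
    (tendsto_natCast_atTop_atTop.const_mul_atTop hα).eventually_ge_atTop 1
  obtain ⟨l, hl1, hl2, hl3⟩ := ((h2.eventually (lt_mem_nhds h3)).and
    (h4.and (eventually_gt_atTop 0))).exists
  refine ⟨l, hl3, hl1.le.trans ?_⟩
  have hl' : (0 : ℝ) < l := by exact_mod_cast hl3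
  rw [le_div_iff₀ hl']
  refine le_trans ?_ (log_choose_ge hl3 (Nat.floor_pos.2 hl2))
  have e1 : √(2 * (l : ℝ)) = √2 * √(l : ℝ) := Real.sqrt_mul (by norm_num) _
  have e2 : √(2 * ((⌊α * l⌋₊ : ℕ) : ℝ)) ≤ √(2 * α) * √(l : ℝ) := by
    rw [← Real.sqrt_mul (by positivity)]
    refine Real.sqrt_le_sqrt ?_
    have := Nat.floor_le (by positivity : 0 ≤ α * l)
    linarith
  have e3 : (√2 + √(2 * α)) / √(l : ℝ) * l = (√2 + √(2 * α)) * √(l : ℝ) := by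
    rw [div_mul_eq_mul_div, mul_div_assoc, Real.div_sqrt]
  have e4 : 2 / (l : ℝ) * l = 2 := div_mul_cancel₀ _ hl'.ne'
  rw [sub_mul, add_mul, e3, e4, e1]
  nlinarith

/-! ### The entropy function -/

lemma eta_eq_of_forall_tendsto {n : E3} (hn : n ∈ sphTriangle) {L : ℝ}
    (h : ∀ Q ∈ flattestSurfaces n,
      Tendsto (fun R : ℝ => entropyDensity n Q R) atTop (𝓝 L)) : eta n = L :=
  (h _ (Classical.epsilon_spec (p := fun Q => Q ∈ flattestSurfaces n)
    ⟨_, surf_discretePlane_mem_flattestSurfaces hn⟩)).limUnder_eq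

lemma tendsto_entropyDensity_of_apply_eq_zero {n : E3} (hn : n ∈ sphTriangle) {i : Fin 3}
    (hi : n i = 0) {Q : Set E3} (hQ : Q ∈ flattestSurfaces n) :
    Tendsto (fun R : ℝ => entropyDensity n Q R) atTop (𝓝 0) := by
  obtain ⟨U, hU, hflat, rfl⟩ := exists_isFlat_of_mem_flattestSurfaces hn hQ
  have : (fun R : ℝ => entropyDensity n (surf U) R) = fun _ => 0 := by
    ext R
    rw [entropyDensity, surfaceCount_eq_one hn hi hU hflat]
    simp
  rw [this]
  exact tendsto_const_nhds

lemma eta_eq_zero {n : E3} (hn : n ∈ sphTriangle) {i : Fin 3} (hi : n i = 0) : eta n = 0 :=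
  eta_eq_of_forall_tendsto hn fun _ hQ => tendsto_entropyDensity_of_apply_eq_zero hn hi hQ

lemma tendsto_entropyDensity_of_cellSets {n : E3} (hn : n ∈ sphTriangle) (hpos : ∀ i, 0 < n i)
    {C L : ℝ} {U₀ : Set (Fin 3 → ℤ)} (h₀ : IsLowerSet U₀) (h₁ : IsFlat n C U₀)
    (h : Tendsto (fun R : ℝ => Real.log (cellSets U₀ R).ncard / (π * R ^ 2)) atTop (𝓝 L)) :
    Tendsto (fun R : ℝ => entropyDensity n (surf U₀) R) atTop (𝓝 L) := by
  have h2 : Tendsto (fun R : ℝ => (1 + -2 / R) ^ 2) atTop (𝓝 ((1 + 0) ^ 2)) :=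
    (tendsto_const_nhds.add (tendsto_const_nhds.div_atTop tendsto_id)).pow 2
  have h3 := (h.comp (tendsto_atTop_add_const_right atTop (-2 : ℝ) tendsto_id)).mul h2
  rw [add_zero, one_pow, mul_one] at h3
  refine tendsto_of_tendsto_of_tendsto_of_le_of_le' h3 h ?_ ?_
  · filter_upwards [eventually_gt_atTop 2] with R hR
    have h4 := log_natCast_le (le_surfaceCount hn hpos h₀ h₁ R)
    have h5 : R - 2 ≠ 0 := by linarith
    have h6 : R ≠ 0 := by linarith
    have h7 : Real.log (cellSets U₀ (R + -2)).ncard / (π * (R + -2) ^ 2) * (1 + -2 / R) ^ 2 =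
        Real.log (cellSets U₀ (R - 2)).ncard / (π * R ^ 2) := by
      rw [← sub_eq_add_neg]
      have : (1 + -2 / R) = (R - 2) / R := by field_simp; ring
      rw [this]
      field_simp
    simp only [Function.comp, id]
    rw [h7]
    exact div_le_div_of_nonneg_right h4 (by positivity)
  · filter_upwards with R
    exact div_le_div_of_nonneg_right
      (log_natCast_le (surfaceCount_le hn (isDown_of_isLowerSet hpos h₀) h₁ R)) (by positivity)

lemma IsFlat.mono {n : E3} {C C' : ℝ} {U : Set (Fin 3 → ℤ)} (h : IsFlat n C U) (hC : C ≤ C') :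
    IsFlat n C' U :=
  ⟨fun c hc => (h.1 c hc).trans hC, fun c hc => (neg_le_neg hC).trans (h.2 c hc)⟩

/-- For interior directions the entropy is the growth rate for every flat set of cubes. -/
theorem exists_eta_eq {n : E3} (hn : n ∈ sphTriangle) (hpos : ∀ i, 0 < n i) {C : ℝ} (hC : 2 ≤ C) :
    ∃ β : ℝ, eta n = n 1 * β ∧
      (∀ Q ∈ flattestSurfaces n, Tendsto (fun R : ℝ => entropyDensity n Q R) atTop (𝓝 (eta n))) ∧
      (∀ U₀, IsLowerSet U₀ → IsFlat n C U₀ →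
        Tendsto (fun R : ℝ => Real.log (cellSets U₀ R).ncard / (π * R ^ 2)) atTop (𝓝 (eta n))) ∧
      β ≤ stairRate (n 0 / n 1) ∧
      ∀ l : ℕ, 0 < l → n 0 / n 1 * l ≤ n 2 / n 1 → n 0 / n 1 * l ≤ C / n 1 →
        Real.log ((l + ⌊n 0 / n 1 * l⌋₊).choose l) / l ≤ β := by
  obtain ⟨β, h1, h2, h3⟩ := exists_entropy_limit hn hpos C
  have h4 : ∀ Q ∈ flattestSurfaces n,
      Tendsto (fun R : ℝ => entropyDensity n Q R) atTop (𝓝 (n 1 * β)) := by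
    intro Q hQ
    obtain ⟨U, hU, hflat, rfl⟩ := exists_isFlat_of_mem_flattestSurfaces hn hQ
    exact tendsto_entropyDensity_of_cellSets hn hpos hU.isLowerSet (hflat.mono hC)
      (h1 U hU.isLowerSet (hflat.mono hC))
  have h5 := eta_eq_of_forall_tendsto hn h4
  refine ⟨β, h5, ?_, ?_, h2, h3⟩
  · rwa [h5]
  · rwa [h5]

lemma pos_or_eq_zero {n : E3} (hn : n ∈ sphTriangle) : (∀ i, 0 < n i) ∨ ∃ i, n i = 0 := by
  by_cases h : ∃ i, n i = 0
  · exact Or.inr h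
  · push Not at h
    exact Or.inl fun i => lt_of_le_of_ne (hn.2 i) (h i).symm

theorem tendsto_entropyDensity {n : E3} (hn : n ∈ sphTriangle) {Q : Set E3}
    (hQ : Q ∈ flattestSurfaces n) :
    Tendsto (fun R : ℝ => entropyDensity n Q R) atTop (𝓝 (eta n)) := by
  rcases pos_or_eq_zero hn with hpos | ⟨i, hi⟩
  · obtain ⟨β, -, h, -⟩ := exists_eta_eq hn hpos le_rfl
    exact h Q hQ
  · rw [eta_eq_zero hn hi]
    exact tendsto_entropyDensity_of_apply_eq_zero hn hi hQ

/-! ### Symmetry -/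

/-- Permutation of the coordinates. -/
def permute (σ : Equiv.Perm (Fin 3)) (n : E3) : E3 := WithLp.toLp 2 fun i => n (σ i)

lemma norm_permute (σ : Equiv.Perm (Fin 3)) (n : E3) : ‖permute σ n‖ = ‖n‖ := by
  refine (sq_eq_sq₀ (norm_nonneg _) (norm_nonneg _)).1 ?_
  rw [EuclideanSpace.norm_sq_eq, EuclideanSpace.norm_sq_eq]
  exact Equiv.sum_comp σ fun i => ‖n i‖ ^ 2

lemma permute_mem_sphTriangle {n : E3} (hn : n ∈ sphTriangle) (σ : Equiv.Perm (Fin 3)) :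
    permute σ n ∈ sphTriangle := ⟨(norm_permute σ n).trans hn.1, fun j => hn.2 (σ j)⟩

lemma dot_permute (σ : Equiv.Perm (Fin 3)) (n : E3) (c : Fin 3 → ℤ) :
    dot (permute σ n) (c ∘ σ) = dot n c := Equiv.sum_comp σ fun i => n i * (c i : ℝ)

/-- Permutation of the coordinates of a set of cubes. -/
def permuteSet (σ : Equiv.Perm (Fin 3)) (U : Set (Fin 3 → ℤ)) : Set (Fin 3 → ℤ) := {c | c ∘ σ ∈ U}

lemma permuteSet_symm (σ : Equiv.Perm (Fin 3)) (U : Set (Fin 3 → ℤ)) :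
    permuteSet σ.symm (permuteSet σ U) = U := by
  ext c
  simp only [permuteSet, mem_ofPred_eq, Function.comp_assoc]
  simp

lemma isLowerSet_permuteSet {σ : Equiv.Perm (Fin 3)} {U : Set (Fin 3 → ℤ)} (hU : IsLowerSet U) :
    IsLowerSet (permuteSet σ U) := fun _ _ h hc => hU (fun i => h (σ i)) hc

lemma isFlat_permuteSet {σ : Equiv.Perm (Fin 3)} {n : E3} {C : ℝ} {U : Set (Fin 3 → ℤ)}
    (h : IsFlat (permute σ n) C U) : IsFlat n C (permuteSet σ U) :=
  ⟨fun c hc => by rw [← dot_permute σ]; exact h.1 _ hc,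
    fun c hc => by rw [← dot_permute σ]; exact h.2 _ hc⟩

lemma permuteSet_mem_cellSets {σ : Equiv.Perm (Fin 3)} {U₀ U : Set (Fin 3 → ℤ)} {R : ℝ}
    (h : U ∈ cellSets U₀ R) : permuteSet σ U ∈ cellSets (permuteSet σ U₀) R :=
  ⟨isLowerSet_permuteSet h.1, fun c hc => h.2 _ (by
    have : toE (c ∘ σ) = permute σ (toE c) := rfl
    rwa [this, norm_permute])⟩

lemma ncard_cellSets_permuteSet (σ : Equiv.Perm (Fin 3)) (U₀ : Set (Fin 3 → ℤ)) (R : ℝ) :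
    (cellSets (permuteSet σ U₀) R).ncard = (cellSets U₀ R).ncard := by
  have key : ∀ (σ : Equiv.Perm (Fin 3)) (U₀ : Set (Fin 3 → ℤ)),
      (cellSets U₀ R).ncard ≤ (cellSets (permuteSet σ U₀) R).ncard := fun σ U₀ =>
    ncard_le_ncard_of_injOn (permuteSet σ) (fun U hU => permuteSet_mem_cellSets hU)
      (fun U _ V _ h => by rw [← permuteSet_symm σ U, h, permuteSet_symm]) (finite_cellSets _ _)
  refine le_antisymm ?_ (key σ U₀)
  have := key σ.symm (permuteSet σ U₀)
  rwa [permuteSet_symm] at this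

/-- A permutation need not carry the chosen flattest surface to the chosen one. This is immaterial,
since the limit is the same for every flat set of cubes. -/
theorem eta_permute {n : E3} (hn : n ∈ sphTriangle) (σ : Equiv.Perm (Fin 3)) :
    eta (permute σ n) = eta n := by
  have hn' := permute_mem_sphTriangle hn σ
  rcases pos_or_eq_zero hn with hpos | ⟨i, hi⟩
  · obtain ⟨β, -, -, h1, -⟩ := exists_eta_eq hn hpos le_rfl
    obtain ⟨β', -, -, h2, -⟩ := exists_eta_eq hn' (fun i => hpos (σ i)) le_rfl
    have hf := isFlat_discretePlane hn'
    have hl := (isDown_discretePlane hn').isLowerSet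
    have h3 := h1 _ (isLowerSet_permuteSet hl) (isFlat_permuteSet hf)
    simp only [ncard_cellSets_permuteSet] at h3
    exact tendsto_nhds_unique (h2 _ hl hf) h3
  · rw [eta_eq_zero hn hi, eta_eq_zero hn' (i := σ.symm i) (by simp [permute, hi])]

/-! ### Bounds for the entropy -/

/-- The homogeneous extension of the entropy density of staircases. -/
noncomputable def pairEntropy (a b : ℝ) : ℝ :=
  -(a * Real.log (a / (a + b)) + b * Real.log (b / (a + b)))

lemma pairEntropy_nonneg {a b : ℝ} (ha : 0 ≤ a) (hb : 0 ≤ b) : 0 ≤ pairEntropy a b := by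
  have h1 : Real.log (a / (a + b)) ≤ 0 :=
    Real.log_nonpos (by positivity) (div_le_one_of_le₀ (by linarith) (by linarith))
  have h2 : Real.log (b / (a + b)) ≤ 0 :=
    Real.log_nonpos (by positivity) (div_le_one_of_le₀ (by linarith) (by linarith))
  unfold pairEntropy
  nlinarith

lemma mul_stairRate {a b : ℝ} (ha : 0 < a) (hb : 0 < b) :
    b * stairRate (a / b) = pairEntropy a b := by
  have h1 : 1 + a / b = (a + b) / b := by field_simp; ring
  have h2 : 0 < a + b := by linarith
  rw [stairRate, pairEntropy, h1, Real.log_div h2.ne' hb.ne', Real.log_div ha.ne' hb.ne',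
    Real.log_div ha.ne' h2.ne', Real.log_div hb.ne' h2.ne']
  field_simp
  ring

lemma eta_le_pairEntropy {n : E3} (hn : n ∈ sphTriangle) : eta n ≤ pairEntropy (n 0) (n 1) := by
  rcases pos_or_eq_zero hn with hpos | ⟨i, hi⟩
  · obtain ⟨β, h1, -, -, h2, -⟩ := exists_eta_eq hn hpos le_rfl
    rw [h1, ← mul_stairRate (hpos 0) (hpos 1)]
    exact mul_le_mul_of_nonneg_left h2 (hpos 1).le
  · rw [eta_eq_zero hn hi]
    exact pairEntropy_nonneg (hn.2 0) (hn.2 1)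

/-- The permutation of the coordinates which moves the coordinate `i` to the last place and keeps
the order of the other ones. -/
def lastPerm (i : Fin 3) : Equiv.Perm (Fin 3) :=
  ![finRotate 3, Equiv.swap 1 2, Equiv.refl _] i

lemma lastPerm_apply (i : Fin 3) : lastPerm i 0 = i.succAbove 0 ∧ lastPerm i 1 = i.succAbove 1 ∧
    lastPerm i 2 = i := by
  fin_cases i <;> decide

theorem eta_le_pairEntropy_succAbove {n : E3} (hn : n ∈ sphTriangle) (i : Fin 3) :
    eta n ≤ pairEntropy (n (i.succAbove 0)) (n (i.succAbove 1)) := by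
  have h := eta_le_pairEntropy (permute_mem_sphTriangle hn (lastPerm i))
  rw [eta_permute hn] at h
  simpa only [permute, lastPerm_apply] using h

lemma tilt_mem_sphTriangle {v : E2} (hv : v ∈ quarterCircle) {θ : ℝ} (h0 : 0 ≤ θ)
    (h1 : θ ≤ π / 2) : tilt v θ ∈ sphTriangle := by
  have hs : 0 ≤ Real.sin θ := Real.sin_nonneg_of_nonneg_of_le_pi h0 (by linarith)
  have hc : 0 ≤ Real.cos θ := Real.cos_nonneg_of_mem_Icc ⟨by linarith, h1⟩
  have hv2 := EuclideanSpace.norm_sq_eq v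
  rw [hv.1, Fin.sum_univ_two] at hv2
  simp only [Real.norm_eq_abs, sq_abs] at hv2
  constructor
  · refine (sq_eq_sq₀ (norm_nonneg _) zero_le_one).1 ?_
    rw [EuclideanSpace.norm_sq_eq, Fin.sum_univ_three]
    simp only [tilt, Real.norm_eq_abs, sq_abs]
    simp
    nlinarith [Real.sin_sq_add_cos_sq θ]
  · intro j
    have := hv.2 0
    have := hv.2 1
    fin_cases j <;> simp [tilt] <;> positivity

lemma eta_tilt_le {v : E2} (hv : v ∈ quarterCircle) {θ : ℝ} (h0 : 0 < θ)
    (h1 : θ < π / 2) : eta (tilt v θ) ≤ Real.sin θ * stairEntropy v := by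
  have hs : 0 < Real.sin θ := Real.sin_pos_of_pos_of_lt_pi h0 (by linarith)
  refine (eta_le_pairEntropy (tilt_mem_sphTriangle hv h0.le h1.le)).trans (le_of_eq ?_)
  have e0 : tilt v θ 0 = Real.sin θ * v 0 := by simp [tilt]
  have e1 : tilt v θ 1 = Real.sin θ * v 1 := by simp [tilt]
  rw [e0, e1, pairEntropy, stairEntropy, ← mul_add, mul_div_mul_left _ _ hs.ne',
    mul_div_mul_left _ _ hs.ne']
  ring

/-- Along the tilt the slope n 0 / n 1 = v 0 / v 1 = α is constant, while n 2 / n 1 tends to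
infinity. Fix l so large that staircases of length l have nearly the full rate; for small θ the
condition α l ≤ n 2 / n 1 of the block construction holds. -/
lemma eventually_le_eta_tilt {v : E2} (hv : v ∈ quarterCircle) {ε : ℝ} (hε : 0 < ε) :
    ∀ᶠ θ in 𝓝[>] (0 : ℝ), Real.sin θ * (stairEntropy v - ε) ≤ eta (tilt v θ) := by
  have hπ := Real.pi_pos
  have hsmall : ∀ᶠ θ in 𝓝[>] (0 : ℝ), θ < π / 2 :=
    eventually_nhdsWithin_of_eventually_nhds (gt_mem_nhds (by linarith))
  -- This covers v on a coordinate axis, where α is zero or undefined; then η ≥ 0 suffices.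
  rcases eq_or_ne (stairEntropy v) 0 with hzero | hnz
  · filter_upwards [hsmall, self_mem_nhdsWithin] with θ h1 h0
    have hs : 0 < Real.sin θ := Real.sin_pos_of_pos_of_lt_pi h0 (by linarith)
    have hn := tilt_mem_sphTriangle hv (le_of_lt h0) h1.le
    have : 0 ≤ eta (tilt v θ) :=
      ge_of_tendsto' (tendsto_entropyDensity hn (surf_discretePlane_mem_flattestSurfaces hn))
        fun R => div_nonneg (Real.log_natCast_nonneg _) (by positivity)
    rw [hzero]
    nlinarith
  have hv0 : 0 < v 0 := lt_of_le_of_ne (hv.2 0) fun h => hnz (by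
    rcases eq_or_ne (v 1) 0 with h1 | h1
    · simp [stairEntropy, ← h, h1]
    · simp [stairEntropy, ← h, h1])
  have hv1 : 0 < v 1 := lt_of_le_of_ne (hv.2 1) fun h => hnz (by
    simp [stairEntropy, ← h, hv0.ne'])
  have hv1' : v 1 ≤ 1 := by
    have := PiLp.norm_apply_le v 1
    rw [hv.1, Real.norm_eq_abs] at this
    exact (le_abs_self _).trans this
  set α := v 0 / v 1 with hα
  have hα0 : 0 < α := div_pos hv0 hv1
  obtain ⟨l, hl, hle⟩ := exists_log_choose_ge hα0 hε
  have htan : ∀ᶠ θ in 𝓝[>] (0 : ℝ), α * l * (Real.sin θ * v 1) < Real.cos θ := by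
    refine eventually_nhdsWithin_of_eventually_nhds ?_
    have h1 : Continuous fun θ : ℝ => α * l * (Real.sin θ * v 1) := by fun_prop
    exact (h1.tendsto 0).eventually_lt (Real.continuous_cos.tendsto 0) (by simp)
  filter_upwards [hsmall, htan, self_mem_nhdsWithin] with θ h1 h2 h0
  have hs : 0 < Real.sin θ := Real.sin_pos_of_pos_of_lt_pi h0 (by linarith)
  have hc : 0 < Real.cos θ := Real.cos_pos_of_mem_Ioo ⟨by linarith [mem_Ioi.1 h0], h1⟩
  have hn := tilt_mem_sphTriangle hv (le_of_lt h0) h1.le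
  have e0 : tilt v θ 0 = Real.sin θ * v 0 := by simp [tilt]
  have e1 : tilt v θ 1 = Real.sin θ * v 1 := by simp [tilt]
  have e2 : tilt v θ 2 = Real.cos θ := by simp [tilt]
  have hpos : ∀ i, 0 < tilt v θ i := by
    intro i
    fin_cases i
    · show 0 < tilt v θ 0
      rw [e0]; positivity
    · show 0 < tilt v θ 1
      rw [e1]; positivity
    · show 0 < tilt v θ 2
      rw [e2]; exact hc
  -- The flatness constant has to be at least α l times n 1, and n 1 ≤ 1.
  obtain ⟨β, h3, -, -, -, h4⟩ := exists_eta_eq hn hpos (le_max_left 2 (α * l))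
  have e3 : tilt v θ 0 / tilt v θ 1 = α := by
    rw [e0, e1, mul_div_mul_left _ _ hs.ne']
  have h1pos : 0 < tilt v θ 1 := hpos 1
  have h5 := h4 l hl (by
    rw [e3, le_div_iff₀ h1pos, e1, e2]; exact h2.le) (by
    rw [e3, le_div_iff₀ h1pos, e1]
    refine le_trans ?_ (le_max_right _ _)
    have : Real.sin θ * v 1 ≤ 1 := mul_le_one₀ (Real.sin_le_one θ) hv1.le hv1'
    exact mul_le_of_le_one_right (by positivity) this)
  rw [e3] at h5
  have h6 : stairEntropy v = v 1 * stairRate α := (mul_stairRate hv0 hv1).symm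
  rw [h3, e1, h6, mul_assoc]
  refine mul_le_mul_of_nonneg_left ?_ hs.le
  have h7 := hle.trans h5
  nlinarith

theorem hasDerivWithinAt_eta_tilt {v : E2} (hv : v ∈ quarterCircle) :
    HasDerivWithinAt (fun θ : ℝ => eta (tilt v θ)) (stairEntropy v) (Set.Ici 0) 0 := by
  have hπ := Real.pi_pos
  have h00 : eta (tilt v 0) = 0 :=
    eta_eq_zero (tilt_mem_sphTriangle hv le_rfl (by linarith)) (i := 0) (by simp [tilt])
  have hsin : Tendsto (fun θ : ℝ => θ⁻¹ * Real.sin θ) (𝓝[>] 0) (𝓝 1) := by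
    have h := (Real.hasDerivAt_sin 0).tendsto_slope_zero_right
    simpa using h
  rw [hasDerivWithinAt_iff_tendsto_slope, Ici_sdiff_left]
  have hsl : ∀ θ : ℝ, slope (fun θ : ℝ => eta (tilt v θ)) 0 θ = θ⁻¹ * eta (tilt v θ) := by
    intro θ
    simp [slope_def_field, h00, div_eq_inv_mul]
  rw [show slope (fun θ : ℝ => eta (tilt v θ)) 0 = fun θ => θ⁻¹ * eta (tilt v θ) from funext hsl]
  have hsmall : ∀ᶠ θ in 𝓝[>] (0 : ℝ), θ < π / 2 :=
    eventually_nhdsWithin_of_eventually_nhds (gt_mem_nhds (by linarith))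
  refine tendsto_order.2 ⟨fun b hb => ?_, fun b hb => ?_⟩
  · have h1 := hsin.mul_const (stairEntropy v - (stairEntropy v - b) / 2)
    rw [one_mul] at h1
    filter_upwards [eventually_le_eta_tilt hv (half_pos (sub_pos.2 hb)),
      h1.eventually (lt_mem_nhds (by linarith : b < _)), self_mem_nhdsWithin] with θ h2 h3 h0
    refine h3.trans_le ?_
    rw [mul_assoc]
    exact mul_le_mul_of_nonneg_left h2 (inv_nonneg.2 (le_of_lt h0))
  · have h1 := hsin.mul_const (stairEntropy v)
    rw [one_mul] at h1
    filter_upwards [hsmall, h1.eventually (gt_mem_nhds hb), self_mem_nhdsWithin] with θ h2 h3 h0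
    refine lt_of_le_of_lt ?_ h3
    rw [mul_assoc]
    exact mul_le_mul_of_nonneg_left (eta_tilt_le hv h0 h2) (inv_nonneg.2 (le_of_lt h0))

/-! ### The dual Wulff construction for the entropy -/

lemma sum_eq_succAbove (f : Fin 3 → ℝ) (i : Fin 3) :
    ∑ j, f j = f i + (f (i.succAbove 0) + f (i.succAbove 1)) := by
  rw [Fin.sum_univ_succAbove _ i, Fin.sum_univ_two]

lemma embed_apply_self (i : Fin 3) (p : E2) : embed i p i = 0 := by simp [embed]

lemma embed_apply_succAbove (i : Fin 3) (p : E2) (k : Fin 2) : embed i p (i.succAbove k) = p k := by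
  simp [embed]

/-- The coordinates of a point other than the `i`-th one. -/
noncomputable def omitCoord (i : Fin 3) (x : E3) : E2 := WithLp.toLp 2 fun k => x (i.succAbove k)

lemma embed_omitCoord {i : Fin 3} {x : E3} (hx : x i = 0) : embed i (omitCoord i x) = x := by
  ext j
  rcases Fin.eq_self_or_eq_succAbove i j with rfl | ⟨k, rfl⟩
  · rw [embed_apply_self, hx]
  · rw [embed_apply_succAbove]; rfl

lemma omitCoord_embed (i : Fin 3) (p : E2) : omitCoord i (embed i p) = p := by
  ext k
  exact embed_apply_succAbove i p k

lemma embed_smul (i : Fin 3) (c : ℝ) (p : E2) : embed i (c • p) = c • embed i p := by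
  ext j
  rcases Fin.eq_self_or_eq_succAbove i j with rfl | ⟨k, rfl⟩
  · simp [embed_apply_self]
  · simp [embed_apply_succAbove]

/-- The convex region above the curve `exp (-x) + exp (-y) = 1`. -/
def expRegion : Set E2 := {p | Real.exp (-p 0) + Real.exp (-p 1) ≤ 1}

/-- This is log u ≤ u - 1 at u = exp (-p) m / s. -/
lemma neg_mul_log_le {s m : ℝ} (p : ℝ) (hs : 0 ≤ s) (hm : s ≤ m) :
    -(s * Real.log (s / m)) ≤ s * p + Real.exp (-p) * m - s := by
  rcases hs.eq_or_lt with rfl | hs'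
  · simpa using mul_nonneg (Real.exp_pos (-p)).le hm
  have hm' : 0 < m := hs'.trans_le hm
  have h1 := Real.log_le_sub_one_of_pos (x := Real.exp (-p) * (m / s)) (by positivity)
  rw [Real.log_mul (Real.exp_pos _).ne' (by positivity), Real.log_exp] at h1
  have h2 : Real.log (s / m) = -Real.log (m / s) := by rw [← Real.log_inv, inv_div]
  have h3 := mul_le_mul_of_nonneg_left h1 hs
  have h4 : s * (Real.exp (-p) * (m / s) - 1) = Real.exp (-p) * m - s := by field_simp
  rw [h2]
  linarith

lemma pairEntropy_le {s t p q : ℝ} (hs : 0 ≤ s) (ht : 0 ≤ t)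
    (h : Real.exp (-p) + Real.exp (-q) ≤ 1) : pairEntropy s t ≤ s * p + t * q := by
  have h1 := neg_mul_log_le p hs (le_add_of_nonneg_right ht : s ≤ s + t)
  have h2 := neg_mul_log_le q ht (le_add_of_nonneg_left hs : t ≤ s + t)
  have h3 := mul_le_mul_of_nonneg_right h (add_nonneg hs ht)
  rw [pairEntropy]
  linarith

/-- Test with v proportional to (a, b) = (exp (-p 0), exp (-p 1)), the equality case of the Gibbs
inequality. There the hypothesis reduces to (a + b) log (a + b) ≤ 0. -/
lemma mem_expRegion_of_forall {p : E2}
    (h : ∀ v ∈ quarterCircle, stairEntropy v ≤ p 0 * v 0 + p 1 * v 1) : p ∈ expRegion := by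
  set a := Real.exp (-p 0) with ha
  set b := Real.exp (-p 1) with hb
  have ha0 : 0 < a := Real.exp_pos _
  have hb0 : 0 < b := Real.exp_pos _
  have hw : (0 : ℝ) < a ^ 2 + b ^ 2 := by positivity
  set r := √(a ^ 2 + b ^ 2) with hr
  have hr0 : 0 < r := Real.sqrt_pos.2 hw
  have hr2 : r ^ 2 = a ^ 2 + b ^ 2 := Real.sq_sqrt hw.le
  have hv : (!₂[a / r, b / r] : E2) ∈ quarterCircle := by
    refine ⟨?_, fun j => ?_⟩
    · rw [EuclideanSpace.norm_eq, Real.sqrt_eq_one]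
      simp only [Fin.sum_univ_two, Real.norm_eq_abs, sq_abs]
      simp only [Matrix.cons_val_zero, Matrix.cons_val_one]
      rw [div_pow, div_pow, ← add_div, ← hr2, div_self (by positivity)]
    · fin_cases j
      · show 0 ≤ a / r
        positivity
      · show 0 ≤ b / r
        positivity
  have h1 := h _ hv
  simp only [stairEntropy, Matrix.cons_val_zero, Matrix.cons_val_one] at h1
  have e0 : a / r / (a / r + b / r) = a / (a + b) := by field_simp
  have e1 : b / r / (a / r + b / r) = b / (a + b) := by field_simp
  rw [e0, e1, Real.log_div ha0.ne' (by positivity), Real.log_div hb0.ne' (by positivity),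
    ha, hb, Real.log_exp, Real.log_exp, ← ha, ← hb] at h1
  have h2 := mul_le_mul_of_nonneg_left h1 hr0.le
  have h3 : r * -(a / r * (-p 0 - Real.log (a + b)) + b / r * (-p 1 - Real.log (a + b))) =
      a * p 0 + b * p 1 + (a + b) * Real.log (a + b) := by
    field_simp
    ring
  have h4 : r * (p 0 * (a / r) + p 1 * (b / r)) = a * p 0 + b * p 1 := by
    field_simp
  rw [h3, h4] at h2
  have h5 : Real.log (a + b) ≤ 0 := by
    by_contra! h6
    have : 0 < (a + b) * Real.log (a + b) := by positivity
    linarith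
  exact (Real.log_nonpos_iff (by positivity)).1 h5

/-- The entropy is bounded by the pair entropy of the coordinates other than i, and the coordinate i
only adds a nonnegative term to the inner product. -/
lemma mem_dualWulffBody_eta {x : E3} (hx : x ∈ octant) {i : Fin 3}
    (h : omitCoord i x ∈ expRegion) : x ∈ dualWulffBody eta := by
  intro n hn
  have h1 := (eta_le_pairEntropy_succAbove hn i).trans
    (pairEntropy_le (hn.2 _) (hn.2 _) h)
  rw [inner_eq_sum, sum_eq_succAbove _ i]
  have h2 := mul_nonneg (hx i) (hn.2 i)
  have h3 : ∀ k, omitCoord i x k = x (i.succAbove k) := fun _ => rfl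
  rw [h3, h3] at h1
  linarith

lemma single_mem_sphTriangle (i : Fin 3) : (EuclideanSpace.single i 1 : E3) ∈ sphTriangle := by
  refine ⟨by simp, fun j => ?_⟩
  rw [PiLp.single_apply]
  split_ifs <;> norm_num

lemma inner_single (i : Fin 3) (x : E3) : inner ℝ (EuclideanSpace.single i (1 : ℝ)) x = x i := by
  simp [EuclideanSpace.inner_single_left]

lemma dualWulffBody_eta_subset_octant : dualWulffBody eta ⊆ octant := by
  intro x hx i
  have h1 := hx _ (single_mem_sphTriangle i)
  rw [real_inner_comm, inner_single, eta_eq_zero (single_mem_sphTriangle i) (i := i.succAbove 0)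
    (by simp)] at h1
  exact h1

lemma isClosed_dualWulffBody (f : E3 → ℝ) : IsClosed (dualWulffBody f) := by
  have : dualWulffBody f = ⋂ n ∈ sphTriangle, {x : E3 | f n ≤ inner ℝ x n} := by
    ext x; simp [dualWulffBody]
  rw [this]
  exact isClosed_biInter fun n _ => isClosed_le continuous_const (by fun_prop)

/-- If x i = 0, the inner product of x with a normal tilted by θ from the i-th axis is sin θ times
that of the remaining coordinates with v. Dividing by sin θ leaves the staircase inequality up to ε.
The other inclusion is `mem_dualWulffBody_eta`. -/
theorem dualWulffBody_eta_inter_coordinate_plane (i : Fin 3) :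
    dualWulffBody eta ∩ {x | x i = 0} = embed i '' expRegion := by
  apply Subset.antisymm
  · rintro x ⟨hx, hxi⟩
    refine ⟨omitCoord i x, mem_expRegion_of_forall fun v hv => ?_, embed_omitCoord hxi⟩
    refine le_of_forall_pos_sub_le fun ε hε => ?_
    have hsmall : ∀ᶠ θ in 𝓝[>] (0 : ℝ), θ < π / 2 :=
      eventually_nhdsWithin_of_eventually_nhds (gt_mem_nhds (by linarith [Real.pi_pos]))
    obtain ⟨θ, h1, h2, h0⟩ :=
      ((eventually_le_eta_tilt hv hε).and (hsmall.and self_mem_nhdsWithin)).exists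
    have hs : 0 < Real.sin θ := Real.sin_pos_of_pos_of_lt_pi h0 (by linarith [Real.pi_pos])
    have hn := tilt_mem_sphTriangle hv (le_of_lt h0) h2.le
    have h3 := hx _ (permute_mem_sphTriangle hn (lastPerm i).symm)
    have h4 : inner ℝ x (permute (lastPerm i).symm (tilt v θ)) =
        Real.sin θ * (x (i.succAbove 0) * v 0 + x (i.succAbove 1) * v 1) := by
      rw [inner_eq_sum, ← Equiv.sum_comp (lastPerm i)]
      simp only [permute, Equiv.symm_apply_apply, Fin.sum_univ_three, lastPerm_apply]
      rw [show x i = 0 from hxi]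
      simp only [tilt, PiLp.toLp_apply, Matrix.cons_val_zero, Matrix.cons_val_one]
      ring
    rw [eta_permute hn, h4] at h3
    exact le_of_mul_le_mul_left (h1.trans h3) hs
  · rintro _ ⟨p, hp, rfl⟩
    refine ⟨mem_dualWulffBody_eta (fun j => ?_) (i := i) (by rwa [omitCoord_embed]),
      embed_apply_self i p⟩
    have h0 := Real.exp_pos (-p 0)
    have h1 := Real.exp_pos (-p 1)
    have hp' : Real.exp (-p 0) + Real.exp (-p 1) ≤ 1 := hp
    rcases Fin.eq_self_or_eq_succAbove i j with rfl | ⟨k, rfl⟩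
    · rw [embed_apply_self]
    · rw [embed_apply_succAbove]
      have h2 : Real.exp (-p k) ≤ 1 := by
        fin_cases k
        · show Real.exp (-p 0) ≤ 1
          linarith
        · show Real.exp (-p 1) ≤ 1
          linarith
      linarith [Real.exp_le_one_iff.1 h2]

lemma eventually_sub_smul_mem {E : Type*} [NormedAddCommGroup E] [NormedSpace ℝ E] {S : Set E}
    {x : E} (hx : x ∈ interior S) (v : E) : ∀ᶠ t in 𝓝[>] (0 : ℝ), x - t • v ∈ S := by
  refine eventually_nhdsWithin_of_eventually_nhds ?_
  have h1 : Continuous fun t : ℝ => x - t • v := by fun_prop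
  have h2 := h1.tendsto 0
  simp only [zero_smul, sub_zero] at h2
  exact h2.eventually (mem_interior_iff_mem_nhds.1 hx)

lemma frontier_dualWulffBody_eta_inter_quadrant (i : Fin 3) :
    frontier (dualWulffBody eta) ∩ quadrant i = dualWulffBody eta ∩ {x | x i = 0} := by
  ext x
  constructor
  · rintro ⟨h1, h2⟩
    exact ⟨(isClosed_dualWulffBody eta).frontier_subset h1, h2.1⟩
  · rintro ⟨h1, h2⟩
    refine ⟨⟨subset_closure h1, fun h3 => ?_⟩, h2, dualWulffBody_eta_subset_octant h1⟩
    obtain ⟨t, h4, h5⟩ := ((eventually_sub_smul_mem h3 (EuclideanSpace.single i 1)).and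
      self_mem_nhdsWithin).exists
    have h6 := dualWulffBody_eta_subset_octant h4 i
    have h7 : x i = 0 := h2
    simp only [PiLp.sub_apply, PiLp.smul_apply, h7, PiLp.single_apply] at h6
    have h8 : 0 < t := h5
    simp at h6
    linarith

lemma frontier_expRegion : frontier expRegion = {p | Real.exp (-p 0) + Real.exp (-p 1) = 1} := by
  have hc : Continuous fun p : E2 => Real.exp (-p 0) + Real.exp (-p 1) := by fun_prop
  apply Subset.antisymm (frontier_le_subset_eq hc continuous_const)
  intro p hp
  refine ⟨subset_closure (le_of_eq hp), fun h3 => ?_⟩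
  obtain ⟨t, h4, h5⟩ := ((eventually_sub_smul_mem h3 (!₂[1, 1] : E2)).and
    self_mem_nhdsWithin).exists
  have h6 : 0 < t := h5
  have h7 : Real.exp (-(p 0 - t * 1)) + Real.exp (-(p 1 - t * 1)) ≤ 1 := h4
  have h8 : Real.exp (-p 0) < Real.exp (-(p 0 - t * 1)) := Real.exp_lt_exp.2 (by linarith)
  have h9 : Real.exp (-p 1) < Real.exp (-(p 1 - t * 1)) := Real.exp_lt_exp.2 (by linarith)
  have hp' : Real.exp (-p 0) + Real.exp (-p 1) = 1 := hp
  linarith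

/-! ### The enclosed volume -/

lemma volume_box (a b : Fin 3 → ℝ) :
    volume {x : E3 | ∀ j, x j ∈ Set.Icc (a j) (b j)} = ∏ j, ENNReal.ofReal (b j - a j) := by
  have h := (PiLp.volume_preserving_ofLp (Fin 3)).measure_preimage
    (measurableSet_Icc (a := a) (b := b)).nullMeasurableSet
  rw [Real.volume_Icc_pi] at h
  rw [← h]
  congr 1
  ext x
  simp only [mem_preimage, Set.mem_Icc, Pi.le_def, mem_ofPred_eq]
  exact ⟨fun h => ⟨fun j => (h j).1, fun j => (h j).2⟩, fun h j => ⟨h.1 j, h.2 j⟩⟩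

lemma exp_add_exp_gt_one {x : E3} (hx : x ∈ octant \ dualWulffBody eta) {j k : Fin 3}
    (hjk : j ≠ k) : 1 < Real.exp (-x j) + Real.exp (-x k) := by
  have key : ∀ i : Fin 3, 1 < Real.exp (-x (i.succAbove 0)) + Real.exp (-x (i.succAbove 1)) := by
    intro i
    by_contra! h
    exact hx.2 (mem_dualWulffBody_eta hx.1 (i := i) h)
  have h : ∀ j k : Fin 3, j ≠ k → ∃ i : Fin 3,
      (i.succAbove 0 = j ∧ i.succAbove 1 = k) ∨ (i.succAbove 0 = k ∧ i.succAbove 1 = j) := by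
    decide
  obtain ⟨i, ⟨rfl, rfl⟩ | ⟨rfl, rfl⟩⟩ := h j k hjk
  · exact key i
  · rw [add_comm]; exact key i

/-- With u = 2⁻¹ ^ (k + 1) ≥ exp (-s), the hypothesis gives (1 - u) exp t < 1. For t > 2 u this
contradicts (1 - u) (1 + 2 u) ≥ 1, valid for u ≤ 1 / 2. -/
lemma le_two_inv_pow_of_exp {s t : ℝ} {k : ℕ} (hs : k + 1 ≤ s)
    (h : 1 < Real.exp (-s) + Real.exp (-t)) : t ≤ 2⁻¹ ^ k := by
  have h2 : (2 : ℝ) ≤ Real.exp 1 := by linarith [Real.add_one_le_exp 1]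
  have h3 : Real.exp (-s) ≤ 2⁻¹ ^ (k + 1) := by
    rw [Real.exp_neg, inv_pow]
    refine inv_anti₀ (by positivity) ?_
    calc (2 : ℝ) ^ (k + 1) ≤ Real.exp 1 ^ (k + 1) := by gcongr
      _ = Real.exp ((k + 1 : ℕ) : ℝ) := by rw [← Real.exp_nat_mul]; simp
      _ ≤ Real.exp s := Real.exp_le_exp.2 (by push_cast; exact hs)
  set u : ℝ := 2⁻¹ ^ (k + 1) with hu
  have hu0 : 0 < u := by positivity
  have hu1 : u ≤ 2⁻¹ := by
    rw [hu, pow_succ]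
    exact mul_le_of_le_one_left (by norm_num) (pow_le_one₀ (by norm_num) (by norm_num))
  have hu2 : (2⁻¹ : ℝ) ^ k = 2 * u := by rw [hu, pow_succ]; ring
  rw [hu2]
  by_contra! h4
  have h5 : (1 - u) * Real.exp t < 1 := by
    have : Real.exp (-t) * Real.exp t = 1 := by rw [← Real.exp_add]; simp
    rw [← this]
    exact mul_lt_mul_of_pos_right (by linarith) (Real.exp_pos t)
  have h6 := Real.add_one_le_exp t
  have h7 : (1 - u) * (2 * u + 1) ≤ (1 - u) * Real.exp t :=
    mul_le_mul_of_nonneg_left (by linarith) (by linarith)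
  nlinarith

/-- Outside the unit cube some x i exceeds 1; if it lies in [k + 1, k + 2], the other two
coordinates are at most 2⁻¹ ^ k. The volumes of these boxes are summable. -/
lemma volume_octant_sdiff_ne_top : volume (octant \ dualWulffBody eta) ≠ ⊤ := by
  let a : Fin 3 → ℕ → Fin 3 → ℝ := fun i k j => if j = i then k + 1 else 0
  let b : Fin 3 → ℕ → Fin 3 → ℝ := fun i k j => if j = i then k + 2 else 2⁻¹ ^ k
  have hcover : octant \ dualWulffBody eta ⊆
      {x : E3 | ∀ j, x j ∈ Set.Icc ((fun _ => 0) j : ℝ) ((fun _ => 1) j : ℝ)} ∪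
      ⋃ i, ⋃ k, {x : E3 | ∀ j, x j ∈ Set.Icc (a i k j) (b i k j)} := by
    intro x hx
    by_cases hle : ∀ j, x j ≤ 1
    · exact Or.inl fun j => ⟨hx.1 j, hle j⟩
    · push Not at hle
      obtain ⟨i, hi⟩ := hle
      refine Or.inr (mem_iUnion.2 ⟨i, mem_iUnion.2 ⟨⌊x i - 1⌋₊, fun j => ?_⟩⟩)
      have h1 := Nat.floor_le (by linarith : 0 ≤ x i - 1)
      have h2 := Nat.lt_floor_add_one (x i - 1)
      rcases eq_or_ne j i with rfl | hj
      · simp only [a, b, if_true]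
        constructor <;> linarith
      · simp only [a, b, if_neg hj]
        exact ⟨hx.1 j, le_two_inv_pow_of_exp (by linarith)
          (exp_add_exp_gt_one hx hj.symm)⟩
  have hvol : ∀ i k, volume {x : E3 | ∀ j, x j ∈ Set.Icc (a i k j) (b i k j)} ≤
      ENNReal.ofReal (2⁻¹ ^ k) := by
    intro i k
    rw [volume_box, Fin.prod_univ_succAbove _ i, Fin.prod_univ_two]
    simp only [a, b, if_true, Fin.succAbove_ne, if_false, sub_zero]
    rw [show (k : ℝ) + 2 - (k + 1) = 1 by ring, ENNReal.ofReal_one, one_mul]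
    refine mul_le_of_le_one_left zero_le ?_
    rw [ENNReal.ofReal_le_one]
    exact pow_le_one₀ (by norm_num) (by norm_num)
  refine ne_top_of_le_ne_top ?_ (measure_mono hcover)
  refine ne_top_of_le_ne_top ?_ (measure_union_le _ _)
  refine ENNReal.add_ne_top.2 ⟨?_, ?_⟩
  · rw [volume_box]
    simp
  · refine ne_top_of_le_ne_top ?_ (measure_iUnion_le _)
    rw [tsum_fintype]
    refine ENNReal.sum_ne_top.2 fun i _ => ?_
    refine ne_top_of_le_ne_top ?_ (measure_iUnion_le _)
    refine ne_top_of_le_ne_top ?_ (ENNReal.tsum_le_tsum (hvol i))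
    exact Summable.tsum_ofReal_ne_top
      (summable_geometric_of_lt_one (by norm_num) (by norm_num))

/-- Otherwise the origin would belong to the body, hence to its section by a coordinate plane,
although exp 0 + exp 0 > 1. -/
lemma exists_eta_pos : ∃ n ∈ sphTriangle, 0 < eta n := by
  by_contra! h
  have hp : (0 : E2) ∈ expRegion := by
    have h1 : (0 : E3) ∈ dualWulffBody eta ∩ {x | x 0 = 0} :=
      ⟨fun n hn => by simpa using h n hn, by simp⟩
    rw [dualWulffBody_eta_inter_coordinate_plane] at h1
    obtain ⟨p, hp, h2⟩ := h1
    have h3 : p = 0 := by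
      rw [← omitCoord_embed 0 p, h2]
      ext k
      simp [omitCoord]
    rwa [← h3]
  have : Real.exp (-(0 : E2) 0) + Real.exp (-(0 : E2) 1) ≤ 1 := hp
  norm_num at this

lemma volume_octant_sdiff_ne_zero : volume (octant \ dualWulffBody eta) ≠ 0 := by
  obtain ⟨n, hn, h⟩ := exists_eta_pos
  let O : Set E3 := (⋂ j, {x | 0 < x j}) ∩ {x | inner ℝ x n < eta n}
  have hO : IsOpen O := (isOpen_iInter_of_finite fun j =>
    isOpen_lt continuous_const (by fun_prop)).inter (isOpen_lt (by fun_prop) continuous_const)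
  have hsub : O ⊆ octant \ dualWulffBody eta := fun x hx =>
    ⟨fun j => (mem_iInter.1 hx.1 j : 0 < x j).le, fun hK => (hK n hn).not_gt hx.2⟩
  have hne : O.Nonempty := by
    have hc : Continuous fun t : ℝ => inner ℝ (WithLp.toLp 2 fun _ => t : E3) n := by
      simp only [inner_eq_sum]
      fun_prop
    have h1 : ∀ᶠ t in 𝓝[>] (0 : ℝ), inner ℝ (WithLp.toLp 2 fun _ => t : E3) n < eta n := by
      refine eventually_nhdsWithin_of_eventually_nhds ?_
      refine (hc.tendsto 0).eventually (gt_mem_nhds ?_)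
      simpa [inner_eq_sum] using h
    obtain ⟨t, h2, h3⟩ := (h1.and self_mem_nhdsWithin).exists
    exact ⟨_, mem_iInter.2 fun j => h3, h2⟩
  exact (hO.measure_pos volume hne).trans_le (measure_mono hsub) |>.ne'

lemma dualWulffScale_eta_pos : 0 < dualWulffScale eta :=
  Real.rpow_pos_of_pos
    (ENNReal.toReal_pos volume_octant_sdiff_ne_zero volume_octant_sdiff_ne_top) _

lemma smul_octant {c : ℝ} (hc : 0 < c) : c • octant = octant := by
  ext x
  rw [mem_smul_set_iff_inv_smul_mem₀ hc.ne']
  exact forall_congr' fun j => mul_nonneg_iff_of_pos_left (inv_pos.2 hc)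

theorem volume_octant_sdiff_normalizedBody_eta : volume (octant \ normalizedBody eta) = 1 := by
  have hpos := dualWulffScale_eta_pos
  have h1 : octant \ normalizedBody eta = dualWulffScale eta • (octant \ dualWulffBody eta) := by
    rw [Set.smul_set_sdiff₀ hpos.ne', smul_octant hpos, normalizedBody]
  have hV := ENNReal.toReal_pos volume_octant_sdiff_ne_zero volume_octant_sdiff_ne_top
  have h2 : dualWulffScale eta ^ 3 = (volume (octant \ dualWulffBody eta)).toReal⁻¹ := by
    rw [dualWulffScale, ← Real.rpow_natCast, ← Real.rpow_mul hV.le, ← Real.rpow_neg_one]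
    norm_num
  rw [h1, Measure.addHaar_smul, finrank_euclideanSpace_fin, h2, abs_of_pos (inv_pos.2 hV),
    ENNReal.ofReal_inv_of_pos hV, ENNReal.ofReal_toReal volume_octant_sdiff_ne_top]
  exact ENNReal.inv_mul_cancel volume_octant_sdiff_ne_zero volume_octant_sdiff_ne_top

/-! ### The facets -/

lemma smul_quadrant {c : ℝ} (hc : 0 < c) (i : Fin 3) : c • quadrant i = quadrant i := by
  ext x
  rw [mem_smul_set_iff_inv_smul_mem₀ hc.ne']
  refine and_congr ?_ (forall_congr' fun j => mul_nonneg_iff_of_pos_left (inv_pos.2 hc))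
  simp [hc.ne']

lemma smul_image_embed (c : ℝ) (i : Fin 3) (S : Set E2) :
    c • (embed i '' S) = embed i '' (c • S) := by
  simp only [← image_smul, image_image, embed_smul]

theorem dualWulffSurface_eta_inter_quadrant (i : Fin 3) :
    dualWulffSurface eta ∩ quadrant i = embed i '' (dualWulffScale eta • expRegion) := by
  have hpos := dualWulffScale_eta_pos
  rw [← smul_image_embed, ← dualWulffBody_eta_inter_coordinate_plane,
    ← frontier_dualWulffBody_eta_inter_quadrant, Set.smul_set_inter₀ hpos.ne', smul_quadrant hpos,
    dualWulffSurface]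

theorem isFacet_dualWulffSurface_eta_inter_quadrant (i : Fin 3) :
    IsFacet (normalizedBody eta) (dualWulffSurface eta ∩ quadrant i) := by
  have hpos := dualWulffScale_eta_pos
  refine ⟨EuclideanSpace.single i 1, 0, by simp, fun x hx => ?_, ?_, ?_⟩
  · rw [inner_single]
    have h1 : x ∈ dualWulffScale eta • octant :=
      smul_set_mono dualWulffBody_eta_subset_octant hx
    rw [smul_octant hpos] at h1
    exact h1 i
  · rw [dualWulffSurface_eta_inter_quadrant, ← smul_image_embed,
      ← dualWulffBody_eta_inter_coordinate_plane, Set.smul_set_inter₀ hpos.ne', normalizedBody]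
    congr 1
    ext x
    rw [mem_smul_set_iff_inv_smul_mem₀ hpos.ne', mem_ofPred_eq, mem_ofPred_eq, inner_single]
    simp [hpos.ne']
  · set c := dualWulffScale eta
    let O : Set {x : E3 | inner ℝ (EuclideanSpace.single i (1 : ℝ)) x = 0} :=
      {x | Real.exp (-(c⁻¹ * (x : E3) (i.succAbove 0))) +
        Real.exp (-(c⁻¹ * (x : E3) (i.succAbove 1))) < 1}
    have hO : IsOpen O := isOpen_lt (by fun_prop) continuous_const
    have hsub : O ⊆ (↑) ⁻¹' (dualWulffSurface eta ∩ quadrant i) := by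
      rintro ⟨x, hx⟩ hxO
      have hx' : x i = 0 := by rwa [mem_ofPred_eq, inner_single] at hx
      rw [mem_preimage, dualWulffSurface_eta_inter_quadrant]
      refine ⟨omitCoord i x, ?_, embed_omitCoord hx'⟩
      rw [mem_smul_set_iff_inv_smul_mem₀ hpos.ne']
      have h1 : Real.exp (-(c⁻¹ * x (i.succAbove 0))) +
        Real.exp (-(c⁻¹ * x (i.succAbove 1))) < 1 := hxO
      exact h1.le
    -- The point (1, 1) satisfies the defining inequality strictly, since 2 exp (-1) < 1.
    refine ⟨⟨embed i (c • !₂[1, 1]), ?_⟩, hO.subset_interior_iff.2 hsub ?_⟩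
    · rw [mem_ofPred_eq, inner_single, embed_apply_self]
    · show Real.exp (-(c⁻¹ * embed i (c • !₂[1, 1]) (i.succAbove 0))) +
        Real.exp (-(c⁻¹ * embed i (c • !₂[1, 1]) (i.succAbove 1))) < 1
      rw [embed_apply_succAbove, embed_apply_succAbove]
      have h2 : (2 : ℝ) < Real.exp 1 := by linarith [Real.add_one_lt_exp one_ne_zero]
      have h3 : Real.exp (-1) < 2⁻¹ := by
        rw [Real.exp_neg]
        exact inv_strictAnti₀ (by norm_num) h2
      simp only [PiLp.smul_apply, Matrix.cons_val_zero, Matrix.cons_val_one,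
        smul_eq_mul, mul_one, inv_mul_cancel₀ hpos.ne']
      linarith

theorem frontier_smul_expRegion {c : ℝ} (hc : 0 < c) :
    frontier (c • expRegion) = (c * (π / √6)) • vershikKerov := by
  have hd : 0 < π / √6 := by positivity
  have h1 : frontier (c • expRegion) = c • frontier expRegion :=
    ((Homeomorph.smulOfNeZero c hc.ne').image_frontier expRegion).symm
  rw [h1, frontier_expRegion, mul_smul]
  congr 1
  ext p
  rw [mem_smul_set_iff_inv_smul_mem₀ hd.ne', vershikKerov, mem_ofPred_eq, mem_ofPred_eq]
  have h2 : ∀ k, -(π / √6) * ((π / √6)⁻¹ • p) k = -p k := by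
    intro k
    rw [PiLp.smul_apply, smul_eq_mul, neg_mul, mul_inv_cancel_left₀ hd.ne']
  rw [h2, h2]

end SkyscraperFacets

theorem mainTheorem6 :
    -- the entropy function is well defined: flattest surfaces exist, and the limit
    -- exists and does not depend on the choice of the flattest surface
    (∀ n ∈ sphTriangle, (flattestSurfaces n).Nonempty ∧
      ∀ Q ∈ flattestSurfaces n,
        Tendsto (fun R : ℝ => entropyDensity n Q R) atTop (𝓝 (eta n))) ∧
    -- the derivative of the entropy at `e_z` in each tangential direction `v`
    (∀ v ∈ quarterCircle,
      HasDerivWithinAt (fun θ : ℝ => eta (tilt v θ)) (stairEntropy v) (Set.Ici 0) 0) ∧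
    -- the surface encloses volume one with the boundary of the octant
    volume (octant \ normalizedBody eta) = 1 ∧
    -- the three identical facets and their boundary curves
    ∃ (F : Set E2) (c : ℝ), 0 < c ∧
      (∀ i : Fin 3,
        dualWulffSurface eta ∩ quadrant i = embed i '' F ∧
        IsFacet (normalizedBody eta) (dualWulffSurface eta ∩ quadrant i)) ∧
      frontier F = c • vershikKerov := by
  refine ⟨fun n hn => ⟨⟨_, surf_discretePlane_mem_flattestSurfaces hn⟩,
    fun Q hQ => tendsto_entropyDensity hn hQ⟩, fun v hv => hasDerivWithinAt_eta_tilt hv,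
    volume_octant_sdiff_normalizedBody_eta, dualWulffScale eta • expRegion,
    dualWulffScale eta * (π / √6), mul_pos dualWulffScale_eta_pos (by positivity), fun i =>
      ⟨dualWulffSurface_eta_inter_quadrant i, isFacet_dualWulffSurface_eta_inter_quadrant i⟩,
    frontier_smul_expRegion dualWulffScale_eta_pos⟩
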